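/- **Setting.** Let $M\ge 1$, $n_1,\dots,n_M\ge 1$, $d=n_1+\dots+n_M$, and write $x\in\mathbb R^d$ in blocks $x=(x_1,\dots,x_M)$, $x_k\in\mathbb R^{n_k}$. For $1\le k\le M$ let $p_k>1$, $1/p_k+1/q_k=1$, and let $U_k:[0,\infty)\to\mathbb R$ be convex and increasing, such that $\exp(-U_k(\|x_k\|_{p_k}^{p_k}))$ is a probability density on $\mathbb R^{n_k}$. Let $X=(X_1,\dots,X_M)$ have independent blocks $X_k$ with these densities, and assume that $X$ is isotropic ($\mathbf E X=0$, $\mathrm{Cov}\,X=\mathrm{Id}_d$). Let $Y=(Y_1,\dots,Y_M)$ be the random vector in $\mathbb R^d$ with independent coordinates, those of $Y_k$ having the density $\frac{b_k^{1/p_k}}{2\Gamma(1+1/p_k)}e^{-b_k|x|^{p_k}}$, $b_k=\left(\Gamma(3/p_k)/\Gamma(1/p_k)\right)^{p_k/2}$. Let $V_k$ be distributed according to the cone probability measure on $\partial B_{p_k}^{n_k}=\{x\in\mathbb R^{n_k}:\|x\|_{p_k}=1\}$, and let $R_k,\tilde R_k$ be random variables on $(0,\infty)$ with densities $$|\partial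 B_{p_k}^{n_k}|\,s^{n_k-1}e^{-U_k(s^{p_k})}\quad\text{and}\quad \frac{b_k^{n_k/p_k}}{\frac1{p_k}\Gamma(n_k/p_k)}\,s^{n_k-1}e^{-b_ks^{p_k}},\qquad |\partial B_{p_k}^{n_k}|=\frac{p_k(2\Gamma(1+1/p_k))^{n_k}}{\Gamma(n_k/p_k)} .$$ Put $P_k=R_k/\|R_k\|_2$, $Q_k=\tilde R_k/\|\tilde R_k\|_2$, $W_k=\|R_k\|_2V_k$; here $\|\xi\|_r=(\mathbf E|\xi|^r)^{1/r}$ for a random variable $\xi$ (only the laws of these variables matter below). For $t\in\mathbb R^d$ put $X_t=\langle X,t\rangle$, $Y_t=\langle Y,t\rangle$, $I_k(t)=\{i:\ |t_{k,i}|>0\}$. **Cube-like sets.** Let $C\ge1$, $\delta>0$, and let $0<\rho\le e^{-1}$ satisfy $\rho/\log\frac1\rho=4C\delta$. For $p\ge2$, a finite set $T\subset\mathbb R^d$ is called cube-like if $0\in T$; $e^p\le|T|\le1+e^p$; there are numbers $\kappa_{k,i}\ge\rho$ with $t_{k,i}\in\{0,\kappa_{k,i}\}$ for all $t\in T$ and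 all $k,i$; $\sum_k\sum_{i\in I_k(t)}\kappa_{k,i}\le2C\delta p$ for all $t\in T$; and $\|X_t-X_s\|_p\ge p$ for all distinct $s,t\in T$. **Proposition.** There is a universal constant $K$ such that for every $C\ge1$ there is $\delta_0>0$, depending on $C$ only, such that for all $0<\delta\le\delta_0$, all $X$, $p$, $\rho$ and $T$ as above, and all $s,t\in T$, the following holds, where $a\simeq b$ means $a\le Kb$ and $b\le Ka$, $a\lesssim b$ means $a\le Kb$, and $m_k=|I_k(t)\triangle I_k(s)|$: $$\|X_t-X_s\|_p\simeq\sup\Big\{\sum_{k=1}^M\|P_k\|_{r_k}\|\langle W_k,t_k-s_k\rangle\|_{r_k}1_{r_k\ge m_k}:\ r_k\ge0,\ \sum_{k=1}^Mr_k=p\Big\},$$ $$\|Y_t-Y_s\|_p\simeq\sup\Big\{\sum_{k=1}^M\|Q_k\|_{r_k}\|\langle W_k,t_k-s_k\rangle\|_{r_k}1_{r_k\ge m_k}:\ r_k\ge0,\ \sum_{k=1}^Mr_k=p\Big\}$$ (a summand with $r_k=0$ is read as $0$). Moreover, for every $k$ and every real $r>0$ with $r\ge m_k$, $$\|P_k\|_r\|\langle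 W_k,t_k-s_k\rangle\|_r=\|\langle X_k,t_k-s_k\rangle\|_r\ \lesssim\ \|Q_k\|_r\|\langle W_k,t_k-s_k\rangle\|_r=\|\langle Y_k,t_k-s_k\rangle\|_r\simeq r^{1/p_k}\|t_k-s_k\|_{q_k},$$ and if in addition $r\le n_k$, then also $\|\langle Y_k,t_k-s_k\rangle\|_r\lesssim\|\langle X_k,t_k-s_k\rangle\|_r$. -/

import Mathlib

open MeasureTheory ProbabilityTheory Set
open scoped ENNReal NNReal symmDiff

noncomputable section

namespace RadialProduct

/-- The `ℓ_p` norm `(∑ |x_i|^p)^{1/p}` of `x ∈ ℝⁿ`. -/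
def ellNorm {n : ℕ} (p : ℝ) (x : Fin n → ℝ) : ℝ := (∑ i, |x i| ^ p) ^ (1 / p)

/-- The Euclidean pairing `⟨v, u⟩` on `ℝⁿ`. -/
def dot {n : ℕ} (v u : Fin n → ℝ) : ℝ := ∑ i, v i * u i

/-! ### One block `ℝⁿ` -/

/-- The law of the block `X_k`: the measure on `ℝⁿ` with density `exp (-U (‖x‖_p^p))`. -/
def blockLaw (n : ℕ) (p : ℝ) (U : ℝ → ℝ) : Measure (Fin n → ℝ) :=
  volume.withDensity fun x => ENNReal.ofReal (Real.exp (-U (ellNorm p x ^ p)))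

/-- The constant `b = (Γ(3/p) / Γ(1/p))^{p/2}`. -/
def bConst (p : ℝ) : ℝ := (Real.Gamma (3 / p) / Real.Gamma (1 / p)) ^ (p / 2)

/-- The law of the block `Y_k`, with independent coordinates of density
`b^{1/p} / (2 Γ(1 + 1/p)) * exp (-b |x|^p)`. -/
def blockLawY (n : ℕ) (p : ℝ) : Measure (Fin n → ℝ) :=
  volume.withDensity fun x => ENNReal.ofReal
    (∏ i, bConst p ^ (1 / p) / (2 * Real.Gamma (1 + 1 / p)) *
      Real.exp (-(bConst p * |x i| ^ p)))

/-- The cone (probability) measure on the unit sphere of `ℓ_p^n`: the image of the uniform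
distribution on the unit ball under the radial projection `x ↦ x / ‖x‖_p`. It is the law of
`V_k`. -/
def coneMeasure (n : ℕ) (p : ℝ) : Measure (Fin n → ℝ) :=
  (ProbabilityTheory.cond volume {x : Fin n → ℝ | ellNorm p x ≤ 1}).map
    fun x => (ellNorm p x)⁻¹ • x

/-- The total mass `|∂B_p^n| = p (2 Γ(1 + 1/p))^n / Γ(n/p)` (that is, `n` times the volume of the
unit ball of `ℓ_p^n`) which occurs in the polar integration formula for the cone measure. -/
def sphereMass (n : ℕ) (p : ℝ) : ℝ :=
  p * (2 * Real.Gamma (1 + 1 / p)) ^ n / Real.Gamma (n / p)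

/-- The law of the radial part `R_k` of `X_k`: the measure on `(0, ∞)` with density
`s^{n-1} exp (-U (s^p)) |∂B_p^n|`. -/
def radialLaw (n : ℕ) (p : ℝ) (U : ℝ → ℝ) : Measure ℝ :=
  (volume.restrict (Ioi 0)).withDensity fun s =>
    ENNReal.ofReal (s ^ (n - 1) * Real.exp (-U (s ^ p)) * sphereMass n p)

/-- The law of the radial part `R̃_k` of `Y_k`: the measure on `(0, ∞)` with density
`b^{n/p} / ((1/p) Γ(n/p)) * s^{n-1} exp (-b s^p)`. -/
def radialLawY (n : ℕ) (p : ℝ) : Measure ℝ :=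
  (volume.restrict (Ioi 0)).withDensity fun s =>
    ENNReal.ofReal (bConst p ^ ((n : ℝ) / p) / (1 / p * Real.Gamma (n / p)) *
      (s ^ (n - 1) * Real.exp (-(bConst p * s ^ p))))

/-- The number `‖R‖_2` for a random variable `R` of law `μ`. -/
def l2 (μ : Measure ℝ) : ℝ := (eLpNorm (fun s => s) 2 μ).toReal

/-- `‖P_k‖_r`, where `P_k = R_k / ‖R_k‖_2`. -/
def normP (n : ℕ) (p : ℝ) (U : ℝ → ℝ) (r : ℝ≥0) : ℝ≥0∞ :=
  eLpNorm (fun s => s / l2 (radialLaw n p U)) r (radialLaw n p U)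

/-- `‖Q_k‖_r`, where `Q_k = R̃_k / ‖R̃_k‖_2`. -/
def normQ (n : ℕ) (p : ℝ) (r : ℝ≥0) : ℝ≥0∞ :=
  eLpNorm (fun s => s / l2 (radialLawY n p)) r (radialLawY n p)

/-- `‖⟨W_k, u⟩‖_r`, where `W_k = ‖R_k‖_2 V_k`. -/
def normW (n : ℕ) (p : ℝ) (U : ℝ → ℝ) (u : Fin n → ℝ) (r : ℝ≥0) : ℝ≥0∞ :=
  eLpNorm (fun v => dot (l2 (radialLaw n p U) • v) u) r (coneMeasure n p)

/-! ### The whole space `ℝ^d = ℝ^{n_1} × ⋯ × ℝ^{n_M}` -/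

variable {M : ℕ}

/-- Vectors of `ℝ^d`, `d = n_1 + ⋯ + n_M`, written in blocks: `x k i` is the `i`-th coordinate of
the `k`-th block `x_k`. -/
abbrev Vec (n : Fin M → ℕ) : Type := (k : Fin M) → Fin (n k) → ℝ

/-- The canonical process `X_t(x) = ⟨x, t⟩ = ∑_k ⟨x_k, t_k⟩`. -/
def proc {n : Fin M → ℕ} (t x : Vec n) : ℝ := ∑ k, dot (x k) (t k)

/-- The law of `X = (X_1, …, X_M)`, with independent blocks. -/
def lawX (n : Fin M → ℕ) (p : Fin M → ℝ) (U : Fin M → ℝ → ℝ) : Measure (Vec n) :=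
  Measure.pi fun k => blockLaw (n k) (p k) (U k)

/-- The law of `Y = (Y_1, …, Y_M)`, with independent blocks. -/
def lawY (n : Fin M → ℕ) (p : Fin M → ℝ) : Measure (Vec n) :=
  Measure.pi fun k => blockLawY (n k) (p k)

/-- The standing assumptions on `X`: nonempty blocks, exponents `p_k > 1`, convex increasing `U_k`
on `[0, ∞)` for which `exp (-U_k (‖x_k‖_{p_k}^{p_k}))` is a probability density, and isotropic
position. -/
structure IsStructured (n : Fin M → ℕ) (p : Fin M → ℝ) (U : Fin M → ℝ → ℝ) : Prop where
  block_pos : ∀ k, 1 ≤ n k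
  one_lt : ∀ k, 1 < p k
  convex : ∀ k, ConvexOn ℝ (Ici 0) (U k)
  increasing : ∀ k, MonotoneOn (U k) (Ici 0)
  prob : ∀ k, IsProbabilityMeasure (blockLaw (n k) (p k) (U k))
  mean : ∀ a : (k : Fin M) × Fin (n k), ∫ x, x a.1 a.2 ∂(lawX n p U) = 0
  cov : ∀ a b : (k : Fin M) × Fin (n k),
    covariance (fun x : Vec n => x a.1 a.2) (fun x : Vec n => x b.1 b.2) (lawX n p U) =
      if a = b then 1 else 0

/-- `I_k(t)`, the set of the indices `i` in the `k`-th block with `|t_i| > 0`. -/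
def blockSupp {n : Fin M → ℕ} (t : Vec n) (k : Fin M) : Finset (Fin (n k)) :=
  {i | 0 < |t k i|}

/-- The cube-like sets `T` at the moment order `q`, with parameters `C`, `δ`, `ρ` and
side lengths `κ`. -/
structure IsCubeLike (n : Fin M → ℕ) (p : Fin M → ℝ) (U : Fin M → ℝ → ℝ)
    (C δ ρ q : ℝ) (κ : Vec n) (T : Finset (Vec n)) : Prop where
  order : 2 ≤ q
  card_ge : Real.exp q ≤ T.card
  card_le : (T.card : ℝ) ≤ 1 + Real.exp q
  zero_mem : 0 ∈ T
  rho_pos : 0 < ρ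
  rho_le : ρ ≤ Real.exp (-1)
  rho_eq : ρ / Real.log (1 / ρ) = 4 * C * δ
  side : ∀ k i, ρ ≤ κ k i
  cube : ∀ t ∈ T, ∀ k i, t k i = 0 ∨ t k i = κ k i
  thin : ∀ t ∈ T, ∑ k, ∑ i ∈ blockSupp t k, κ k i ≤ 2 * C * δ * q
  separated : ∀ s ∈ T, ∀ t ∈ T, s ≠ t →
    ENNReal.ofReal q ≤ eLpNorm (fun x => proc t x - proc s x) (ENNReal.ofReal q) (lawX n p U)

/-- `a ≃ b` with constant `K`. -/
def Comparable (K : ℝ≥0) (a b : ℝ≥0∞) : Prop := a ≤ K * b ∧ b ≤ K * a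

/-- `sup { ∑_k N_k(r_k) 1_{r_k ≥ m_k} : r_k ≥ 0, ∑_k r_k = q }`. -/
def supSplit (q : ℝ) (N : Fin M → ℝ≥0 → ℝ≥0∞) (m : Fin M → ℕ) : ℝ≥0∞ :=
  ⨆ (r : Fin M → ℝ≥0) (_ : ∑ k, (r k : ℝ) = q), ∑ k, if (m k : ℝ≥0) ≤ r k then N k (r k) else 0

end RadialProduct

end

/-!
The moments of an increment are those of `∑ k, ⟨X_k, a_k⟩` with `a = t - s`, a sum of independent
symmetric variables, and `m_k` is the number of nonzero coordinates of `a_k`. The argument has three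
ingredients.

*One block.* Polar integration makes the radius and the direction of a block independent, whence
`‖⟨X_k, a⟩‖_r = ‖R_k‖_r ‖⟨V_k, a⟩‖_r` (`eLpNorm_dot_blockLaw`). The block `Y_k` is the special case
of a linear potential (`blockLawY_eq_blockLaw`), with the same law of the direction, and isotropy
forces the two radii to have the same second moment (`eLpNorm_two_radialLaw`); this gives the
identities for single blocks. The comparison of `X_k` and `Y_k` is a comparison of radial moments.
Since `U_k` is convex, the density of `R_k` exceeds a Gamma type density on an interval only, so
among radial parts with a given moment the model one has the largest higher moments
(`moment_le_of_crossing`, `radialDensity_moment_le`), and those are computed with the Gamma function (`gammaMoment_rpow_le`, `le_gammaMoment_rpow`).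

*Linear functionals of the model block.* For `r ≥ m` the `r`-th moment of `⟨Y_k, a⟩` is of the order
`r ^ (1/p) ‖a‖_{p'}`: from above by Hölder's inequality and an exponential moment of
`∑ |y_i| ^ p` over the `m` relevant coordinates (`eLpNorm_dot_blockLawY_le`), from below because the
coordinates follow the vector dual to `a` with probability at least `c ^ r`
(`le_eLpNorm_dot_blockLawY`). Through the polar decomposition this yields the regularity
`‖⟨X_k, a⟩‖_{lr} ≤ B l ^ 2 ‖⟨X_k, a⟩‖_r` for `l ≥ 1` and `r ≥ m` (`eLpNorm_dot_blockLaw_mul_le`).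

*Independent sums.* For symmetric independent `Z_k` with this regularity and `2 ∑ m_k ≤ q`, the
`q`-th moment of the sum is comparable with the supremum over all splittings of `q`. The lower bound
(`supSplit_le_eLpNorm_sum`) makes the summands simultaneously large; the upper bound
(`eLpNorm_sum_le_supSplit`) dominates each `Z_k` by its moment of a random order `m_k + J_k` with
an exponential tail and rescales these orders to the sum `q`. Being cube-like enters only through
the identification of `m_k` with `|I_k(t) △ I_k(s)|` (`IsCubeLike.blockSupp_symmDiff`) and the bound
`2 ∑ m_k ≤ q` (`IsCubeLike.two_mul_sum_card_le`), for which `δ ≤ e ^ (-2) / (8 C)` suffices.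
-/

namespace RadialProduct

/-! ### Bounds for the Gamma function -/

/-- Convexity of `log Γ`, in the form that the increments of `log Γ` over intervals of a given
length increase, the step of length `1` being `log x`. -/
theorem rpow_mul_Gamma_le {x y : ℝ} (hx : 0 < x) (hy : 0 ≤ y) :
    x ^ y * Real.Gamma (x + 1) ≤ Real.Gamma (x + 1 + y) := by
  rcases hy.eq_or_lt with rfl | hy
  · simp
  have hc := Real.convexOn_log_Gamma
  have h := hc.slope_mono_adjacent (x := x) (y := x + 1) (z := x + 1 + y) hx
    (by simp; linarith) (by linarith) (by linarith)
  have hG := Real.Gamma_pos_of_pos hx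
  have hG1 := Real.Gamma_pos_of_pos (show 0 < x + 1 by linarith)
  have hG2 := Real.Gamma_pos_of_pos (show 0 < x + 1 + y by linarith)
  simp only [Function.comp, add_sub_cancel_left, div_one] at h
  rw [le_div_iff₀ hy] at h
  have e : Real.log (Real.Gamma (x + 1)) = Real.log x + Real.log (Real.Gamma x) := by
    rw [Real.Gamma_add_one hx.ne', Real.log_mul hx.ne' hG.ne']
  rw [← Real.log_le_log_iff (by positivity) hG2, Real.log_mul (by positivity) hG1.ne',
    Real.log_rpow hx]
  nlinarith

/-- Convexity of `log Γ` again: the mean slope of `log Γ` on `[x, x + y]` is at most that on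
`[x + y, x + y + 1]`, which is `log (x + y)`. -/
theorem Gamma_add_le {x y : ℝ} (hx : 0 < x) (hy : 0 ≤ y) :
    Real.Gamma (x + y) ≤ (x + y) ^ y * Real.Gamma x := by
  rcases hy.eq_or_lt with rfl | hy
  · simp
  have hc := Real.convexOn_log_Gamma
  have h := hc.slope_mono_adjacent (x := x) (y := x + y) (z := x + y + 1) hx
    (by simp; linarith) (by linarith) (by linarith)
  have hG := Real.Gamma_pos_of_pos hx
  have hxy : 0 < x + y := by linarith
  have hG1 := Real.Gamma_pos_of_pos hxy
  simp only [Function.comp, add_sub_cancel_left, div_one] at h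
  rw [div_le_iff₀ hy, Real.Gamma_add_one hxy.ne', Real.log_mul hxy.ne' hG1.ne'] at h
  rw [← Real.log_le_log_iff hG1 (by positivity), Real.log_mul (by positivity) hG.ne',
    Real.log_rpow hxy]
  nlinarith

/-- Restricting Euler's integral to `(c, ∞)`. -/
theorem rpow_mul_exp_neg_le_Gamma {c y : ℝ} (hc : 0 ≤ c) (hy : 0 ≤ y) :
    c ^ y * Real.exp (-c) ≤ Real.Gamma (1 + y) := by
  rw [Real.Gamma_eq_integral (by linarith)]
  have hint := Real.GammaIntegral_convergent (s := 1 + y) (by linarith)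
  calc c ^ y * Real.exp (-c) = ∫ u in Ioi c, Real.exp (-u) * c ^ y := by
        rw [integral_mul_const, integral_exp_neg_Ioi, mul_comm]
    _ ≤ ∫ u in Ioi c, Real.exp (-u) * u ^ (1 + y - 1) := by
        refine setIntegral_mono_on ?_ (hint.mono_set (Ioi_subset_Ioi hc)) measurableSet_Ioi ?_
        · exact (integrableOn_exp_neg_Ioi c).mul_const _
        · intro u hu
          have : c ≤ u := le_of_lt hu
          rw [add_sub_cancel_left]
          gcongr
    _ ≤ _ := by
        refine setIntegral_mono_set hint ?_ (Ioi_subset_Ioi hc).eventuallyLE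
        filter_upwards [ae_restrict_mem measurableSet_Ioi] with u hu
        have : (0 : ℝ) < u := hu
        simp only [Pi.zero_apply]
        positivity

theorem exp_neg_one_le_Gamma_one_add {y : ℝ} (hy : 0 ≤ y) :
    Real.exp (-1) ≤ Real.Gamma (1 + y) := by
  simpa using rpow_mul_exp_neg_le_Gamma (c := 1) zero_le_one hy

theorem rpow_div_exp_one_le_Gamma {y : ℝ} (hy : 0 ≤ y) :
    (y / Real.exp 1) ^ y ≤ Real.Gamma (1 + y) := by
  have h := rpow_mul_exp_neg_le_Gamma hy hy
  rwa [Real.div_rpow hy (Real.exp_pos _).le, ← Real.exp_mul, one_mul, div_eq_mul_inv,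
    ← Real.exp_neg]

/-- Superadditivity of `y ↦ log Γ(1 + y)`, a convex function which vanishes at `0`. -/
theorem Gamma_one_add_mul_Gamma_one_add_le {x y : ℝ} (hx : 0 ≤ x) (hy : 0 ≤ y) :
    Real.Gamma (1 + y) * Real.Gamma (1 + x) ≤ Real.Gamma (x + 1 + y) := by
  rcases hx.eq_or_lt with rfl | hx
  · simp
  rcases hy.eq_or_lt with rfl | hy
  · simp [add_comm]
  -- four collinear points `1 < 1 + x`, `1 + y < 1 + x + y` with equal sums
  have hc := Real.convexOn_log_Gamma
  have hG1 := Real.Gamma_pos_of_pos (show 0 < 1 + x by linarith)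
  have hG2 := Real.Gamma_pos_of_pos (show 0 < 1 + y by linarith)
  have hG3 := Real.Gamma_pos_of_pos (show 0 < x + 1 + y by linarith)
  have hs : 0 < x + y := by linarith
  have hmem : x + 1 + y ∈ Ioi (0 : ℝ) := by simp; linarith
  have hone : (1 : ℝ) ∈ Ioi (0 : ℝ) := by simp
  have h1 := hc.2 hone hmem (show 0 ≤ y / (x + y) by positivity)
    (show 0 ≤ x / (x + y) by positivity) (by field_simp; ring)
  have h2 := hc.2 hone hmem (show 0 ≤ x / (x + y) by positivity)
    (show 0 ≤ y / (x + y) by positivity) (by field_simp)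
  have e1 : (y / (x + y)) • (1 : ℝ) + (x / (x + y)) • (x + 1 + y) = 1 + x := by
    simp only [smul_eq_mul]; field_simp; ring
  have e2 : (x / (x + y)) • (1 : ℝ) + (y / (x + y)) • (x + 1 + y) = 1 + y := by
    simp only [smul_eq_mul]; field_simp; ring
  rw [e1] at h1
  rw [e2] at h2
  simp only [Function.comp, Real.Gamma_one, Real.log_one, smul_eq_mul, mul_zero, zero_add] at h1 h2
  rw [← Real.log_le_log_iff (by positivity) hG3, Real.log_mul hG2.ne' hG1.ne']
  have : x / (x + y) * Real.log (Real.Gamma (x + 1 + y)) +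
      y / (x + y) * Real.log (Real.Gamma (x + 1 + y)) = Real.log (Real.Gamma (x + 1 + y)) := by
    field_simp
  linarith

theorem Gamma_one_add_le_one {y : ℝ} (hy : 0 ≤ y) (hy1 : y ≤ 1) : Real.Gamma (1 + y) ≤ 1 := by
  have h := Real.convexOn_Gamma.2 (show (1 : ℝ) ∈ Ioi 0 by simp) (show (2 : ℝ) ∈ Ioi 0 by simp)
    (show 0 ≤ 1 - y by linarith) hy (by ring)
  simp only [smul_eq_mul, Real.Gamma_one, Real.Gamma_two] at h
  calc Real.Gamma (1 + y) = Real.Gamma ((1 - y) * 1 + y * 2) := by ring_nf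
    _ ≤ _ := h
    _ = 1 := by ring

theorem Gamma_one_add_le_six {y : ℝ} (hy : 0 ≤ y) (hy1 : y ≤ 3) : Real.Gamma (1 + y) ≤ 6 := by
  have h4 : Real.Gamma 4 = 6 := by
    rw [show (4 : ℝ) = (3 : ℕ) + 1 by norm_num, Real.Gamma_nat_eq_factorial]
    norm_num [Nat.factorial]
  have h := Real.convexOn_Gamma.2 (show (1 : ℝ) ∈ Ioi 0 by simp) (show (4 : ℝ) ∈ Ioi 0 by simp)
    (show 0 ≤ 1 - y / 3 by linarith) (show 0 ≤ y / 3 by positivity) (by ring)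
  simp only [smul_eq_mul, Real.Gamma_one, h4] at h
  calc Real.Gamma (1 + y) = Real.Gamma ((1 - y / 3) * 1 + y / 3 * 4) := by ring_nf
    _ ≤ _ := h
    _ ≤ 6 := by linarith

theorem bConst_pos {p : ℝ} (hp : 0 < p) : 0 < bConst p := by
  unfold bConst
  have := Real.Gamma_pos_of_pos (show 0 < 3 / p by positivity)
  have := Real.Gamma_pos_of_pos (show 0 < 1 / p by positivity)
  positivity

theorem bConst_rpow {p : ℝ} (hp : 0 < p) (e : ℝ) :
    bConst p ^ (e / p) = (Real.Gamma (3 / p) / Real.Gamma (1 / p)) ^ (e / 2) := by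
  have h1 := Real.Gamma_pos_of_pos (show 0 < 3 / p by positivity)
  have h2 := Real.Gamma_pos_of_pos (show 0 < 1 / p by positivity)
  unfold bConst
  rw [← Real.rpow_mul (by positivity)]
  congr 1
  field_simp

theorem Gamma_three_div_div {p : ℝ} (hp : 0 < p) :
    Real.Gamma (3 / p) / Real.Gamma (1 / p) =
      Real.Gamma (1 + 3 / p) / (3 * Real.Gamma (1 + 1 / p)) := by
  rw [add_comm 1 (3 / p), add_comm 1 (1 / p), Real.Gamma_add_one (by positivity),
    Real.Gamma_add_one (by positivity)]
  have h1 := Real.Gamma_pos_of_pos (show 0 < 3 / p by positivity)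
  have h2 := Real.Gamma_pos_of_pos (show 0 < 1 / p by positivity)
  field_simp

/-- The normalization to unit variance changes the scale of the coordinates by a bounded factor
only, uniformly in `p`. -/
theorem bConst_rpow_inv_le {p : ℝ} (hp : 1 < p) : bConst p ^ (1 / p) ≤ 3 := by
  have hp0 : 0 < p := by linarith
  rw [bConst_rpow hp0, Gamma_three_div_div hp0, ← Real.sqrt_eq_rpow]
  apply Real.sqrt_le_iff.2 ⟨by norm_num, ?_⟩
  have h1 := Gamma_one_add_le_six (y := 3 / p) (by positivity) (by
    rw [div_le_iff₀ hp0]; linarith)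
  have h2 := exp_neg_one_le_Gamma_one_add (y := 1 / p) (by positivity)
  have h3 : (1 : ℝ) / 3 ≤ Real.exp (-1) := by
    rw [Real.exp_neg, one_div]
    exact inv_anti₀ (Real.exp_pos _) (by linarith [Real.exp_one_lt_d9])
  rw [div_le_iff₀ (by linarith)]
  linarith

theorem le_bConst_rpow_inv {p : ℝ} (hp : 1 < p) : 1 / 3 ≤ bConst p ^ (1 / p) := by
  have hp0 : 0 < p := by linarith
  rw [bConst_rpow hp0, Gamma_three_div_div hp0, ← Real.sqrt_eq_rpow]
  apply Real.le_sqrt_of_sq_le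
  have h1 := Gamma_one_add_le_one (y := 1 / p) (by positivity) (by
    rw [div_le_iff₀ hp0]; linarith)
  have h0 := Real.Gamma_pos_of_pos (show 0 < 1 + 1 / p by positivity)
  have h2 := exp_neg_one_le_Gamma_one_add (y := 3 / p) (by positivity)
  have h3 : (1 : ℝ) / 3 ≤ Real.exp (-1) := by
    rw [Real.exp_neg, one_div]
    exact inv_anti₀ (Real.exp_pos _) (by linarith [Real.exp_one_lt_d9])
  rw [le_div_iff₀ (by linarith)]
  linarith

/-- The `r`-th moment `Γ((n+r)/p) / Γ(n/p)` of `G^{1/p}` for a variable `G` with the Gamma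
distribution of shape `n/p`. -/
noncomputable def gammaMoment (n : ℕ) (p r : ℝ) : ℝ :=
  Real.Gamma ((n + r) / p) / Real.Gamma (n / p)

theorem gammaMoment_pos {n : ℕ} (hn : 1 ≤ n) {p r : ℝ} (hp : 0 < p) (hr : 0 ≤ r) :
    0 < gammaMoment n p r := by
  have hn' : (0 : ℝ) < n := by exact_mod_cast hn
  exact div_pos (Real.Gamma_pos_of_pos (by positivity)) (Real.Gamma_pos_of_pos (by positivity))

theorem gammaMoment_rpow_le {n : ℕ} (hn : 1 ≤ n) {p r : ℝ} (hp : 0 < p) (hr : 0 < r) :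
    gammaMoment n p r ^ (1 / r) ≤ ((n + r) / p) ^ (1 / p) := by
  have hn' : (0 : ℝ) < n := by exact_mod_cast hn
  have h := Gamma_add_le (x := n / p) (y := r / p) (by positivity) (by positivity)
  rw [← add_div] at h
  have h2 : gammaMoment n p r ≤ ((n + r) / p) ^ (r / p) :=
    (div_le_iff₀ (Real.Gamma_pos_of_pos (by positivity))).2 h
  calc gammaMoment n p r ^ (1 / r) ≤ (((n + r) / p) ^ (r / p)) ^ (1 / r) :=
        Real.rpow_le_rpow (gammaMoment_pos hn hp hr.le).le h2 (by positivity)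
    _ = _ := by
        rw [← Real.rpow_mul (by positivity)]
        congr 1
        field_simp

/-- With `x = n/p` and `y = r/p` this bounds `Γ(x + y) / Γ(x)` from below. For `y ≤ 3x` the
convexity bound `rpow_mul_Gamma_le` is good enough; for larger `y` the factor `Γ(1 + y)`, split off
by `Gamma_one_add_mul_Gamma_one_add_le`, is already of the order `(y/e) ^ y`. -/
theorem le_gammaMoment_rpow {n : ℕ} (hn : 1 ≤ n) {p r : ℝ} (hp : 1 < p) (hr : 1 ≤ r) :
    1 / 12 * ((n + r) / p) ^ (1 / p) ≤ gammaMoment n p r ^ (1 / r) := by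
  have hp0 : 0 < p := by linarith
  have hn' : (1 : ℝ) ≤ n := by exact_mod_cast hn
  set x : ℝ := n / p with hx
  set y : ℝ := r / p with hy
  have hx0 : 0 < x := by positivity
  have hy0 : 0 < y := by positivity
  have hxy : (n + r) / p = x + y := by rw [hx, hy, add_div]
  have e3 : Real.exp 1 ≤ 3 := by linarith [Real.exp_one_lt_d9]
  have hG1 := Real.Gamma_pos_of_pos (show 0 < 1 + x by positivity)
  have hGx := Real.Gamma_pos_of_pos hx0
  have h1 : ((x + y) / 6) ^ y * Real.Gamma (x + 1) ≤ Real.Gamma (x + 1 + y) := by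
    rcases le_total (y / 3) x with h | h
    · refine le_trans ?_ (rpow_mul_Gamma_le hx0 hy0.le)
      rw [add_comm x 1]
      gcongr
      linarith
    · refine le_trans ?_ (Gamma_one_add_mul_Gamma_one_add_le hx0.le hy0.le)
      rw [add_comm x 1]
      gcongr
      refine le_trans ?_ (rpow_div_exp_one_le_Gamma hy0.le)
      gcongr ?_ ^ _
      calc (x + y) / 6 ≤ y / 3 := by linarith
        _ ≤ _ := by gcongr
  have h2 : n / (n + r) * ((x + y) / 6) ^ y ≤ gammaMoment n p r := by
    rw [show x + 1 + y = (x + y) + 1 by ring, Real.Gamma_add_one (s := x + y) (by positivity),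
      Real.Gamma_add_one hx0.ne'] at h1
    unfold gammaMoment
    rw [hxy, le_div_iff₀ hGx]
    have e : (n : ℝ) / (n + r) = x / (x + y) := by
      rw [← hxy, hx]; field_simp
    rw [e, div_mul_eq_mul_div, div_mul_eq_mul_div, div_le_iff₀ (by positivity)]
    linarith
  have h3 : (2 : ℝ)⁻¹ ^ r ≤ n / (n + r) := by
    have hb : 1 + r ≤ 2 ^ r := by
      have := one_add_mul_self_le_rpow_one_add (s := 1) (by norm_num) hr
      norm_num at this
      linarith
    rw [Real.inv_rpow (by norm_num), inv_le_comm₀ (by positivity) (by positivity), inv_div]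
    refine le_trans ?_ hb
    rw [div_le_iff₀ (by positivity)]
    nlinarith
  have h4 : ((2 : ℝ)⁻¹ * ((x + y) / 6) ^ (1 / p)) ^ r ≤ gammaMoment n p r := by
    rw [Real.mul_rpow (by positivity) (by positivity), ← Real.rpow_mul (by positivity),
      one_div_mul_eq_div]
    exact le_trans (mul_le_mul_of_nonneg_right h3 (by positivity)) h2
  rw [hxy]
  calc 1 / 12 * (x + y) ^ (1 / p) ≤ (2 : ℝ)⁻¹ * ((x + y) / 6) ^ (1 / p) := by
        rw [Real.div_rpow (by positivity) (by positivity)]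
        have : (6 : ℝ) ^ (1 / p) ≤ 6 := by
          conv_rhs => rw [← Real.rpow_one 6]
          apply Real.rpow_le_rpow_of_exponent_le (by norm_num)
          rw [div_le_iff₀ hp0]; linarith
        rw [← mul_div_assoc, le_div_iff₀ (by positivity)]
        have h0 : 0 ≤ (x + y) ^ (1 / p) := by positivity
        nlinarith
    _ ≤ _ := by
        rw [one_div r, Real.le_rpow_inv_iff_of_pos (by positivity)
          (gammaMoment_pos hn hp0 (by linarith)).le (by linarith)]
        exact h4

/-- The growth of the moments of the model radial variable. -/
theorem gammaMoment_ratio_le {n : ℕ} (hn : 1 ≤ n) {p r₀ r₁ : ℝ} (hp : 1 < p) (h0 : 1 ≤ r₀)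
    (h1 : r₀ ≤ r₁) :
    gammaMoment n p r₁ ^ (1 / r₁) ≤
      12 * ((n + r₁) / (n + r₀)) ^ (1 / p) * gammaMoment n p r₀ ^ (1 / r₀) := by
  have hp0 : 0 < p := by linarith
  have hn' : (1 : ℝ) ≤ n := by exact_mod_cast hn
  have hr0 : 0 < r₀ := by linarith
  have hr1 : 0 < r₁ := by linarith
  refine (gammaMoment_rpow_le hn hp0 (by linarith)).trans ?_
  have h := le_gammaMoment_rpow hn hp h0
  have e : ((n + r₁) / p) ^ (1 / p) =
      ((n + r₁) / (n + r₀)) ^ (1 / p) * ((n + r₀) / p) ^ (1 / p) := by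
    rw [← Real.mul_rpow (by positivity) (by positivity)]
    congr 1
    field_simp
  rw [e]
  have : 0 ≤ ((n + r₁) / (n + r₀)) ^ (1 / p) := by positivity
  nlinarith

/-! ### Products of functions on product spaces -/

theorem lintegral_pi_prod {M : ℕ} {E : Fin M → Type*} {mE : ∀ i, MeasurableSpace (E i)}
    (μ : ∀ i, Measure (E i)) [∀ i, SigmaFinite (μ i)] (f : ∀ i, E i → ℝ≥0∞)
    (hf : ∀ i, Measurable (f i)) :
    ∫⁻ x, ∏ i, f i (x i) ∂(Measure.pi μ) = ∏ i, ∫⁻ x, f i x ∂(μ i) := by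
  induction M with
  | zero => simp
  | succ M ih =>
    have hm : Measurable fun x : (∀ i, E i) => ∏ i, f i (x i) :=
      Finset.measurable_prod _ fun i _ => (hf i).comp (measurable_pi_apply i)
    have hm2 : Measurable fun x : (∀ i : Fin M, E i.succ) => ∏ i, f i.succ (x i) :=
      Finset.measurable_prod _ fun i _ => (hf i.succ).comp (measurable_pi_apply i)
    have h := (measurePreserving_piFinSuccAbove μ 0).symm
    rw [← h.lintegral_comp hm]
    simp_rw [Fin.prod_univ_succ]
    simp only [Fin.zero_succAbove]
    have := lintegral_prod_mul (μ := μ 0) (ν := Measure.pi fun j : Fin M => μ j.succ)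
      (hf 0).aemeasurable hm2.aemeasurable
    rw [ih (fun i => μ i.succ) (fun i => f i.succ) (fun i => hf _)] at this
    exact this

/-- A product density defines the product measure. -/
theorem withDensity_prod_eq_pi {n : ℕ} (f : ℝ → ℝ≥0∞) (hf : Measurable f)
    [IsProbabilityMeasure (volume.withDensity f)] :
    (volume : Measure (Fin n → ℝ)).withDensity (fun x => ∏ i, f (x i)) =
      Measure.pi fun _ => volume.withDensity f := by
  symm
  refine Measure.pi_eq fun s hs => ?_
  rw [withDensity_apply _ (MeasurableSet.univ_pi hs), ← lintegral_indicator
    (MeasurableSet.univ_pi hs)]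
  simp_rw [withDensity_apply _ (hs _), ← lintegral_indicator (hs _)]
  rw [volume_pi, ← lintegral_pi_prod _ _ fun i => hf.indicator (hs i)]
  congr 1
  ext x
  by_cases hx : x ∈ univ.pi s
  · rw [indicator_of_mem hx]
    exact Finset.prod_congr rfl fun i _ => (indicator_of_mem (hx i trivial) f).symm
  · rw [indicator_of_notMem hx]
    simp only [mem_pi, mem_univ, true_imp_iff, not_forall] at hx
    obtain ⟨i, hi⟩ := hx
    exact (Finset.prod_eq_zero (Finset.mem_univ i) (indicator_of_notMem hi f)).symm

/-! ### The `ℓ_p` norm -/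

theorem ellNorm_nonneg {n : ℕ} (p : ℝ) (x : Fin n → ℝ) : 0 ≤ ellNorm p x := by
  unfold ellNorm; positivity

theorem ellNorm_rpow {n : ℕ} {p : ℝ} (hp : 0 < p) (x : Fin n → ℝ) :
    ellNorm p x ^ p = ∑ i, |x i| ^ p := by
  unfold ellNorm
  rw [← Real.rpow_mul (by positivity), one_div_mul_cancel hp.ne', Real.rpow_one]

theorem measurable_ellNorm {n : ℕ} (p : ℝ) : Measurable (ellNorm p : (Fin n → ℝ) → ℝ) := by
  unfold ellNorm
  fun_prop

theorem abs_le_ellNorm {n : ℕ} {p : ℝ} (hp : 0 < p) (x : Fin n → ℝ) (i : Fin n) :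
    |x i| ≤ ellNorm p x := by
  rw [← Real.rpow_le_rpow_iff (abs_nonneg _) (ellNorm_nonneg p x) hp, ellNorm_rpow hp]
  exact Finset.single_le_sum (f := fun i => |x i| ^ p) (fun i _ => by positivity)
    (Finset.mem_univ i)

theorem ellNorm_zero {n : ℕ} {p : ℝ} (hp : 0 < p) : ellNorm p (0 : Fin n → ℝ) = 0 := by
  simp [ellNorm, Real.zero_rpow hp.ne', hp.ne']

theorem ellNorm_eq_zero {n : ℕ} {p : ℝ} (hp : 0 < p) {x : Fin n → ℝ} :
    ellNorm p x = 0 ↔ x = 0 := by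
  refine ⟨fun h => ?_, fun h => h ▸ ellNorm_zero hp⟩
  ext i
  have := abs_le_ellNorm hp x i
  rw [h] at this
  exact abs_nonpos_iff.1 this

theorem ellNorm_smul {n : ℕ} {p : ℝ} (hp : 0 < p) {c : ℝ} (hc : 0 ≤ c) (x : Fin n → ℝ) :
    ellNorm p (c • x) = c * ellNorm p x := by
  unfold ellNorm
  simp_rw [Pi.smul_apply, smul_eq_mul, abs_mul, abs_of_nonneg hc,
    Real.mul_rpow hc (abs_nonneg _), ← Finset.mul_sum]
  rw [Real.mul_rpow (by positivity) (by positivity), ← Real.rpow_mul hc,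
    mul_one_div_cancel hp.ne', Real.rpow_one]

theorem ellNorm_neg {n : ℕ} (p : ℝ) (x : Fin n → ℝ) : ellNorm p (-x) = ellNorm p x := by
  simp [ellNorm]

theorem dot_smul {n : ℕ} (c : ℝ) (v u : Fin n → ℝ) : dot (c • v) u = c * dot v u := by
  simp [dot, Finset.mul_sum, mul_assoc]

theorem measurable_dot {n : ℕ} (u : Fin n → ℝ) : Measurable fun v => dot v u := by
  unfold dot
  fun_prop

theorem abs_dot_le {n : ℕ} {p : ℝ} (hp : 0 < p) (v u : Fin n → ℝ) :
    |dot v u| ≤ ellNorm p v * ∑ i, |u i| := by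
  unfold dot
  refine (Finset.abs_sum_le_sum_abs _ _).trans ?_
  rw [Finset.mul_sum]
  refine Finset.sum_le_sum fun i _ => ?_
  rw [abs_mul]
  exact mul_le_mul_of_nonneg_right (abs_le_ellNorm hp v i) (abs_nonneg _)

/-! ### Polar integration -/

theorem sphereMass_pos {n : ℕ} (hn : 1 ≤ n) {p : ℝ} (hp : 0 < p) : 0 < sphereMass n p := by
  have hn' : (0 : ℝ) < n := by exact_mod_cast hn
  unfold sphereMass
  have := Real.Gamma_pos_of_pos (show 0 < 1 + 1 / p by positivity)
  have := Real.Gamma_pos_of_pos (show 0 < n / p by positivity)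
  positivity

theorem volume_ellNorm_le_one {n : ℕ} (hn : 1 ≤ n) {p : ℝ} (hp : 1 < p) :
    volume {x : Fin n → ℝ | ellNorm p x ≤ 1} = ENNReal.ofReal (sphereMass n p / n) := by
  have : Nonempty (Fin n) := ⟨⟨0, hn⟩⟩
  have hn' : (0 : ℝ) < n := by exact_mod_cast hn
  have hp0 : 0 < p := by linarith
  have h := volume_sum_rpow_le (ι := Fin n) hp.le 1
  simp only [Fintype.card_fin, ENNReal.ofReal_one, one_pow, one_mul] at h
  change volume {x : Fin n → ℝ | (∑ i, |x i| ^ p) ^ (1 / p) ≤ 1} = _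
  rw [h]
  congr 1
  unfold sphereMass
  rw [Real.Gamma_add_one (s := n / p) (by positivity), add_comm (1 / p)]
  have := Real.Gamma_pos_of_pos (show 0 < n / p by positivity)
  field_simp

theorem setLIntegral_ellNorm_le {n : ℕ} {p : ℝ} (hp : 1 < p)
    (g : (Fin n → ℝ) → ℝ≥0∞) (hg : Measurable g)
    (hg0 : ∀ c : ℝ, 0 < c → ∀ x, g (c • x) = g x) {s : ℝ} (hs : 0 < s) :
    ∫⁻ x in {x | ellNorm p x ≤ s}, g x =
      ENNReal.ofReal (s ^ n) * ∫⁻ x in {x | ellNorm p x ≤ 1}, g x := by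
  have hp0 : 0 < p := by linarith
  have hmeas (c : ℝ) : MeasurableSet {x : Fin n → ℝ | ellNorm p x ≤ c} :=
    measurableSet_le (measurable_ellNorm p) measurable_const
  rw [← lintegral_indicator (hmeas _), ← lintegral_indicator (hmeas _)]
  have h := lintegral_map (μ := (volume : Measure (Fin n → ℝ))) (hg.indicator (hmeas s))
    (measurable_const_smul s)
  rw [Measure.map_addHaar_smul volume hs.ne', lintegral_smul_measure] at h
  have e : ∀ x : Fin n → ℝ, ({x | ellNorm p x ≤ s} : Set (Fin n → ℝ)).indicator g (s • x) =
      ({x | ellNorm p x ≤ 1} : Set (Fin n → ℝ)).indicator g x := by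
    intro x
    have : s • x ∈ {x : Fin n → ℝ | ellNorm p x ≤ s} ↔ x ∈ {x : Fin n → ℝ | ellNorm p x ≤ 1} := by
      simp only [mem_ofPred_eq, ellNorm_smul hp0 hs.le]
      rw [mul_le_iff_le_one_right hs]
    by_cases hx : x ∈ {x : Fin n → ℝ | ellNorm p x ≤ 1}
    · rw [indicator_of_mem hx, indicator_of_mem (this.2 hx), hg0 s hs]
    · rw [indicator_of_notMem hx, indicator_of_notMem (fun h => hx (this.1 h))]
  simp_rw [e] at h
  rw [← h, smul_eq_mul, ← mul_assoc, ← ENNReal.ofReal_mul (by positivity), Module.finrank_fin_fun,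
    abs_of_pos (by positivity), mul_inv_cancel₀ (by positivity), ENNReal.ofReal_one, one_mul]

theorem lintegral_Ioc_pow {n : ℕ} (hn : 1 ≤ n) {a b : ℝ} (ha : 0 ≤ a) (hab : a ≤ b) :
    ∫⁻ s in Ioc a b, ENNReal.ofReal (n * s ^ (n - 1)) = ENNReal.ofReal (b ^ n - a ^ n) := by
  rw [← ofReal_integral_eq_lintegral_ofReal]
  · congr 1
    rw [← intervalIntegral.integral_of_le hab, intervalIntegral.integral_const_mul, integral_pow]
    have : ((n - 1 : ℕ) : ℝ) + 1 = n := by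
      rw [Nat.cast_sub hn]; simp
    rw [this, Nat.sub_add_cancel hn]
    have hn' : (0 : ℝ) < n := by exact_mod_cast hn
    field_simp
  · exact (Continuous.integrableOn_Icc (by fun_prop)).mono_set Ioc_subset_Icc_self
  · filter_upwards [ae_restrict_mem measurableSet_Ioc] with s hs
    have : 0 < s := lt_of_le_of_lt ha hs.1
    simp only [Pi.zero_apply]
    positivity

/-- The distribution of the radius under a density which depends on the direction only: its
distribution function is a multiple of `s ^ n` by homogeneity. -/
theorem map_ellNorm_withDensity {n : ℕ} (hn : 1 ≤ n) {p : ℝ} (hp : 1 < p)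
    (g : (Fin n → ℝ) → ℝ≥0∞) (hg : Measurable g)
    (hg0 : ∀ c : ℝ, 0 < c → ∀ x, g (c • x) = g x)
    (hfin : ∫⁻ x in {x | ellNorm p x ≤ 1}, g x ≠ ∞) :
    ((volume : Measure (Fin n → ℝ)).withDensity g).map (ellNorm p) =
      (∫⁻ x in {x | ellNorm p x ≤ 1}, g x) •
        (volume.restrict (Ioi 0)).withDensity fun s : ℝ => ENNReal.ofReal (n * s ^ (n - 1)) := by
  have hp0 : 0 < p := by linarith
  have hmeas (c : ℝ) : MeasurableSet {x : Fin n → ℝ | ellNorm p x ≤ c} :=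
    measurableSet_le (measurable_ellNorm p) measurable_const
  set η := ((volume : Measure (Fin n → ℝ)).withDensity g).map (ellNorm p) with hη
  set c := ∫⁻ x in {x : Fin n → ℝ | ellNorm p x ≤ 1}, g x with hc
  have hpre (s : ℝ) : ellNorm p ⁻¹' Iic s = {x : Fin n → ℝ | ellNorm p x ≤ s} := rfl
  have : Nonempty (Fin n) := ⟨⟨0, hn⟩⟩
  have hη_pos : ∀ s, 0 ≤ s → η (Iic s) = ENNReal.ofReal (s ^ n) * c := by
    intro s hs
    rw [hη, Measure.map_apply (measurable_ellNorm p) measurableSet_Iic, hpre,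
      withDensity_apply _ (hmeas s)]
    rcases hs.eq_or_lt with rfl | hs
    · have : {x : Fin n → ℝ | ellNorm p x ≤ 0} = {0} := by
        ext x
        simp only [mem_ofPred_eq, mem_singleton_iff]
        rw [← ellNorm_eq_zero hp0]
        exact ⟨fun h => le_antisymm h (ellNorm_nonneg p x), fun h => h.le⟩
      rw [this, zero_pow (by omega)]
      simp
    · exact setLIntegral_ellNorm_le hp g hg hg0 hs
  have hη_fin : ∀ s, η (Iic s) ≠ ∞ := by
    intro s
    refine ne_top_of_le_ne_top ?_ (measure_mono (Iic_subset_Iic.2 (le_max_left s 0)))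
    rw [hη_pos _ (le_max_right _ _)]
    exact ENNReal.mul_ne_top ENNReal.ofReal_ne_top hfin
  have : IsLocallyFiniteMeasure η := ⟨fun x => ⟨Iic (x + 1), Iic_mem_nhds (by linarith),
    (hη_fin _).lt_top⟩⟩
  refine Measure.ext_of_Ioc η _ fun a b hab => ?_
  have hIoc : ∀ a b : ℝ, 0 ≤ a → a ≤ b → η (Ioc a b) = c * ENNReal.ofReal (b ^ n - a ^ n) := by
    intro a b ha hab
    have hd : Ioc a b = Iic b \ Iic a := by
      ext x
      simp [and_comm]
    rw [hd, measure_sdiff (Iic_subset_Iic.2 hab) measurableSet_Iic.nullMeasurableSet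
      (hη_fin a), hη_pos _ ha, hη_pos _ (ha.trans hab), ENNReal.ofReal_sub _ (by positivity),
      ENNReal.mul_sub (fun _ _ => hfin), mul_comm c, mul_comm c]
  have hsplit : η (Ioc a b) = η (Ioc (max a 0) (max b 0)) := by
    have h0 : η (Iic 0) = 0 := by
      rw [hη_pos _ le_rfl, zero_pow (by omega)]; simp
    apply measure_congr
    have h0' : ∀ᵐ x ∂η, x ∉ Iic 0 := measure_eq_zero_iff_ae_notMem.1 h0
    filter_upwards [h0'] with x hx
    have hx' : 0 < x := by simpa using hx
    apply propext
    change (a < x ∧ x ≤ b) ↔ (max a 0 < x ∧ x ≤ max b 0)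
    simp [hx', not_le.2 hx']
  rw [hsplit, hIoc _ _ (le_max_right _ _) (max_le_max_right _ hab.le), Measure.smul_apply,
    smul_eq_mul, withDensity_apply _ measurableSet_Ioc, Measure.restrict_restrict measurableSet_Ioc,
    ← lintegral_Ioc_pow hn (le_max_right _ _) (max_le_max_right _ hab.le)]
  congr 3
  ext x
  simp only [mem_Ioc, mem_inter_iff, mem_Ioi, max_lt_iff, le_max_iff]
  constructor
  · rintro ⟨⟨h1, h2⟩, h3 | h3⟩
    · exact ⟨⟨h1, h3⟩, h2⟩
    · linarith
  · rintro ⟨⟨h1, h2⟩, h3⟩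
    exact ⟨⟨h1, h3⟩, Or.inl h2⟩

theorem inv_ellNorm_smul_pos_smul {n : ℕ} {p : ℝ} (hp : 0 < p) {c : ℝ} (hc : 0 < c)
    (x : Fin n → ℝ) : (ellNorm p (c • x))⁻¹ • (c • x) = (ellNorm p x)⁻¹ • x := by
  rw [ellNorm_smul hp hc.le, smul_smul]
  congr 1
  field_simp

/-- Polar integration with respect to the cone measure. -/
theorem lintegral_polar {n : ℕ} (hn : 1 ≤ n) {p : ℝ} (hp : 1 < p) {φ : ℝ → ℝ≥0∞}
    (hφ : Measurable φ) {g : (Fin n → ℝ) → ℝ≥0∞} (hg : Measurable g) {B : ℝ≥0∞} (hB : B ≠ ∞)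
    (hgB : ∀ x, g ((ellNorm p x)⁻¹ • x) ≤ B) :
    ∫⁻ x, φ (ellNorm p x) * g ((ellNorm p x)⁻¹ • x) =
      (∫⁻ s in Ioi 0, φ s * ENNReal.ofReal (s ^ (n - 1) * sphereMass n p)) *
        ∫⁻ v, g v ∂(coneMeasure n p) := by
  have hp0 : 0 < p := by linarith
  have hn' : (0 : ℝ) < n := by exact_mod_cast hn
  have hN := measurable_ellNorm (n := n) p
  have hdir : Measurable fun x : Fin n → ℝ => (ellNorm p x)⁻¹ • x := hN.inv.smul measurable_id
  have hgd : Measurable fun x : Fin n → ℝ => g ((ellNorm p x)⁻¹ • x) := hg.comp hdir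
  have hvol := volume_ellNorm_le_one hn hp
  have hS := sphereMass_pos hn hp0
  have hmap := map_ellNorm_withDensity hn hp (fun x => g ((ellNorm p x)⁻¹ • x)) hgd
    (fun c hc x => by rw [inv_ellNorm_smul_pos_smul hp0 hc]) (by
      refine ne_top_of_le_ne_top ?_ (lintegral_mono hgB)
      rw [setLIntegral_const, hvol]
      exact ENNReal.mul_ne_top hB ENNReal.ofReal_ne_top)
  have h1 : ∫⁻ x, φ (ellNorm p x) * g ((ellNorm p x)⁻¹ • x) =
      ∫⁻ s, φ s ∂(((volume : Measure (Fin n → ℝ)).withDensity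
        fun x => g ((ellNorm p x)⁻¹ • x)).map (ellNorm p)) := by
    rw [lintegral_map hφ hN, lintegral_withDensity_eq_lintegral_mul _ hgd
      (g := fun x => φ (ellNorm p x)) (hφ.comp hN)]
    simp [mul_comm]
  have hm : Measurable fun s : ℝ => ENNReal.ofReal (n * s ^ (n - 1)) := by fun_prop
  have h2 : ∫⁻ v, g v ∂(coneMeasure n p) = (ENNReal.ofReal (sphereMass n p / n))⁻¹ *
      ∫⁻ x in {x | ellNorm p x ≤ 1}, g ((ellNorm p x)⁻¹ • x) := by
    unfold coneMeasure ProbabilityTheory.cond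
    rw [lintegral_map hg hdir, lintegral_smul_measure, hvol, smul_eq_mul]
  rw [h1, hmap, lintegral_smul_measure, lintegral_withDensity_eq_lintegral_mul _ hm hφ, h2,
    smul_eq_mul]
  have h3 : ∫⁻ s in Ioi (0 : ℝ), φ s * ENNReal.ofReal (s ^ (n - 1) * sphereMass n p) =
      ENNReal.ofReal (sphereMass n p / n) *
        ∫⁻ s in Ioi (0 : ℝ), ((fun s : ℝ => ENNReal.ofReal (n * s ^ (n - 1))) * φ) s := by
    rw [← lintegral_const_mul _ (hm.mul hφ)]
    refine lintegral_congr fun s => ?_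
    simp only [Pi.mul_apply]
    rw [← mul_assoc, ← ENNReal.ofReal_mul (by positivity), mul_comm]
    congr 2
    field_simp
  rw [h3]
  have h4 : ENNReal.ofReal (sphereMass n p / n) ≠ 0 := by
    simp only [ne_eq, ENNReal.ofReal_eq_zero, not_le]; positivity
  rw [mul_mul_mul_comm, ENNReal.mul_inv_cancel h4 ENNReal.ofReal_ne_top, one_mul, mul_comm]

theorem measurable_exp_neg_comp {U : ℝ → ℝ} (hU : MonotoneOn U (Ici 0)) (p : ℝ) :
    Measurable fun s : ℝ => ENNReal.ofReal (Real.exp (-U (max (s ^ p) 0))) := by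
  have : Monotone fun y => U (max y 0) := fun a b hab =>
    hU (le_max_right a 0) (le_max_right b 0) (max_le_max_right 0 hab)
  have h2 : Measurable fun s : ℝ => U (max (s ^ p) 0) :=
    this.measurable.comp (measurable_id.pow_const p)
  exact (Real.measurable_exp.comp h2.neg).ennreal_ofReal

theorem blockLaw_eq (n : ℕ) {p : ℝ} (U : ℝ → ℝ) :
    blockLaw n p U = (volume : Measure (Fin n → ℝ)).withDensity fun x =>
      ENNReal.ofReal (Real.exp (-U (max (ellNorm p x ^ p) 0))) := by
  unfold blockLaw
  congr 1
  ext x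
  rw [max_eq_left (Real.rpow_nonneg (ellNorm_nonneg p x) p)]

theorem lintegral_radialLaw {n : ℕ} {p : ℝ} {U : ℝ → ℝ}
    (hU : MonotoneOn U (Ici 0)) {f : ℝ → ℝ≥0∞} (hf : Measurable f) :
    ∫⁻ s, f s ∂(radialLaw n p U) = ∫⁻ s in Ioi 0,
      ENNReal.ofReal (s ^ (n - 1) * Real.exp (-U (s ^ p)) * sphereMass n p) * f s := by
  have hd := measurable_exp_neg_comp hU p
  have h : radialLaw n p U = (volume.restrict (Ioi 0)).withDensity fun s =>
      ENNReal.ofReal (Real.exp (-U (max (s ^ p) 0))) *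
        ENNReal.ofReal (s ^ (n - 1) * sphereMass n p) := by
    unfold radialLaw
    refine withDensity_congr_ae ?_
    filter_upwards [ae_restrict_mem measurableSet_Ioi] with s hs
    have : (0 : ℝ) < s := hs
    rw [← ENNReal.ofReal_mul (by positivity), max_eq_left (by positivity)]
    congr 1
    ring
  have hd2 : Measurable fun s : ℝ => ENNReal.ofReal (Real.exp (-U (max (s ^ p) 0))) *
      ENNReal.ofReal (s ^ (n - 1) * sphereMass n p) := hd.mul (by fun_prop)
  rw [h, lintegral_withDensity_eq_lintegral_mul _ hd2 hf]
  refine setLIntegral_congr_fun measurableSet_Ioi fun s hs => ?_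
  have : (0 : ℝ) < s := hs
  simp only [Pi.mul_apply]
  rw [← ENNReal.ofReal_mul (by positivity), max_eq_left (by positivity)]
  congr 2
  ring

/-- Radius and direction of a block are independent, so the moments of its linear functionals
factor. -/
theorem eLpNorm_dot_blockLaw {n : ℕ} (hn : 1 ≤ n) {p : ℝ} (hp : 1 < p) {U : ℝ → ℝ}
    (hU : MonotoneOn U (Ici 0)) (u : Fin n → ℝ) (r : ℝ≥0) :
    eLpNorm (fun x => dot x u) r (blockLaw n p U) =
      eLpNorm (fun s => s) r (radialLaw n p U) *
        eLpNorm (fun v => dot v u) r (coneMeasure n p) := by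
  rcases eq_or_ne r 0 with rfl | hr
  · simp
  have hp0 : 0 < p := by linarith
  have hr0 : (0 : ℝ) < r := by positivity
  have hN := measurable_ellNorm (n := n) p
  have hd := measurable_exp_neg_comp hU p
  have hdot := measurable_dot u
  rw [eLpNorm_eq_lintegral_rpow_enorm_toReal (by simpa) (by simp),
    eLpNorm_eq_lintegral_rpow_enorm_toReal (by simpa) (by simp),
    eLpNorm_eq_lintegral_rpow_enorm_toReal (by simpa) (by simp),
    ← ENNReal.mul_rpow_of_nonneg _ _ (by positivity)]
  congr 1
  simp only [ENNReal.coe_toReal]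
  have hpolar := lintegral_polar hn hp (φ := fun s =>
      ENNReal.ofReal (Real.exp (-U (max (s ^ p) 0))) * ‖s‖ₑ ^ (r : ℝ))
    (hd.mul (by fun_prop)) (g := fun v => ‖dot v u‖ₑ ^ (r : ℝ)) (by fun_prop)
    (B := ENNReal.ofReal (∑ i, |u i|) ^ (r : ℝ))
    (ENNReal.rpow_ne_top_of_nonneg hr0.le ENNReal.ofReal_ne_top) (fun x => by
      refine ENNReal.rpow_le_rpow ?_ hr0.le
      rw [Real.enorm_eq_ofReal_abs]
      refine ENNReal.ofReal_le_ofReal ((abs_dot_le hp0 _ _).trans ?_)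
      rw [ellNorm_smul hp0 (inv_nonneg.2 (ellNorm_nonneg p x))]
      refine mul_le_of_le_one_left (by positivity) (inv_mul_le_one))
  rw [blockLaw_eq, lintegral_withDensity_eq_lintegral_mul _ (by exact hd.comp hN) (by fun_prop),
    lintegral_radialLaw hU (by fun_prop)]
  convert hpolar using 1
  · refine lintegral_congr fun x => ?_
    simp only [Pi.mul_apply]
    rw [mul_assoc, ← ENNReal.mul_rpow_of_nonneg _ _ hr0.le, ← enorm_mul, dot_smul, ← mul_assoc]
    rcases eq_or_ne x 0 with rfl | hx
    · simp [dot]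
    · rw [mul_inv_cancel₀ (by rwa [ne_eq, ellNorm_eq_zero hp0]), one_mul]
  · congr 1
    refine setLIntegral_congr_fun measurableSet_Ioi fun s hs => ?_
    have : (0 : ℝ) < s := hs
    rw [mul_right_comm (ENNReal.ofReal (Real.exp _)), ← ENNReal.ofReal_mul (by positivity),
      max_eq_left (by positivity)]
    congr 2
    ring

/-- The total mass of the radial law is the total mass of the block. -/
theorem radialLaw_univ {n : ℕ} (hn : 1 ≤ n) {p : ℝ} (hp : 1 < p) {U : ℝ → ℝ}
    (hU : MonotoneOn U (Ici 0)) : radialLaw n p U univ = blockLaw n p U univ := by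
  have hp0 : 0 < p := by linarith
  have hn' : (0 : ℝ) < n := by exact_mod_cast hn
  have hN := measurable_ellNorm (n := n) p
  have hd := measurable_exp_neg_comp hU p
  have hpolar := lintegral_polar hn hp hd (g := fun _ => 1) measurable_const
    (B := 1) (by simp) (fun x => le_rfl)
  have hvol := volume_ellNorm_le_one hn hp
  have hS := sphereMass_pos hn hp0
  have hcone : coneMeasure n p univ = 1 := by
    have : IsProbabilityMeasure
        (ProbabilityTheory.cond volume {x : Fin n → ℝ | ellNorm p x ≤ 1}) := by
      apply cond_isProbabilityMeasure_of_finite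
      · rw [hvol, ne_eq, ENNReal.ofReal_eq_zero, not_le]; positivity
      · rw [hvol]; exact ENNReal.ofReal_ne_top
    unfold coneMeasure
    have hdir : Measurable fun x : Fin n → ℝ => (ellNorm p x)⁻¹ • x := hN.inv.smul measurable_id
    rw [Measure.map_apply hdir MeasurableSet.univ]
    simp
  rw [← lintegral_one, lintegral_radialLaw hU measurable_const, blockLaw_eq,
    withDensity_apply _ MeasurableSet.univ, Measure.restrict_univ]
  simp only [mul_one, lintegral_const, hcone] at hpolar ⊢
  rw [hpolar]
  refine setLIntegral_congr_fun measurableSet_Ioi fun s hs => ?_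
  have : (0 : ℝ) < s := hs
  rw [← ENNReal.ofReal_mul (by positivity), max_eq_left (by positivity)]
  congr 1
  ring

/-! ### Comparison of moments of densities which cross twice -/

/-- The chord of the convex function `t ↦ t ^ (r₁ / r₀)` at `t = s ^ r₀`. -/
theorem exists_interpolation {r₀ r₁ s₁ s₂ : ℝ} (h0 : 0 < r₀) (h1 : r₀ < r₁) (hs₁ : 0 ≤ s₁)
    (hs : s₁ < s₂) : ∃ A B : ℝ, ∀ s, 0 < s →
      ((s₁ ≤ s → s ≤ s₂ → s ^ r₁ ≤ A * s ^ r₀ + B) ∧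
        (s ≤ s₁ ∨ s₂ ≤ s → A * s ^ r₀ + B ≤ s ^ r₁)) := by
  have hc : ConvexOn ℝ (Ici 0) fun t : ℝ => t ^ (r₁ / r₀) :=
    convexOn_rpow ((one_le_div h0).2 h1.le)
  have hs₂ : 0 < s₂ := by linarith
  set t₁ := s₁ ^ r₀ with ht₁
  set t₂ := s₂ ^ r₀ with ht₂
  have ht : t₁ < t₂ := Real.rpow_lt_rpow hs₁ hs h0
  have ht₁0 : 0 ≤ t₁ := by positivity
  set A := (t₂ ^ (r₁ / r₀) - t₁ ^ (r₁ / r₀)) / (t₂ - t₁) with hA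
  have hA' : A * (t₂ - t₁) = t₂ ^ (r₁ / r₀) - t₁ ^ (r₁ / r₀) :=
    div_mul_cancel₀ _ (by linarith)
  refine ⟨A, t₁ ^ (r₁ / r₀) - A * t₁, fun s hs0 => ?_⟩
  have e : s ^ r₁ = (s ^ r₀) ^ (r₁ / r₀) := by
    rw [← Real.rpow_mul hs0.le, mul_div_cancel₀ _ h0.ne']
  have hsr : 0 ≤ s ^ r₀ := by positivity
  rw [e]
  constructor
  · intro ha hb
    have ha' : t₁ ≤ s ^ r₀ := Real.rpow_le_rpow hs₁ ha h0.le
    have hb' : s ^ r₀ ≤ t₂ := Real.rpow_le_rpow hs0.le hb h0.le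
    rcases ha'.eq_or_lt with ha' | ha'
    · rw [← ha']; linarith
    rcases hb'.eq_or_lt with hb' | hb'
    · rw [hb']; linarith
    have := hc.slope_mono_adjacent ht₁0 (ht₁0.trans ht.le) ha' hb'
    rw [div_le_div_iff₀ (by linarith) (by linarith)] at this
    nlinarith
  · rintro (ha | hb)
    · have ha' : s ^ r₀ ≤ t₁ := Real.rpow_le_rpow hs0.le ha h0.le
      rcases ha'.eq_or_lt with ha' | ha'
      · rw [ha']; linarith
      have := hc.slope_mono_adjacent hsr (ht₁0.trans ht.le) ha' ht
      rw [← hA, div_le_iff₀ (by linarith)] at this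
      linarith
    · have hb' : t₂ ≤ s ^ r₀ := Real.rpow_le_rpow hs₂.le hb h0.le
      rcases hb'.eq_or_lt with hb' | hb'
      · rw [← hb']; linarith
      have := hc.slope_mono_adjacent ht₁0 hsr ht hb'
      rw [← hA, le_div_iff₀ (by linarith)] at this
      linarith

/-- Two densities with the same mass and the same `r₀`-th moment: if the one exceeds the other on
an interval `[s₁, s₂]` only, then its higher moments are smaller. Indeed `s ^ r₁` lies below its
chord `A s ^ r₀ + B` through the endpoints on this interval and above it elsewhere, so that
`(s ^ r₁ - A s ^ r₀ - B) (f - g) ≤ 0`, and the chord contributes nothing to the integral. -/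
theorem moment_le_of_crossing {μ : Measure ℝ} [NullSingletonClass μ]
    (hμ : ∀ᵐ s ∂μ, 0 < s) {f g : ℝ → ℝ} {r₀ r₁ : ℝ} (h0 : 0 < r₀) (h1 : r₀ < r₁)
    (hf_nonneg : ∀ s, 0 < s → 0 ≤ f s)
    (hg_nonneg : ∀ s, 0 < s → 0 ≤ g s) (hf : Integrable f μ) (hg : Integrable g μ)
    (hf0 : Integrable (fun s => s ^ r₀ * f s) μ) (hg0 : Integrable (fun s => s ^ r₀ * g s) μ)
    (hg1 : Integrable (fun s => s ^ r₁ * g s) μ) (hmass : ∫ s, f s ∂μ = ∫ s, g s ∂μ)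
    (hmom : ∫ s, s ^ r₀ * f s ∂μ = ∫ s, s ^ r₀ * g s ∂μ)
    (hJ : OrdConnected {s | 0 < s ∧ g s ≤ f s}) :
    Integrable (fun s => s ^ r₁ * f s) μ ∧ ∫ s, s ^ r₁ * f s ∂μ ≤ ∫ s, s ^ r₁ * g s ∂μ := by
  have hr1 : 0 < r₁ := h0.trans h1
  -- the conclusion is an equality for densities which agree almost everywhere
  have htriv : f =ᵐ[μ] g →
      Integrable (fun s => s ^ r₁ * f s) μ ∧ ∫ s, s ^ r₁ * f s ∂μ ≤ ∫ s, s ^ r₁ * g s ∂μ := by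
    intro h
    have h' : (fun s => s ^ r₁ * f s) =ᵐ[μ] fun s => s ^ r₁ * g s := by
      filter_upwards [h] with s hs
      rw [hs]
    exact ⟨hg1.congr h'.symm, (integral_congr_ae h').le⟩
  set J := {s | 0 < s ∧ g s ≤ f s} with hJdef
  have hnotJ : ∀ s, 0 < s → s ∉ J → f s < g s := fun s hs h => by
    by_contra h'
    exact h ⟨hs, not_lt.1 h'⟩
  have hle_triv : f ≤ᵐ[μ] g → f =ᵐ[μ] g := fun h =>
    (integral_eq_iff_of_ae_le hf hg h).1 hmass
  have hne : ∀ a : ℝ, ∀ᵐ s ∂μ, s ≠ a := fun a => by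
    rw [ae_iff]
    simp
  rcases J.eq_empty_or_nonempty with hempty | hnon
  · refine htriv (hle_triv ?_)
    filter_upwards [hμ] with s hs
    exact (hnotJ s hs (by simp [hempty])).le
  have hbb : BddBelow J := ⟨0, fun s hs => hs.1.le⟩
  set s₁ := sInf J with hs₁
  have hs₁0 : 0 ≤ s₁ := le_csInf hnon fun s hs => hs.1.le
  by_cases hba : BddAbove J
  swap
  · -- a single crossing contradicts the equality of the moments, unless the densities agree
    have hin : ∀ s, s₁ < s → s ∈ J := by
      intro s hs
      obtain ⟨a, ha, has⟩ := exists_lt_of_csInf_lt hnon hs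
      rw [not_bddAbove_iff] at hba
      obtain ⟨b, hb, hsb⟩ := hba s
      exact hJ.out ha hb ⟨has.le, hsb.le⟩
    have hout : ∀ s, 0 < s → s < s₁ → f s < g s := fun s hs hlt =>
      hnotJ s hs fun h => absurd (csInf_le hbb h) (not_le.2 hlt)
    have hint : Integrable (fun s => (s ^ r₀ - s₁ ^ r₀) * (f s - g s)) μ := by
      have := ((hf0.sub hg0).sub ((hf.sub hg).const_mul (s₁ ^ r₀)))
      refine this.congr (Filter.Eventually.of_forall fun s => ?_)
      simp only [Pi.sub_apply]
      ring
    have hzero : ∫ s, (s ^ r₀ - s₁ ^ r₀) * (f s - g s) ∂μ = 0 := by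
      have e : (fun s => (s ^ r₀ - s₁ ^ r₀) * (f s - g s)) = fun s =>
          (s ^ r₀ * f s - s ^ r₀ * g s) - s₁ ^ r₀ * (f s - g s) := by
        ext s; ring
      have i1 : Integrable (fun s => s ^ r₀ * f s - s ^ r₀ * g s) μ := hf0.sub hg0
      have i2 : Integrable (fun s => s₁ ^ r₀ * (f s - g s)) μ := (hf.sub hg).const_mul _
      rw [e, integral_sub i1 i2, integral_sub hf0 hg0,
        integral_const_mul, integral_sub hf hg, hmass, hmom]
      simp
    have hpos : 0 ≤ᵐ[μ] fun s => (s ^ r₀ - s₁ ^ r₀) * (f s - g s) := by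
      filter_upwards [hμ, hne s₁] with s hs hs'
      simp only [Pi.zero_apply]
      rcases lt_or_gt_of_ne hs' with h | h
      · have := Real.rpow_le_rpow hs.le h.le h0.le
        exact mul_nonneg_of_nonpos_of_nonpos (by linarith) (by linarith [hout s hs h])
      · have := Real.rpow_le_rpow hs₁0 h.le h0.le
        exact mul_nonneg (by linarith) (by linarith [(hin s h).2])
    have := (integral_eq_zero_iff_of_nonneg_ae hpos hint).1 hzero
    refine htriv ?_
    filter_upwards [this, hμ, hne s₁] with s hs hs0 hs'
    simp only [Pi.zero_apply, mul_eq_zero, sub_eq_zero] at hs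
    rcases hs with hs | hs
    · exact absurd ((Real.rpow_left_inj hs0.le hs₁0 h0.ne').1 hs) hs'
    · exact hs
  set s₂ := sSup J with hs₂
  have h12 : s₁ ≤ s₂ := csInf_le_csSup hnon hbb hba
  have hs₂0 : 0 ≤ s₂ := hs₁0.trans h12
  have hJsub : ∀ s, s ∈ J → s₁ ≤ s ∧ s ≤ s₂ := fun s hs => ⟨csInf_le hbb hs, le_csSup hba hs⟩
  have hJsup : ∀ s, s₁ < s → s < s₂ → s ∈ J := by
    intro s h h'
    obtain ⟨a, ha, has⟩ := exists_lt_of_csInf_lt hnon h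
    obtain ⟨b, hb, hsb⟩ := exists_lt_of_lt_csSup hnon h'
    exact hJ.out ha hb ⟨has.le, hsb.le⟩
  rcases h12.eq_or_lt with heq | hlt
  · refine htriv (hle_triv ?_)
    filter_upwards [hμ, hne s₁] with s hs hs'
    refine (hnotJ s hs fun h => hs' ?_).le
    have := hJsub s h
    rw [← heq] at this
    exact le_antisymm this.2 this.1
  obtain ⟨A, B, hAB⟩ := exists_interpolation h0 h1 hs₁0 hlt
  have hint : Integrable (fun s => s ^ r₁ * f s) μ := by
    refine Integrable.mono' (hg1.add (hf.const_mul (s₂ ^ r₁))) ?_ ?_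
    · exact ((measurable_id.pow_const r₁).aestronglyMeasurable).mul hf.aestronglyMeasurable
    · filter_upwards [hμ] with s hs
      have hfs := hf_nonneg s hs
      have hgs := hg_nonneg s hs
      have hsr : 0 ≤ s ^ r₁ := by positivity
      rw [Real.norm_of_nonneg (by positivity)]
      simp only [Pi.add_apply]
      by_cases h : s ∈ J
      · have := Real.rpow_le_rpow hs.le (hJsub s h).2 hr1.le
        nlinarith [mul_le_mul_of_nonneg_right this hfs, mul_nonneg hsr hgs]
      · have h3 := hnotJ s hs h
        have : 0 ≤ s₂ ^ r₁ := by positivity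
        nlinarith [mul_le_mul_of_nonneg_left h3.le hsr, mul_nonneg this hfs]
  refine ⟨hint, ?_⟩
  have hle : ∫ s, (s ^ r₁ * f s - (A * (s ^ r₀ * f s) + B * f s)) ∂μ ≤
      ∫ s, (s ^ r₁ * g s - (A * (s ^ r₀ * g s) + B * g s)) ∂μ := by
    refine integral_mono_ae (hint.sub ((hf0.const_mul A).add (hf.const_mul B)))
      (hg1.sub ((hg0.const_mul A).add (hg.const_mul B))) ?_
    filter_upwards [hμ, hne s₁, hne s₂] with s hs hs1 hs2
    have hs_AB := hAB s hs
    have key : (s ^ r₁ - (A * s ^ r₀ + B)) * (f s - g s) ≤ 0 := by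
      by_cases h : s ∈ J
      · have := hs_AB.1 (hJsub s h).1 (hJsub s h).2
        exact mul_nonpos_of_nonpos_of_nonneg (by linarith) (by linarith [h.2])
      · have hor : s ≤ s₁ ∨ s₂ ≤ s := by
          by_contra hcon
          push Not at hcon
          exact h (hJsup s hcon.1 hcon.2)
        have := hs_AB.2 hor
        exact mul_nonpos_of_nonneg_of_nonpos (by linarith) (by linarith [hnotJ s hs h])
    nlinarith
  have i1 : Integrable (fun s => A * (s ^ r₀ * f s) + B * f s) μ :=
    (hf0.const_mul A).add (hf.const_mul B)
  have i2 : Integrable (fun s => A * (s ^ r₀ * g s) + B * g s) μ :=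
    (hg0.const_mul A).add (hg.const_mul B)
  rw [integral_sub hint i1,
    integral_add (hf0.const_mul A) (hf.const_mul B), integral_const_mul, integral_const_mul,
    integral_sub hg1 i2,
    integral_add (hg0.const_mul A) (hg.const_mul B), integral_const_mul, integral_const_mul,
    hmass, hmom] at hle
  linarith

/-! ### Moments of the radial parts -/

/-- The density of `R` on `(0, ∞)`. -/
noncomputable def radialDensity (n : ℕ) (p : ℝ) (U : ℝ → ℝ) (s : ℝ) : ℝ :=
  s ^ (n - 1) * Real.exp (-U (s ^ p)) * sphereMass n p

/-- The density of the radius in the model case of rate `b`, where the `p`-th power of the radius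
has a Gamma distribution of shape `n/p`. -/
noncomputable def gammaDensity (n : ℕ) (p b : ℝ) (s : ℝ) : ℝ :=
  b ^ ((n : ℝ) / p) / (1 / p * Real.Gamma (n / p)) * (s ^ (n - 1) * Real.exp (-(b * s ^ p)))

section Model

variable {n : ℕ} {p b : ℝ}

theorem rpow_mul_gammaDensity (hn : 1 ≤ n) {s : ℝ} (hs : 0 < s) (r : ℝ) :
    s ^ r * gammaDensity n p b s = b ^ ((n : ℝ) / p) / (1 / p * Real.Gamma (n / p)) *
      (s ^ (r + n - 1) * Real.exp (-b * s ^ p)) := by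
  unfold gammaDensity
  have : s ^ (r + n - 1) = s ^ r * s ^ (n - 1) := by
    rw [← Real.rpow_natCast, ← Real.rpow_add hs, Nat.cast_sub hn]
    simp [add_sub_assoc]
  rw [this, neg_mul]
  ring

theorem integrable_rpow_mul_gammaDensity (hn : 1 ≤ n) (hp : 1 < p) (hb : 0 < b) {r : ℝ}
    (hr : 0 ≤ r) :
    Integrable (fun s => s ^ r * gammaDensity n p b s) (volume.restrict (Ioi 0)) := by
  have hp0 : 0 < p := by linarith
  have hn' : (1 : ℝ) ≤ n := by exact_mod_cast hn
  have h := (integrableOn_rpow_mul_exp_neg_mul_rpow (s := r + n - 1) (by linarith) hp0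
    hb).const_mul (b ^ ((n : ℝ) / p) / (1 / p * Real.Gamma (n / p)))
  refine h.congr ?_
  filter_upwards [ae_restrict_mem measurableSet_Ioi] with s hs
  exact (rpow_mul_gammaDensity hn hs r).symm

theorem integral_rpow_mul_gammaDensity (hn : 1 ≤ n) (hp : 1 < p) (hb : 0 < b) {r : ℝ}
    (hr : 0 ≤ r) :
    ∫ s in Ioi 0, s ^ r * gammaDensity n p b s = b ^ (-r / p) * gammaMoment n p r := by
  have hp0 : 0 < p := by linarith
  have hn' : (1 : ℝ) ≤ n := by exact_mod_cast hn
  rw [setIntegral_congr_fun measurableSet_Ioi fun s hs => rpow_mul_gammaDensity hn hs r,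
    integral_const_mul, integral_rpow_mul_exp_neg_mul_rpow hp0 (by linarith) hb]
  have e1 : (r + n - 1 + 1) / p = (n + r) / p := by ring
  have e2 : -(r + n - 1 + 1) / p = -r / p - n / p := by ring
  rw [e1, e2, Real.rpow_sub hb]
  unfold gammaMoment
  have := Real.Gamma_pos_of_pos (show 0 < n / p by positivity)
  have : 0 < b ^ ((n : ℝ) / p) := by positivity
  field_simp

theorem integral_gammaDensity (hn : 1 ≤ n) (hp : 1 < p) (hb : 0 < b) :
    Integrable (gammaDensity n p b) (volume.restrict (Ioi 0)) ∧
      ∫ s in Ioi 0, gammaDensity n p b s = 1 := by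
  have hp0 : 0 < p := by linarith
  have hn' : (1 : ℝ) ≤ n := by exact_mod_cast hn
  have h1 := integrable_rpow_mul_gammaDensity hn hp hb le_rfl
  have h2 := integral_rpow_mul_gammaDensity hn hp hb le_rfl
  have := Real.Gamma_pos_of_pos (show 0 < n / p by positivity)
  simp only [Real.rpow_zero, one_mul, gammaMoment, neg_zero, zero_div, add_zero,
    div_self this.ne'] at h1 h2
  exact ⟨h1, h2⟩

end Model

/-- Among radial parts with a given `r₀`-th moment, the model one has the largest higher
moments: the logarithm of the quotient of the two densities is `b s ^ p - U (s ^ p)` up to a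
constant, a concave function of `s ^ p`, so that the radial density exceeds the model one on an
interval. -/
theorem radialDensity_moment_le {n : ℕ} (hn : 1 ≤ n) {p : ℝ} (hp : 1 < p) {U : ℝ → ℝ}
    (hU : ConvexOn ℝ (Ici 0) U)
    {r₀ r₁ : ℝ} (h0 : 0 < r₀) (h1 : r₀ < r₁)
    (hint : Integrable (radialDensity n p U) (volume.restrict (Ioi 0)))
    (hmass : ∫ s in Ioi 0, radialDensity n p U s = 1)
    (hint0 : Integrable (fun s => s ^ r₀ * radialDensity n p U s) (volume.restrict (Ioi 0)))
    (hpos : 0 < ∫ s in Ioi 0, s ^ r₀ * radialDensity n p U s) :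
    Integrable (fun s => s ^ r₁ * radialDensity n p U s) (volume.restrict (Ioi 0)) ∧
      (∫ s in Ioi 0, s ^ r₁ * radialDensity n p U s) ^ (1 / r₁) * gammaMoment n p r₀ ^ (1 / r₀) ≤
        gammaMoment n p r₁ ^ (1 / r₁) *
          (∫ s in Ioi 0, s ^ r₀ * radialDensity n p U s) ^ (1 / r₀) := by
  have hp0 : 0 < p := by linarith
  have hr1 : 0 < r₁ := h0.trans h1
  have hn' : (0 : ℝ) < n := by exact_mod_cast hn
  have hS := sphereMass_pos hn hp0
  set m := ∫ s in Ioi 0, s ^ r₀ * radialDensity n p U s with hm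
  have hg0 := gammaMoment_pos hn hp0 h0.le
  have hg1 := gammaMoment_pos hn hp0 hr1.le
  -- the rate for which the model radius has the same `r₀`-th moment
  set b := (gammaMoment n p r₀ / m) ^ (p / r₀) with hb
  have hb0 : 0 < b := by positivity
  have hbr : ∀ r : ℝ, b ^ (-r / p) = (m / gammaMoment n p r₀) ^ (r / r₀) := by
    intro r
    rw [hb, ← Real.rpow_mul (by positivity), ← inv_div m, Real.inv_rpow (by positivity),
      ← Real.rpow_neg (by positivity)]
    congr 1
    field_simp
  obtain ⟨hgi, hgm⟩ := integral_gammaDensity hn hp hb0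
  have hG := Real.Gamma_pos_of_pos (show 0 < n / p by positivity)
  have hJ : OrdConnected {s : ℝ | 0 < s ∧ gammaDensity n p b s ≤ radialDensity n p U s} := by
    set c := b ^ ((n : ℝ) / p) / (1 / p * Real.Gamma (n / p)) with hc
    have hc0 : 0 < c := by positivity
    have hiff : ∀ s : ℝ, 0 < s → (gammaDensity n p b s ≤ radialDensity n p U s ↔
        U (s ^ p) - b * s ^ p ≤ Real.log (sphereMass n p) - Real.log c) := by
      intro s hs
      unfold gammaDensity radialDensity
      have hsn : 0 < s ^ (n - 1) := by positivity
      rw [← hc, ← Real.log_le_log_iff (by positivity) (by positivity),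
        Real.log_mul (by positivity) (by positivity), Real.log_mul (by positivity) (by positivity),
        Real.log_mul (by positivity) (by positivity), Real.log_mul (by positivity) (by positivity),
        Real.log_exp, Real.log_exp]
      constructor <;> intro h <;> linarith
    have hconv : ConvexOn ℝ (Ici 0) fun y : ℝ => U y + -b * y := by
      refine hU.add ⟨convex_Ici 0, fun x _ y _ a c _ _ _ => ?_⟩
      simp only [smul_eq_mul]
      apply le_of_eq
      ring
    have hsub := (hconv.convex_le (Real.log (sphereMass n p) - Real.log c)).ordConnected
    refine ⟨fun x hx y hy z hz => ?_⟩
    have hz0 : 0 < z := lt_of_lt_of_le hx.1 hz.1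
    refine ⟨hz0, (hiff z hz0).2 ?_⟩
    have hx' := (hiff x hx.1).1 hx.2
    have hy' := (hiff y hy.1).1 hy.2
    have := hsub.out (x := x ^ p) ⟨Real.rpow_nonneg hx.1.le p, by linarith⟩ (y := y ^ p)
      ⟨Real.rpow_nonneg hy.1.le p, by linarith⟩
      ⟨Real.rpow_le_rpow hx.1.le hz.1 hp0.le, Real.rpow_le_rpow hz0.le hz.2 hp0.le⟩
    have := this.2
    linarith
  have hcross := moment_le_of_crossing (μ := volume.restrict (Ioi 0))
    (ae_restrict_mem measurableSet_Ioi) h0 h1 (f := radialDensity n p U)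
    (g := gammaDensity n p b) (fun s hs => by unfold radialDensity; positivity)
    (fun s hs => by unfold gammaDensity; positivity) hint hgi hint0
    (integrable_rpow_mul_gammaDensity hn hp hb0 h0.le)
    (integrable_rpow_mul_gammaDensity hn hp hb0 hr1.le) (hmass.trans hgm.symm) (by
      rw [integral_rpow_mul_gammaDensity hn hp hb0 h0.le, hbr, div_self h0.ne', Real.rpow_one,
        div_mul_cancel₀ _ hg0.ne']) hJ
  refine ⟨hcross.1, ?_⟩
  have h2 := hcross.2
  rw [integral_rpow_mul_gammaDensity hn hp hb0 hr1.le, hbr] at h2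
  have hnn : 0 ≤ ∫ s in Ioi 0, s ^ r₁ * radialDensity n p U s := by
    refine setIntegral_nonneg measurableSet_Ioi fun s hs => ?_
    have : (0 : ℝ) < s := hs
    unfold radialDensity
    positivity
  have h3 := Real.rpow_le_rpow hnn h2 (show 0 ≤ 1 / r₁ by positivity)
  rw [Real.mul_rpow (by positivity) hg1.le, ← Real.rpow_mul (by positivity),
    show r₁ / r₀ * (1 / r₁) = 1 / r₀ by field_simp, Real.div_rpow hpos.le hg0.le] at h3
  have hg0' : 0 < gammaMoment n p r₀ ^ (1 / r₀) := by positivity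
  calc _ ≤ m ^ (1 / r₀) / gammaMoment n p r₀ ^ (1 / r₀) * gammaMoment n p r₁ ^ (1 / r₁) *
        gammaMoment n p r₀ ^ (1 / r₀) := mul_le_mul_of_nonneg_right h3 hg0'.le
    _ = _ := by field_simp

theorem eLpNorm_radialLaw_rpow {n : ℕ} (hn : 1 ≤ n) {p : ℝ} (hp : 1 < p) {U : ℝ → ℝ}
    (hU : MonotoneOn U (Ici 0)) {r : ℝ≥0} (hr : r ≠ 0) :
    eLpNorm (fun s => s) r (radialLaw n p U) =
      (∫⁻ s in Ioi 0, ENNReal.ofReal (s ^ (r : ℝ) * radialDensity n p U s)) ^ (1 / (r : ℝ)) := by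
  have hS := sphereMass_pos hn (by linarith : 0 < p)
  rw [eLpNorm_eq_lintegral_rpow_enorm_toReal (by simpa) (by simp)]
  congr 1
  simp only [ENNReal.coe_toReal]
  rw [lintegral_radialLaw hU (by fun_prop)]
  refine setLIntegral_congr_fun measurableSet_Ioi fun s hs => ?_
  have hs0 : (0 : ℝ) < s := hs
  rw [Real.enorm_eq_ofReal_abs, abs_of_pos hs0, ENNReal.ofReal_rpow_of_pos hs0,
    ← ENNReal.ofReal_mul (by positivity), mul_comm]
  rfl

theorem aestronglyMeasurable_radialDensity (n : ℕ) {p : ℝ} {U : ℝ → ℝ}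
    (hU : MonotoneOn U (Ici 0)) (r : ℝ) :
    AEStronglyMeasurable (fun s => s ^ r * radialDensity n p U s) (volume.restrict (Ioi 0)) := by
  have hd := (measurable_exp_neg_comp hU p).ennreal_toReal
  have : Measurable fun s : ℝ => s ^ r * (s ^ (n - 1) *
      (ENNReal.ofReal (Real.exp (-U (max (s ^ p) 0)))).toReal * sphereMass n p) := by
    fun_prop
  refine this.aestronglyMeasurable.congr ?_
  filter_upwards [ae_restrict_mem measurableSet_Ioi] with s hs
  have hs0 : (0 : ℝ) < s := hs
  rw [ENNReal.toReal_ofReal (Real.exp_pos _).le, max_eq_left (by positivity)]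
  rfl

theorem rpow_mul_radialDensity_nonneg {n : ℕ} (hn : 1 ≤ n) {p : ℝ} (hp : 1 < p) (U : ℝ → ℝ)
    (r : ℝ) : 0 ≤ᵐ[volume.restrict (Ioi 0)] fun s => s ^ r * radialDensity n p U s := by
  have hS := sphereMass_pos hn (by linarith : 0 < p)
  filter_upwards [ae_restrict_mem measurableSet_Ioi] with s hs
  have hs0 : (0 : ℝ) < s := hs
  unfold radialDensity
  simp only [Pi.zero_apply]
  positivity

theorem integrable_of_eLpNorm_radialLaw {n : ℕ} (hn : 1 ≤ n) {p : ℝ} (hp : 1 < p) {U : ℝ → ℝ}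
    (hU : MonotoneOn U (Ici 0)) {r : ℝ≥0} (hr : r ≠ 0)
    (h : eLpNorm (fun s => s) r (radialLaw n p U) ≠ ∞) :
    Integrable (fun s => s ^ (r : ℝ) * radialDensity n p U s) (volume.restrict (Ioi 0)) := by
  have hr0 : (0 : ℝ) < r := by positivity
  refine ⟨aestronglyMeasurable_radialDensity n hU r, ?_⟩
  rw [hasFiniteIntegral_iff_ofReal (rpow_mul_radialDensity_nonneg hn hp U r)]
  rw [eLpNorm_radialLaw_rpow hn hp hU hr] at h
  by_contra hcon
  rw [not_lt, top_le_iff] at hcon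
  rw [hcon, ENNReal.top_rpow_of_pos (by positivity)] at h
  exact h rfl

theorem eLpNorm_radialLaw_eq {n : ℕ} (hn : 1 ≤ n) {p : ℝ} (hp : 1 < p) {U : ℝ → ℝ}
    (hU : MonotoneOn U (Ici 0)) {r : ℝ≥0} (hr : r ≠ 0)
    (h : Integrable (fun s => s ^ (r : ℝ) * radialDensity n p U s) (volume.restrict (Ioi 0))) :
    eLpNorm (fun s => s) r (radialLaw n p U) =
      ENNReal.ofReal ((∫ s in Ioi 0, s ^ (r : ℝ) * radialDensity n p U s) ^ (1 / (r : ℝ))) := by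
  have hr0 : (0 : ℝ) < r := by positivity
  rw [eLpNorm_radialLaw_rpow hn hp hU hr, ← ofReal_integral_eq_lintegral_ofReal h
    (rpow_mul_radialDensity_nonneg hn hp U r), ENNReal.ofReal_rpow_of_nonneg _ (by positivity)]
  exact integral_nonneg_of_ae (rpow_mul_radialDensity_nonneg hn hp U r)

/-- The growth of the moments of the radial part of a block, which by `radialDensity_moment_le`
is at most that of the Gamma moments. -/
theorem eLpNorm_radialLaw_le {n : ℕ} (hn : 1 ≤ n) {p : ℝ} (hp : 1 < p) {U : ℝ → ℝ}
    (hU : MonotoneOn U (Ici 0)) (hUc : ConvexOn ℝ (Ici 0) U)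
    (hprob : IsProbabilityMeasure (blockLaw n p U)) {r₀ r₁ : ℝ≥0} (h0 : 1 ≤ r₀) (h1 : r₀ ≤ r₁)
    (hfin : eLpNorm (fun s => s) r₀ (radialLaw n p U) ≠ ∞) :
    eLpNorm (fun s => s) r₁ (radialLaw n p U) ≤
      ENNReal.ofReal (12 * ((n + r₁) / (n + r₀)) ^ (1 / p)) *
        eLpNorm (fun s => s) r₀ (radialLaw n p U) := by
  have hp0 : 0 < p := by linarith
  have hn' : (0 : ℝ) < n := by exact_mod_cast hn
  have hr0 : r₀ ≠ 0 := (zero_lt_one.trans_le h0).ne'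
  have hr1 : r₁ ≠ 0 := (zero_lt_one.trans_le (h0.trans h1)).ne'
  have hr0' : (0 : ℝ) < r₀ := by positivity
  have hr1' : (0 : ℝ) < r₁ := by positivity
  have hS := sphereMass_pos hn hp0
  rcases h1.eq_or_lt with heq | hlt
  · subst heq
    rw [div_self (by positivity), Real.one_rpow, mul_one]
    refine le_mul_of_one_le_left' ?_
    rw [ENNReal.one_le_ofReal]; norm_num
  have hint0 := integrable_of_eLpNorm_radialLaw hn hp hU hr0 hfin
  have hnn := rpow_mul_radialDensity_nonneg hn hp U
  have hone : ∫⁻ s in Ioi 0, ENNReal.ofReal (radialDensity n p U s) = 1 := by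
    have h := radialLaw_univ hn hp hU
    rw [hprob.measure_univ, ← lintegral_one (μ := radialLaw n p U),
      lintegral_radialLaw hU measurable_const] at h
    simpa [radialDensity] using h
  have hnn0 : 0 ≤ᵐ[volume.restrict (Ioi 0)] radialDensity n p U := by
    simpa using hnn 0
  have hint : Integrable (radialDensity n p U) (volume.restrict (Ioi 0)) := by
    refine ⟨by simpa using aestronglyMeasurable_radialDensity n (p := p) hU 0, ?_⟩
    rw [hasFiniteIntegral_iff_ofReal hnn0, hone]
    simp
  have hmass : ∫ s in Ioi 0, radialDensity n p U s = 1 := by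
    rw [integral_eq_lintegral_of_nonneg_ae hnn0 hint.aestronglyMeasurable, hone]
    simp
  have hpos : 0 < ∫ s in Ioi 0, s ^ (r₀ : ℝ) * radialDensity n p U s := by
    rw [integral_pos_iff_support_of_nonneg_ae (hnn r₀) hint0]
    refine lt_of_lt_of_le ?_ (measure_mono (s := Ioi 0) ?_)
    · simp
    · intro s hs
      have : (0 : ℝ) < s := hs
      simp only [Function.mem_support, radialDensity]
      positivity
  obtain ⟨hint1, hle⟩ := radialDensity_moment_le hn hp hUc hr0' (by exact_mod_cast hlt) hint hmass
    hint0 hpos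
  rw [eLpNorm_radialLaw_eq hn hp hU hr0 hint0, eLpNorm_radialLaw_eq hn hp hU hr1 hint1,
    ← ENNReal.ofReal_mul (by positivity)]
  apply ENNReal.ofReal_le_ofReal
  have hratio := gammaMoment_ratio_le hn hp (r₀ := r₀) (r₁ := r₁) (by exact_mod_cast h0)
    (by exact_mod_cast h1)
  have hg := gammaMoment_pos hn hp0 hr0'.le
  have hg' : 0 < gammaMoment n p r₀ ^ (1 / (r₀ : ℝ)) := by positivity
  refine le_of_mul_le_mul_right (hle.trans ?_) hg'
  calc _ ≤ (12 * ((n + r₁) / (n + r₀)) ^ (1 / p) * gammaMoment n p r₀ ^ (1 / (r₀ : ℝ))) *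
        (∫ s in Ioi 0, s ^ (r₀ : ℝ) * radialDensity n p U s) ^ (1 / (r₀ : ℝ)) := by
        gcongr
        exact hratio
    _ = _ := by ring

/-! ### The coordinates of the model block -/

/-- The density of one coordinate of `Y_k`. -/
noncomputable def coordDensity (p x : ℝ) : ℝ :=
  bConst p ^ (1 / p) / (2 * Real.Gamma (1 + 1 / p)) * Real.exp (-(bConst p * |x| ^ p))

/-- The law of one coordinate of `Y_k`. -/
noncomputable def coordLaw (p : ℝ) : Measure ℝ :=
  volume.withDensity fun x => ENNReal.ofReal (coordDensity p x)

theorem coordDensity_pos {p : ℝ} (hp : 1 < p) (x : ℝ) : 0 < coordDensity p x := by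
  have hp0 : 0 < p := by linarith
  have := bConst_pos hp0
  have := Real.Gamma_pos_of_pos (show 0 < 1 + 1 / p by positivity)
  unfold coordDensity
  positivity

theorem measurable_coordDensity (p : ℝ) : Measurable (coordDensity p) := by
  unfold coordDensity
  fun_prop

theorem lintegral_abs_rpow_mul_exp {p a q : ℝ} (hp : 0 < p) (ha : 0 < a) (hq : -1 < q) :
    ∫⁻ x : ℝ, ENNReal.ofReal (|x| ^ q * Real.exp (-a * |x| ^ p)) =
      ENNReal.ofReal (2 * (a ^ (-(q + 1) / p) * (1 / p) * Real.Gamma ((q + 1) / p))) := by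
  have h : ∫ x : ℝ, |x| ^ q * Real.exp (-a * |x| ^ p) =
      2 * (a ^ (-(q + 1) / p) * (1 / p) * Real.Gamma ((q + 1) / p)) := by
    rw [integral_comp_abs (f := fun x => x ^ q * Real.exp (-a * x ^ p)),
      integral_rpow_mul_exp_neg_mul_rpow hp hq ha]
  have hpos := Real.Gamma_pos_of_pos (show 0 < (q + 1) / p from div_pos (by linarith) hp)
  rw [← h, ofReal_integral_eq_lintegral_ofReal]
  · by_contra hcon
    rw [integral_undef hcon] at h
    have : 0 < 2 * (a ^ (-(q + 1) / p) * (1 / p) * Real.Gamma ((q + 1) / p)) := by positivity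
    linarith
  · exact Filter.Eventually.of_forall fun x => by simp only [Pi.zero_apply]; positivity

theorem lintegral_coordLaw {p : ℝ} {f : ℝ → ℝ≥0∞} (hf : Measurable f) :
    ∫⁻ x, f x ∂(coordLaw p) = ∫⁻ x, ENNReal.ofReal (coordDensity p x) * f x := by
  unfold coordLaw
  rw [lintegral_withDensity_eq_lintegral_mul _ (measurable_coordDensity p).ennreal_ofReal hf]
  rfl

/-- The variable `b |y| ^ p` has the Gamma distribution of shape `1/p`, whose exponential moments
are explicit. -/
theorem lintegral_exp_coordLaw {p θ : ℝ} (hp : 1 < p) (hθ : θ < 1) :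
    ∫⁻ x, ENNReal.ofReal (Real.exp (θ * (bConst p * |x| ^ p))) ∂(coordLaw p) =
      ENNReal.ofReal ((1 - θ) ^ (-(1 / p))) := by
  have hp0 : 0 < p := by linarith
  have hb := bConst_pos hp0
  have hG := Real.Gamma_pos_of_pos (show 0 < 1 + 1 / p by positivity)
  have h1 : 0 < 1 - θ := by linarith
  rw [lintegral_coordLaw (by fun_prop)]
  have e : ∀ x : ℝ, ENNReal.ofReal (coordDensity p x) *
      ENNReal.ofReal (Real.exp (θ * (bConst p * |x| ^ p))) =
      ENNReal.ofReal (bConst p ^ (1 / p) / (2 * Real.Gamma (1 + 1 / p))) *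
        ENNReal.ofReal (|x| ^ (0 : ℝ) * Real.exp (-((1 - θ) * bConst p) * |x| ^ p)) := by
    intro x
    rw [← ENNReal.ofReal_mul (coordDensity_pos hp x).le, ← ENNReal.ofReal_mul (by positivity),
      Real.rpow_zero, one_mul, coordDensity, mul_assoc, ← Real.exp_add]
    congr 3
    ring
  simp_rw [e]
  rw [lintegral_const_mul _ (by fun_prop), lintegral_abs_rpow_mul_exp hp0 (by positivity)
    (by norm_num), ← ENNReal.ofReal_mul (by positivity)]
  congr 1
  rw [zero_add, add_comm 1 (1 / p), Real.Gamma_add_one (by positivity), neg_div,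
    Real.mul_rpow h1.le hb.le, Real.rpow_neg hb.le]
  have := Real.Gamma_pos_of_pos (show 0 < 1 / p by positivity)
  have : 0 < bConst p ^ (1 / p) := by positivity
  field_simp

theorem isProbabilityMeasure_coordLaw {p : ℝ} (hp : 1 < p) :
    IsProbabilityMeasure (coordLaw p) := by
  constructor
  have h := lintegral_exp_coordLaw (θ := 0) hp (by norm_num)
  simpa using h

/-- The constant `b` is chosen so that the coordinates have variance `1`. -/
theorem lintegral_sq_coordLaw {p : ℝ} (hp : 1 < p) :
    ∫⁻ x, ‖x‖ₑ ^ (2 : ℝ) ∂(coordLaw p) = 1 := by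
  have hp0 : 0 < p := by linarith
  have hb := bConst_pos hp0
  have hG1 := Real.Gamma_pos_of_pos (show 0 < 1 / p by positivity)
  have hG3 := Real.Gamma_pos_of_pos (show 0 < 3 / p by positivity)
  rw [lintegral_coordLaw (by fun_prop)]
  have e : ∀ x : ℝ, ENNReal.ofReal (coordDensity p x) * ‖x‖ₑ ^ (2 : ℝ) =
      ENNReal.ofReal (bConst p ^ (1 / p) / (2 * Real.Gamma (1 + 1 / p))) *
        ENNReal.ofReal (|x| ^ (2 : ℝ) * Real.exp (-bConst p * |x| ^ p)) := by
    intro x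
    have : 0 < Real.Gamma (1 + 1 / p) := Real.Gamma_pos_of_pos (by positivity)
    rw [Real.enorm_eq_ofReal_abs, ENNReal.ofReal_rpow_of_nonneg (abs_nonneg x) (by norm_num),
      ← ENNReal.ofReal_mul (coordDensity_pos hp x).le, ← ENNReal.ofReal_mul (by positivity),
      coordDensity, neg_mul]
    congr 1
    ring
  simp_rw [e]
  have h := bConst_rpow hp0 2
  rw [show (2 : ℝ) / 2 = 1 by norm_num, Real.rpow_one] at h
  rw [lintegral_const_mul _ (by fun_prop), lintegral_abs_rpow_mul_exp hp0 hb (by norm_num),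
    add_comm 1 (1 / p), Real.Gamma_add_one (by positivity), ← ENNReal.ofReal_mul (by positivity),
    show -((2 : ℝ) + 1) / p = -(1 / p) - 2 / p by ring, Real.rpow_sub hb, h, Real.rpow_neg hb.le,
    show ((2 : ℝ) + 1) / p = 3 / p by norm_num]
  have : 0 < bConst p ^ (1 / p) := by positivity
  rw [← ENNReal.ofReal_one]
  congr 1
  field_simp

theorem blockLawY_eq_pi (n : ℕ) {p : ℝ} (hp : 1 < p) :
    blockLawY n p = Measure.pi fun _ => coordLaw p := by
  have := isProbabilityMeasure_coordLaw hp
  unfold coordLaw at this ⊢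
  rw [← withDensity_prod_eq_pi _ (measurable_coordDensity p).ennreal_ofReal]
  unfold blockLawY
  congr 1
  ext x
  rw [← ENNReal.ofReal_prod_of_nonneg fun i _ => (coordDensity_pos hp (x i)).le]
  rfl

theorem isProbabilityMeasure_blockLawY (n : ℕ) {p : ℝ} (hp : 1 < p) :
    IsProbabilityMeasure (blockLawY n p) := by
  have := isProbabilityMeasure_coordLaw hp
  rw [blockLawY_eq_pi n hp]
  infer_instance

/-- The linear potential for which the block `X_k` has the law of `Y_k`. -/
noncomputable def modelPotential (n : ℕ) (p g : ℝ) : ℝ :=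
  bConst p * g - n * Real.log (bConst p ^ (1 / p) / (2 * Real.Gamma (1 + 1 / p)))

theorem monotoneOn_modelPotential (n : ℕ) {p : ℝ} (hp : 1 < p) :
    MonotoneOn (modelPotential n p) (Ici 0) := fun x _ y _ hxy =>
  sub_le_sub_right (mul_le_mul_of_nonneg_left hxy (bConst_pos (by linarith)).le) _

theorem convexOn_modelPotential (n : ℕ) (p : ℝ) :
    ConvexOn ℝ (Ici 0) (modelPotential n p) := by
  refine ⟨convex_Ici 0, fun x _ y _ a c _ _ hac => le_of_eq ?_⟩
  unfold modelPotential
  simp only [smul_eq_mul]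
  linear_combination n * Real.log (bConst p ^ (1 / p) / (2 * Real.Gamma (1 + 1 / p))) * hac

theorem exp_neg_modelPotential (n : ℕ) {p : ℝ} (hp : 1 < p) (g : ℝ) :
    Real.exp (-modelPotential n p g) =
      (bConst p ^ (1 / p) / (2 * Real.Gamma (1 + 1 / p))) ^ n * Real.exp (-(bConst p * g)) := by
  have hp0 : 0 < p := by linarith
  have hb := bConst_pos hp0
  have hG := Real.Gamma_pos_of_pos (show 0 < 1 + 1 / p by positivity)
  rw [modelPotential, neg_sub, sub_eq_add_neg, Real.exp_add, ← Real.log_pow,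
    Real.exp_log (by positivity)]

theorem blockLawY_eq_blockLaw (n : ℕ) {p : ℝ} (hp : 1 < p) :
    blockLawY n p = blockLaw n p (modelPotential n p) := by
  unfold blockLawY blockLaw
  congr 1
  ext x
  congr 1
  rw [exp_neg_modelPotential n hp, Finset.prod_mul_distrib, ← Real.exp_sum,
    ellNorm_rpow (by linarith), Finset.prod_const, Finset.card_univ, Fintype.card_fin,
    Finset.mul_sum, Finset.sum_neg_distrib]

theorem radialDensity_modelPotential {n : ℕ} (hn : 1 ≤ n) {p : ℝ} (hp : 1 < p) (s : ℝ) :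
    radialDensity n p (modelPotential n p) s = gammaDensity n p (bConst p) s := by
  have hp0 : 0 < p := by linarith
  have hn' : (0 : ℝ) < n := by exact_mod_cast hn
  have hb := bConst_pos hp0
  have hG := Real.Gamma_pos_of_pos (show 0 < 1 + 1 / p by positivity)
  have hGn := Real.Gamma_pos_of_pos (show 0 < n / p by positivity)
  unfold radialDensity gammaDensity sphereMass
  rw [exp_neg_modelPotential n hp, div_pow, ← Real.rpow_natCast (bConst p ^ (1 / p)),
    ← Real.rpow_mul hb.le, one_div_mul_eq_div]
  field_simp

theorem radialLawY_eq_radialLaw {n : ℕ} (hn : 1 ≤ n) {p : ℝ} (hp : 1 < p) :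
    radialLawY n p = radialLaw n p (modelPotential n p) := by
  unfold radialLawY radialLaw
  congr 1
  ext s
  exact congrArg ENNReal.ofReal (radialDensity_modelPotential hn hp s).symm

theorem eLpNorm_radialLawY {n : ℕ} (hn : 1 ≤ n) {p : ℝ} (hp : 1 < p) {r : ℝ≥0} (hr : r ≠ 0) :
    eLpNorm (fun s => s) r (radialLawY n p) =
      ENNReal.ofReal (bConst p ^ (-(1 / p)) * gammaMoment n p r ^ (1 / (r : ℝ))) := by
  have hp0 : 0 < p := by linarith
  have hb := bConst_pos hp0
  have hr0 : (0 : ℝ) < r := by positivity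
  have hint := integrable_rpow_mul_gammaDensity hn hp hb hr0.le
  have hval := integral_rpow_mul_gammaDensity hn hp hb hr0.le
  simp_rw [← radialDensity_modelPotential hn hp] at hint hval
  rw [radialLawY_eq_radialLaw hn hp, eLpNorm_radialLaw_eq hn hp (monotoneOn_modelPotential n hp) hr
    hint, hval, Real.mul_rpow (by positivity) (gammaMoment_pos hn hp0 hr0.le).le,
    ← Real.rpow_mul hb.le]
  congr 3
  field_simp

/-! ### Linear functionals of the model block -/

section ModelFunctional

variable {n : ℕ} {p : ℝ}

/-- Hölder's inequality on the support of the coefficients, followed by `u ≤ e ^ u`. The factors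
have finite expectations, and there are only as many as there are nonzero coefficients. -/
theorem abs_dot_le_prod_exp (hp : 1 < p) (a x : Fin n → ℝ) {r : ℝ} (hr : 0 < r) :
    |dot x a| ^ r ≤ (ellNorm p.conjExponent a * (2 * r / (bConst p * p)) ^ (1 / p)) ^ r *
      ∏ i, if a i = 0 then 1 else Real.exp (1 / 2 * (bConst p * |x i| ^ p)) := by
  have hp0 : 0 < p := by linarith
  have hb := bConst_pos hp0
  have hpq := Real.HolderConjugate.conjExponent hp
  set S : Finset (Fin n) := {i | a i ≠ 0} with hS
  set G := ∑ i ∈ S, |x i| ^ p with hG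
  have hG0 : 0 ≤ G := Finset.sum_nonneg fun i _ => by positivity
  have hholder : |dot x a| ≤ ellNorm p.conjExponent a * G ^ (1 / p) := by
    have h1 : dot x a = ∑ i ∈ S, x i * a i := by
      unfold dot
      refine (Finset.sum_subset (Finset.subset_univ S) fun i _ hi => ?_).symm
      have : a i = 0 := by simpa [hS] using hi
      simp [this]
    rw [h1]
    calc |∑ i ∈ S, x i * a i| ≤ ∑ i ∈ S, |x i| * |a i| := by
          refine (Finset.abs_sum_le_sum_abs _ _).trans (le_of_eq ?_)
          simp_rw [abs_mul]
      _ ≤ (∑ i ∈ S, |(|x i|)| ^ p) ^ (1 / p) *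
          (∑ i ∈ S, |(|a i|)| ^ p.conjExponent) ^ (1 / p.conjExponent) :=
          Real.inner_le_Lp_mul_Lq S _ _ hpq
      _ ≤ G ^ (1 / p) * ellNorm p.conjExponent a := by
          simp_rw [abs_abs]
          unfold ellNorm
          have hq0 := hpq.symm.pos
          refine mul_le_mul_of_nonneg_left ?_ (by positivity)
          refine Real.rpow_le_rpow (Finset.sum_nonneg fun i _ => by positivity) ?_ (by positivity)
          exact Finset.sum_le_sum_of_subset_of_nonneg (Finset.subset_univ S)
            fun i _ _ => by positivity
      _ = _ := mul_comm _ _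
  have hexp : G ≤ 2 * r / (bConst p * p) * Real.exp (bConst p * G * p / (2 * r)) := by
    have h := Real.add_one_le_exp (bConst p * G * p / (2 * r))
    rw [div_mul_eq_mul_div, le_div_iff₀ (by positivity)]
    have h2 : bConst p * G * p / (2 * r) ≤ Real.exp (bConst p * G * p / (2 * r)) := by linarith
    rw [div_le_iff₀ (by positivity)] at h2
    linarith
  have hprod : (∏ i, if a i = 0 then 1 else Real.exp (1 / 2 * (bConst p * |x i| ^ p))) =
      Real.exp (bConst p * G / 2) := by
    have : ∀ i, (if a i = 0 then 1 else Real.exp (1 / 2 * (bConst p * |x i| ^ p))) =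
        Real.exp (if a i ≠ 0 then 1 / 2 * (bConst p * |x i| ^ p) else 0) := by
      intro i
      by_cases h : a i = 0 <;> simp [h]
    simp_rw [this]
    rw [← Real.exp_sum, ← Finset.sum_filter, ← hS, ← Finset.mul_sum, ← Finset.mul_sum]
    congr 1
    ring
  have hL := ellNorm_nonneg p.conjExponent a
  rw [hprod]
  calc |dot x a| ^ r ≤ (ellNorm p.conjExponent a *
        (2 * r / (bConst p * p) * Real.exp (bConst p * G * p / (2 * r))) ^ (1 / p)) ^ r := by
        gcongr
        exact hholder.trans (by gcongr)
    _ = _ := by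
        rw [Real.mul_rpow (x := 2 * r / (bConst p * p)) (by positivity) (by positivity),
          ← mul_assoc, Real.mul_rpow (by positivity) (by positivity), ← Real.exp_mul,
          ← Real.exp_mul]
        congr 2
        field_simp

/-- By independence the product in `abs_dot_le_prod_exp` has expectation `2 ^ (m/p)`, where `m` is
the number of nonzero coefficients; its `r`-th root is bounded because `m ≤ r`. -/
theorem eLpNorm_dot_blockLawY_le (hp : 1 < p) (a : Fin n → ℝ) {r : ℝ≥0} (hr : 1 ≤ r)
    (hm : ((Finset.univ.filter fun i => a i ≠ 0).card : ℝ≥0) ≤ r) :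
    eLpNorm (fun x => dot x a) r (blockLawY n p) ≤
      ENNReal.ofReal (12 * ((r : ℝ) ^ (1 / p) * ellNorm p.conjExponent a)) := by
  have hp0 : 0 < p := by linarith
  have hb := bConst_pos hp0
  have hr0 : r ≠ 0 := (zero_lt_one.trans_le hr).ne'
  have hr' : (0 : ℝ) < r := by positivity
  have hcoord := isProbabilityMeasure_coordLaw hp
  set m := (Finset.univ.filter fun i => a i ≠ 0).card with hmdef
  set L := ellNorm p.conjExponent a * (2 * r / (bConst p * p)) ^ (1 / p) with hL
  have hL0 : 0 ≤ L := mul_nonneg (ellNorm_nonneg _ _) (by positivity)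
  have hdot := measurable_dot a
  have hint : ∫⁻ x, ‖dot x a‖ₑ ^ (r : ℝ) ∂(blockLawY n p) ≤
      ENNReal.ofReal (L ^ (r : ℝ) * 2 ^ (m / p : ℝ)) := by
    calc ∫⁻ x, ‖dot x a‖ₑ ^ (r : ℝ) ∂(blockLawY n p)
        ≤ ∫⁻ x, ENNReal.ofReal (L ^ (r : ℝ)) * ∏ i, (fun i y => ENNReal.ofReal (if a i = 0 then 1
            else Real.exp (1 / 2 * (bConst p * |y| ^ p)))) i (x i) ∂(blockLawY n p) := by
          refine lintegral_mono fun x => ?_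
          rw [Real.enorm_eq_ofReal_abs, ENNReal.ofReal_rpow_of_nonneg (abs_nonneg _) hr'.le,
            ← ENNReal.ofReal_prod_of_nonneg (fun i _ => by split_ifs <;> positivity),
            ← ENNReal.ofReal_mul (by positivity)]
          exact ENNReal.ofReal_le_ofReal (abs_dot_le_prod_exp hp a x hr')
      _ = ENNReal.ofReal (L ^ (r : ℝ)) * ∏ i, ∫⁻ y, ENNReal.ofReal (if a i = 0 then 1
            else Real.exp (1 / 2 * (bConst p * |y| ^ p))) ∂(coordLaw p) := by
          have hmeas : ∀ i : Fin n, Measurable fun y : ℝ => ENNReal.ofReal (if a i = 0 then 1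
              else Real.exp (1 / 2 * (bConst p * |y| ^ p))) := by
            intro i
            by_cases h : a i = 0
            · simp [h]
            · simp only [h, if_false]; fun_prop
          rw [lintegral_const_mul, blockLawY_eq_pi n hp]
          · congr 1
            exact lintegral_pi_prod (fun _ => coordLaw p) _ hmeas
          · exact Finset.measurable_prod _ fun i _ => (hmeas i).comp (measurable_pi_apply i)
      _ = ENNReal.ofReal (L ^ (r : ℝ)) *
          ∏ i, if a i ≠ 0 then ENNReal.ofReal (2 ^ (1 / p)) else 1 := by
          congr 1
          refine Finset.prod_congr rfl fun i _ => ?_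
          by_cases h : a i = 0
          · simp [h]
          · simp only [h, if_false, ne_eq, not_false_eq_true, if_true]
            rw [lintegral_exp_coordLaw hp (by norm_num), show (1 : ℝ) - 1 / 2 = 2⁻¹ by norm_num,
              Real.inv_rpow (by norm_num), Real.rpow_neg (by norm_num), inv_inv]
      _ = _ := by
          rw [Finset.prod_ite]
          simp only [Finset.prod_const, one_pow, mul_one]
          rw [← hmdef, ← ENNReal.ofReal_pow (by positivity), ← ENNReal.ofReal_mul (by positivity),
            ← Real.rpow_natCast, ← Real.rpow_mul (by norm_num)]
          congr 3
          ring
  rw [eLpNorm_eq_lintegral_rpow_enorm_toReal (by simpa) (by simp), ENNReal.coe_toReal]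
  refine (ENNReal.rpow_le_rpow hint (by positivity)).trans ?_
  rw [ENNReal.ofReal_rpow_of_nonneg (by positivity) (by positivity)]
  apply ENNReal.ofReal_le_ofReal
  rw [Real.mul_rpow (by positivity) (by positivity), ← Real.rpow_mul hL0,
    mul_one_div_cancel hr'.ne', Real.rpow_one, ← Real.rpow_mul (by norm_num)]
  have h2 : ∀ e : ℝ, e ≤ 1 → (2 : ℝ) ^ e ≤ 2 := fun e he =>
    (Real.rpow_le_rpow_of_exponent_le (by norm_num) he).trans_eq (Real.rpow_one 2)
  have hp1 : 1 / p ≤ 1 := by rw [div_le_one hp0]; exact hp.le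
  have hfac : (2 : ℝ) ^ (m / p * (1 / r) : ℝ) ≤ 2 := by
    apply h2
    have hmr : (m : ℝ) ≤ r := by exact_mod_cast hm
    rw [div_mul_div_comm, div_le_one (by positivity)]
    nlinarith
  have hLle : L ≤ 6 * ((r : ℝ) ^ (1 / p) * ellNorm p.conjExponent a) := by
    have hβ := le_bConst_rpow_inv hp
    have hpp : 1 ≤ p ^ (1 / p) := Real.one_le_rpow hp.le (by positivity)
    have hE := ellNorm_nonneg p.conjExponent a
    have : (2 * r / (bConst p * p)) ^ (1 / p) ≤ 6 * (r : ℝ) ^ (1 / p) := by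
      rw [Real.div_rpow (by positivity) (by positivity), Real.mul_rpow (by positivity) hr'.le,
        Real.mul_rpow hb.le hp0.le, div_le_iff₀ (by positivity)]
      have h22 := h2 _ hp1
      have h1 : 1 / 3 * 1 ≤ bConst p ^ (1 / p) * p ^ (1 / p) := by gcongr
      have h0 : 0 ≤ (r : ℝ) ^ (1 / p) := by positivity
      nlinarith [mul_le_mul_of_nonneg_right h22 h0, mul_le_mul_of_nonneg_left h1 h0]
    rw [hL]
    calc _ ≤ ellNorm p.conjExponent a * (6 * (r : ℝ) ^ (1 / p)) := by gcongr
      _ = _ := by ring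
  calc L * (2 : ℝ) ^ (m / p * (1 / r) : ℝ)
      ≤ 6 * ((r : ℝ) ^ (1 / p) * ellNorm p.conjExponent a) * 2 := by
        have := hL0.trans hLle
        gcongr
    _ = _ := by ring

/-- The mass of an interval is at least its length times the least value of the density on it. -/
theorem le_coordLaw_Icc (hp : 1 < p) {c h w : ℝ} (hh : 0 ≤ h)
    (hw : ∀ y ∈ Icc c (c + h), |y| ≤ w) :
    ENNReal.ofReal (h * (bConst p ^ (1 / p) / 2 * Real.exp (-(bConst p ^ (1 / p) * w) ^ p))) ≤
      coordLaw p (Icc c (c + h)) := by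
  have hp0 : 0 < p := by linarith
  have hb := bConst_pos hp0
  have hG := Real.Gamma_pos_of_pos (show 0 < 1 + 1 / p by positivity)
  have hG1 := Gamma_one_add_le_one (y := 1 / p) (by positivity)
    (by rw [div_le_one hp0]; exact hp.le)
  rw [coordLaw, withDensity_apply _ measurableSet_Icc]
  calc _ = ∫⁻ _ in Icc c (c + h), ENNReal.ofReal
        (bConst p ^ (1 / p) / 2 * Real.exp (-(bConst p ^ (1 / p) * w) ^ p)) := by
        rw [setLIntegral_const, Real.volume_Icc, ENNReal.ofReal_mul hh, add_sub_cancel_left,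
          mul_comm]
    _ ≤ _ := by
        refine setLIntegral_mono (measurable_coordDensity p).ennreal_ofReal fun y hy => ?_
        apply ENNReal.ofReal_le_ofReal
        have hw' := hw y hy
        have hw0 : 0 ≤ w := (abs_nonneg y).trans hw'
        unfold coordDensity
        rw [Real.mul_rpow (by positivity) hw0, ← Real.rpow_mul hb.le, one_div_mul_cancel hp0.ne',
          Real.rpow_one]
        gcongr
        linarith

/-- Integrating the density over an interval of length `1 / (4 b ^ (1/p))` to the right of the
threshold is enough for a tail bound uniform in `p`. -/
theorem le_coordLaw_tail (hp : 1 < p) {σ x : ℝ} (hσ : σ = 1 ∨ σ = -1) (hx : 0 ≤ x) :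
    ENNReal.ofReal (1 / 8 * Real.exp (-1 - x ^ p)) ≤
      coordLaw p {y | x / (2 * bConst p ^ (1 / p)) ≤ σ * y} := by
  have hp0 : 0 < p := by linarith
  have hb := bConst_pos hp0
  set β := bConst p ^ (1 / p) with hβ
  have hβ0 : 0 < β := by positivity
  set z := x / (2 * β) with hz
  have hz0 : 0 ≤ z := by positivity
  have hpow : (β * (z + 1 / (4 * β))) ^ p ≤ 1 + x ^ p := by
    have e : β * (z + 1 / (4 * β)) = x / 2 + 1 / 4 := by rw [hz]; field_simp
    rw [e]
    have hxp : 0 ≤ x ^ p := by positivity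
    rcases le_total x (1 / 2) with h | h
    · have : (x / 2 + 1 / 4) ^ p ≤ 1 := Real.rpow_le_one (by positivity) (by linarith) hp0.le
      linarith
    · have : (x / 2 + 1 / 4) ^ p ≤ x ^ p :=
        Real.rpow_le_rpow (by positivity) (by linarith) hp0.le
      linarith
  have hval : 1 / 8 * Real.exp (-1 - x ^ p) ≤
      1 / (4 * β) * (β / 2 * Real.exp (-(β * (z + 1 / (4 * β))) ^ p)) := by
    have : 1 / (4 * β) * (β / 2 * Real.exp (-(β * (z + 1 / (4 * β))) ^ p)) =
        1 / 8 * Real.exp (-(β * (z + 1 / (4 * β))) ^ p) := by field_simp; norm_num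
    rw [this]
    gcongr
    linarith
  refine (ENNReal.ofReal_le_ofReal hval).trans ?_
  have hh : 0 ≤ 1 / (4 * β) := by positivity
  rcases hσ with rfl | rfl
  · refine (le_coordLaw_Icc hp (c := z) (h := 1 / (4 * β)) hh fun y hy => ?_).trans
      (measure_mono fun y hy => ?_)
    · rw [abs_of_nonneg (hz0.trans hy.1)]; exact hy.2
    · simpa using hy.1
  · refine (le_coordLaw_Icc hp (c := -(z + 1 / (4 * β))) (h := 1 / (4 * β)) hh
      fun y hy => ?_).trans (measure_mono fun y hy => ?_)
    · rw [abs_le]; exact ⟨hy.1, by linarith [hy.2]⟩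
    · have := hy.2
      change z ≤ -1 * y
      linarith

/-- On the event that `y_i sign(a_i)` exceeds a multiple of `r ^ (1/p)` times the coordinate of
the vector dual to `a`, for all `i` in the support of `a`, the linear functional is large; the
event has probability at least `72 ^ (-r)`. -/
theorem le_eLpNorm_dot_blockLawY (hp : 1 < p) (a : Fin n → ℝ) {r : ℝ≥0} (hr : 1 ≤ r)
    (hm : ((Finset.univ.filter fun i => a i ≠ 0).card : ℝ≥0) ≤ r) :
    ENNReal.ofReal (1 / 432 * ((r : ℝ) ^ (1 / p) * ellNorm p.conjExponent a)) ≤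
      eLpNorm (fun x => dot x a) r (blockLawY n p) := by
  have hp0 : 0 < p := by linarith
  have hb := bConst_pos hp0
  have hr0 : r ≠ 0 := (zero_lt_one.trans_le hr).ne'
  have hr' : (0 : ℝ) < r := by positivity
  have hpq := Real.HolderConjugate.conjExponent hp
  set q := p.conjExponent with hq
  have hq0 : 0 < q := hpq.symm.pos
  have hcoord := isProbabilityMeasure_coordLaw hp
  set S := Finset.univ.filter fun i => a i ≠ 0 with hS
  have hmr : (S.card : ℝ) ≤ r := by exact_mod_cast hm
  set A := ∑ i, |a i| ^ q with hA
  have hAnn : 0 ≤ A := Finset.sum_nonneg fun i _ => by positivity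
  rcases hAnn.eq_or_lt with hA0 | hA0
  · have : ellNorm q a = 0 := by
      unfold ellNorm
      rw [← hA, ← hA0, Real.zero_rpow (by positivity)]
    simp [this]
  set β := bConst p ^ (1 / p) with hβ
  have hβ0 : 0 < β := by positivity
  have hβ3 : β ≤ 3 := bConst_rpow_inv_le hp
  set σ : Fin n → ℝ := fun i => if 0 ≤ a i then 1 else -1 with hσ
  have hσ1 : ∀ i, σ i = 1 ∨ σ i = -1 := fun i => by
    by_cases h : 0 ≤ a i <;> simp [hσ, h]
  have hσa : ∀ i, a i = |a i| * σ i := fun i => by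
    by_cases h : 0 ≤ a i
    · simp [hσ, h, abs_of_nonneg h]
    · simp [hσ, h, abs_of_neg (not_le.1 h)]
  set x : Fin n → ℝ := fun i => (r * |a i| ^ q / A) ^ (1 / p) with hx
  have hx0 : ∀ i, 0 ≤ x i := fun i => by positivity
  have hxp : ∀ i, x i ^ p = r * |a i| ^ q / A := fun i => by
    rw [hx]
    simp only
    rw [← Real.rpow_mul (by positivity), one_div_mul_cancel hp0.ne', Real.rpow_one]
  have hxsum : ∑ i ∈ S, x i ^ p ≤ r := by
    calc ∑ i ∈ S, x i ^ p ≤ ∑ i, x i ^ p :=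
          Finset.sum_le_sum_of_subset_of_nonneg (Finset.subset_univ S)
            fun i _ _ => by have := hx0 i; positivity
      _ = r := by
          simp_rw [hxp, mul_div_assoc]
          rw [← Finset.mul_sum, ← Finset.sum_div, div_self hA0.ne', mul_one]
  have hdual : ∑ i, |a i| * x i = (r : ℝ) ^ (1 / p) * ellNorm q a := by
    have e : ∀ i, |a i| * x i = (r / A) ^ (1 / p) * |a i| ^ q := by
      intro i
      rw [hx]
      simp only
      rw [mul_div_right_comm, Real.mul_rpow (by positivity) (by positivity),
        ← Real.rpow_mul (abs_nonneg _)]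
      rcases (abs_nonneg (a i)).eq_or_lt with h | h
      · rw [← h, Real.zero_rpow hq0.ne', zero_mul, mul_zero]
      · have : q = 1 + q * (1 / p) := by
          have := hpq.symm.sub_one_mul_conj
          field_simp
          linarith [hpq.symm.mul_eq_add]
        conv_rhs => rw [this, Real.rpow_add h, Real.rpow_one]
        ring
    simp_rw [e]
    rw [← Finset.mul_sum, ← hA]
    unfold ellNorm
    rw [← hA, Real.div_rpow hr'.le hA0.le, div_mul_eq_mul_div, mul_div_assoc]
    congr 1
    rw [div_eq_iff (by positivity), ← Real.rpow_add hA0]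
    have : 1 / q + 1 / p = 1 := by
      have := hpq.inv_add_inv_eq_one
      rw [one_div, one_div, add_comm]; exact this
    rw [this, Real.rpow_one]
  set E : Set (Fin n → ℝ) := univ.pi fun i =>
    if a i ≠ 0 then {y | x i / (2 * β) ≤ σ i * y} else univ with hE
  have hEprob : ENNReal.ofReal ((1 / 72) ^ (r : ℝ)) ≤ blockLawY n p E := by
    rw [blockLawY_eq_pi n hp, hE, Measure.pi_pi]
    calc ENNReal.ofReal ((1 / 72) ^ (r : ℝ))
        ≤ ENNReal.ofReal (∏ i ∈ S, (1 / 8 * Real.exp (-1 - x i ^ p))) := by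
          apply ENNReal.ofReal_le_ofReal
          rw [Finset.prod_mul_distrib, Finset.prod_const, ← Real.exp_sum,
            Finset.sum_sub_distrib, Finset.sum_const, nsmul_eq_mul]
          have h1 : ((1 : ℝ) / 8) ^ (r : ℝ) ≤ (1 / 8) ^ S.card := by
            rw [← Real.rpow_natCast]
            exact Real.rpow_le_rpow_of_exponent_ge (by norm_num) (by norm_num) hmr
          have h2 : (Real.exp (-2)) ^ (r : ℝ) ≤
              Real.exp ((S.card : ℝ) * -1 - ∑ i ∈ S, x i ^ p) := by
            rw [← Real.exp_mul]
            apply Real.exp_le_exp.2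
            linarith
          have h3 : (1 : ℝ) / 9 ≤ Real.exp (-2) := by
            have : Real.exp 2 ≤ 9 := by
              have h := Real.exp_one_lt_d9
              have e : Real.exp 2 = Real.exp 1 * Real.exp 1 := by
                rw [← Real.exp_add]; norm_num
              rw [e]
              nlinarith [Real.exp_pos 1]
            rw [Real.exp_neg, one_div]
            exact inv_anti₀ (Real.exp_pos _) this
          calc ((1 : ℝ) / 72) ^ (r : ℝ) = (1 / 8) ^ (r : ℝ) * (1 / 9) ^ (r : ℝ) := by
                rw [← Real.mul_rpow (by norm_num) (by norm_num)]; norm_num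
            _ ≤ (1 / 8) ^ (r : ℝ) * (Real.exp (-2)) ^ (r : ℝ) := by gcongr
            _ ≤ _ := by gcongr
      _ = ∏ i ∈ S, ENNReal.ofReal (1 / 8 * Real.exp (-1 - x i ^ p)) :=
          ENNReal.ofReal_prod_of_nonneg fun i _ => by positivity
      _ = ∏ i, if a i ≠ 0 then ENNReal.ofReal (1 / 8 * Real.exp (-1 - x i ^ p)) else 1 := by
          rw [Finset.prod_ite]
          simp [hS]
      _ ≤ _ := by
          refine Finset.prod_le_prod' fun i _ => ?_
          by_cases h : a i = 0
          · simp [h]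
          · simp only [ne_eq, h, not_false_eq_true, if_true]
            exact le_coordLaw_tail hp (hσ1 i) (hx0 i)
  set ε := 1 / (2 * β) * ((r : ℝ) ^ (1 / p) * ellNorm q a) with hε
  have hε0 : 0 ≤ ε := mul_nonneg (by positivity) (mul_nonneg (by positivity) (ellNorm_nonneg _ _))
  have hEsub : E ⊆ {y | ENNReal.ofReal ε ≤ ‖dot y a‖ₑ} := by
    intro y hy
    change ENNReal.ofReal ε ≤ ‖dot y a‖ₑ
    rw [Real.enorm_eq_ofReal_abs]
    apply ENNReal.ofReal_le_ofReal
    refine le_trans ?_ (le_abs_self _)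
    rw [hε, ← hdual, Finset.mul_sum]
    refine Finset.sum_le_sum fun i _ => ?_
    by_cases h : a i = 0
    · simp [h]
    · have hyi := hy i trivial
      simp only [ne_eq, h, not_false_eq_true, if_true] at hyi
      have hyi' : x i / (2 * β) ≤ σ i * y i := hyi
      rw [hσa i, abs_mul, abs_abs]
      have habs : |σ i| = 1 := by rcases hσ1 i with h | h <;> simp [h]
      rw [habs, mul_one]
      calc 1 / (2 * β) * (|a i| * x i) = |a i| * (x i / (2 * β)) := by ring
        _ ≤ |a i| * (σ i * y i) := by gcongr
        _ = _ := by ring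
  have hmarkov := mul_meas_ge_le_pow_eLpNorm' (blockLawY n p) (p := r) (by simpa) (by simp)
    (measurable_dot a).aestronglyMeasurable (ENNReal.ofReal ε)
  rw [ENNReal.coe_toReal] at hmarkov
  have h1 : ENNReal.ofReal ((ε * (1 / 72)) ^ (r : ℝ)) ≤
      eLpNorm (fun x => dot x a) r (blockLawY n p) ^ (r : ℝ) := by
    refine le_trans ?_ hmarkov
    rw [Real.mul_rpow hε0 (by norm_num), ENNReal.ofReal_mul (by positivity),
      ENNReal.ofReal_rpow_of_nonneg hε0 hr'.le]
    gcongr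
    exact hEprob.trans (measure_mono hEsub)
  rw [← ENNReal.ofReal_rpow_of_nonneg (by positivity) hr'.le, ENNReal.rpow_le_rpow_iff hr'] at h1
  refine (ENNReal.ofReal_le_ofReal ?_).trans h1
  have hnn : 0 ≤ (r : ℝ) ^ (1 / p) * ellNorm q a := mul_nonneg (by positivity) (ellNorm_nonneg _ _)
  have : (1 : ℝ) / 6 ≤ 1 / (2 * β) := by
    apply one_div_le_one_div_of_le (by positivity); linarith
  calc _ = 1 / 6 * ((r : ℝ) ^ (1 / p) * ellNorm q a) * (1 / 72) := by ring
    _ ≤ _ := by rw [hε]; gcongr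

end ModelFunctional

/-! ### Moments of sums of independent symmetric variables -/

section Tails

variable {Ω : Type*} {mΩ : MeasurableSpace Ω} {μ : Measure Ω}

/-- A variable whose moments of orders `r` and `2r` are comparable exceeds half of its `r`-th
moment with probability at least `c ^ r`, where `c` depends on the ratio of the moments only
(Paley–Zygmund). -/
theorem le_measure_eLpNorm_div_two_le [IsProbabilityMeasure μ] {Z : Ω → ℝ} (hZ : Measurable Z)
    {r : ℝ≥0} (hr : 1 ≤ r) {D : ℝ≥0} (hD : 1 ≤ D) (hfin : eLpNorm Z r μ ≠ ∞)
    (hdouble : eLpNorm Z ((2 * r : ℝ≥0) : ℝ≥0∞) μ ≤ D * eLpNorm Z r μ) :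
    ((1 / (4 * D ^ 2) : ℝ≥0) : ℝ≥0∞) ^ (r : ℝ) ≤ μ {x | eLpNorm Z r μ / 2 ≤ ‖Z x‖ₑ} := by
  have hr0 : r ≠ 0 := (zero_lt_one.trans_le hr).ne'
  have hr' : (0 : ℝ) < r := by positivity
  have hD0 : D ≠ 0 := (zero_lt_one.trans_le hD).ne'
  set N := eLpNorm Z r μ with hN
  rcases eq_or_ne N 0 with h0 | h0
  · simp only [h0, ENNReal.zero_div, zero_le, ofPred_true, measure_univ]
    refine ENNReal.rpow_le_one ?_ hr'.le
    rw [ENNReal.coe_le_one_iff]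
    refine div_le_one_of_le₀ ?_ (by positivity)
    nlinarith [one_le_pow₀ hD (n := 2)]
  set S := {x | N / 2 ≤ ‖Z x‖ₑ} with hS
  have hSm : MeasurableSet S := measurableSet_le measurable_const hZ.enorm
  have hsplit : N ≤ eLpNorm (S.indicator Z) r μ + eLpNorm (Sᶜ.indicator Z) r μ := by
    have h := eLpNorm_add_le (p := r) (μ := μ) (hZ.indicator hSm).aestronglyMeasurable
      (hZ.indicator hSm.compl).aestronglyMeasurable (by exact_mod_cast hr)
    rwa [indicator_self_add_compl] at h
  have hsmall : eLpNorm (Sᶜ.indicator Z) r μ ≤ N / 2 := by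
    refine (eLpNorm_le_of_ae_enorm_bound (C := N / 2) (Filter.Eventually.of_forall fun x => ?_)).trans
      (by simp)
    by_cases hx : x ∈ S
    · simp [hx]
    · rw [indicator_of_mem (by exact hx)]
      exact (not_le.1 hx).le
  have hlarge : eLpNorm (S.indicator Z) r μ ≤ D * N * μ S ^ (1 / (2 * (r : ℝ))) := by
    rw [eLpNorm_indicator_eq_eLpNorm_restrict hSm]
    have hle : (r : ℝ≥0∞) ≤ ((2 * r : ℝ≥0) : ℝ≥0∞) := by
      exact_mod_cast le_mul_of_one_le_left' one_le_two
    refine (eLpNorm_le_eLpNorm_mul_rpow_measure_univ hle hZ.aestronglyMeasurable).trans ?_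
    rw [Measure.restrict_apply_univ]
    have e : 1 / (r : ℝ≥0∞).toReal - 1 / ((2 * r : ℝ≥0) : ℝ≥0∞).toReal = 1 / (2 * (r : ℝ)) := by
      simp only [ENNReal.coe_toReal, NNReal.coe_mul, NNReal.coe_ofNat]
      field_simp
      norm_num
    rw [e]
    gcongr
    exact (eLpNorm_mono_measure _ Measure.restrict_le_self).trans hdouble
  have hhalf : N / 2 ≤ D * N * μ S ^ (1 / (2 * (r : ℝ))) := by
    have h : N / 2 + N / 2 ≤ D * N * μ S ^ (1 / (2 * (r : ℝ))) + N / 2 := by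
      rw [ENNReal.add_halves]
      exact hsplit.trans (add_le_add hlarge hsmall)
    exact (ENNReal.add_le_add_iff_right (ENNReal.div_ne_top hfin (by norm_num))).1 h
  have h1 : ((1 / (2 * D) : ℝ≥0) : ℝ≥0∞) ≤ μ S ^ (1 / (2 * (r : ℝ))) := by
    have h2 : N * ((1 / (2 * D) : ℝ≥0) : ℝ≥0∞) ≤ N * μ S ^ (1 / (2 * (r : ℝ))) := by
      have e : (D : ℝ≥0∞) * (N * ((1 / (2 * D) : ℝ≥0) : ℝ≥0∞)) = N / 2 := by
        rw [mul_left_comm, ← ENNReal.coe_mul, show D * (1 / (2 * D)) = (2 : ℝ≥0)⁻¹ by field_simp,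
          ENNReal.coe_inv (by norm_num), div_eq_mul_inv]
        rfl
      rw [← e, mul_assoc] at hhalf
      exact (ENNReal.mul_le_mul_iff_right (by exact_mod_cast hD0) ENNReal.coe_ne_top).1 hhalf
    exact (ENNReal.mul_le_mul_iff_right h0 hfin).1 h2
  have h2 := ENNReal.rpow_le_rpow h1 (show 0 ≤ 2 * (r : ℝ) by positivity)
  rw [← ENNReal.rpow_mul, one_div_mul_cancel (by positivity), ENNReal.rpow_one,
    ENNReal.rpow_mul] at h2
  convert h2 using 2
  rw [show (2 : ℝ) = ((2 : ℕ) : ℝ) by norm_num, ENNReal.rpow_natCast, ← ENNReal.coe_pow]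
  congr 1
  rw [div_pow, mul_pow]
  norm_num

/-- The one-sided version of `le_measure_eLpNorm_div_two_le` for a symmetric variable, which
costs a factor `1/2` of the probability. -/
theorem le_measure_le_of_symmetric [IsProbabilityMeasure μ] {Z : Ω → ℝ} (hZ : Measurable Z)
    (hsymm : ∀ c, μ {x | c ≤ Z x} = μ {x | Z x ≤ -c})
    {r : ℝ≥0} (hr : 1 ≤ r) {D : ℝ≥0} (hD : 1 ≤ D) (hfin : eLpNorm Z r μ ≠ ∞)
    (hdouble : eLpNorm Z ((2 * r : ℝ≥0) : ℝ≥0∞) μ ≤ D * eLpNorm Z r μ) :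
    ((1 / (8 * D ^ 2) : ℝ≥0) : ℝ≥0∞) ^ (r : ℝ) ≤ μ {x | (eLpNorm Z r μ / 2).toReal ≤ Z x} := by
  have h := le_measure_eLpNorm_div_two_le hZ hr hD hfin hdouble
  set θ := (eLpNorm Z r μ / 2).toReal with hθ
  have hθ' : eLpNorm Z r μ / 2 = ENNReal.ofReal θ :=
    (ENNReal.ofReal_toReal (ENNReal.div_ne_top hfin (by norm_num))).symm
  have hsub : {x | eLpNorm Z r μ / 2 ≤ ‖Z x‖ₑ} ⊆ {x | θ ≤ Z x} ∪ {x | Z x ≤ -θ} := by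
    intro x hx
    have hx' : eLpNorm Z r μ / 2 ≤ ‖Z x‖ₑ := hx
    rw [hθ', Real.enorm_eq_ofReal_abs, ENNReal.ofReal_le_ofReal_iff (abs_nonneg _), le_abs] at hx'
    rcases hx' with h | h
    · exact Or.inl h
    · exact Or.inr (by change Z x ≤ -θ; linarith)
  have h2 : ((1 / (4 * D ^ 2) : ℝ≥0) : ℝ≥0∞) ^ (r : ℝ) ≤ 2 * μ {x | θ ≤ Z x} := by
    refine h.trans ((measure_mono hsub).trans ((measure_union_le _ _).trans ?_))
    rw [← hsymm, two_mul]
  have h3 : ((1 / (8 * D ^ 2) : ℝ≥0) : ℝ≥0∞) ^ (r : ℝ) =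
      (2⁻¹ : ℝ≥0∞) ^ (r : ℝ) * ((1 / (4 * D ^ 2) : ℝ≥0) : ℝ≥0∞) ^ (r : ℝ) := by
    rw [← ENNReal.mul_rpow_of_nonneg _ _ (by positivity)]
    congr 1
    rw [show (2⁻¹ : ℝ≥0∞) = ((2⁻¹ : ℝ≥0) : ℝ≥0∞) by rw [ENNReal.coe_inv (by norm_num)]; rfl,
      ← ENNReal.coe_mul]
    congr 1
    rw [one_div, one_div, ← mul_inv]
    congr 1
    ring
  have h4 : (2⁻¹ : ℝ≥0∞) ^ (r : ℝ) ≤ 2⁻¹ := by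
    conv_rhs => rw [← ENNReal.rpow_one 2⁻¹]
    exact ENNReal.rpow_le_rpow_of_exponent_ge (by norm_num) (by exact_mod_cast hr)
  rw [h3]
  calc _ ≤ (2⁻¹ : ℝ≥0∞) * (2 * μ {x | θ ≤ Z x}) := mul_le_mul' h4 h2
    _ = _ := by rw [← mul_assoc, ENNReal.inv_mul_cancel (by norm_num) (by norm_num), one_mul]

/-- Chebyshev's inequality with a moment of order `r`. -/
theorem measure_four_mul_eLpNorm_lt {Z : Ω → ℝ} (hZ : Measurable Z) {r : ℝ≥0}
    (hr : r ≠ 0) (hfin : eLpNorm Z r μ ≠ ∞) :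
    μ {x | 4 * eLpNorm Z r μ < ‖Z x‖ₑ} ≤ (4⁻¹ : ℝ≥0∞) ^ (r : ℝ) := by
  have hr' : (0 : ℝ) < r := by positivity
  set N := eLpNorm Z r μ with hN
  rcases eq_or_ne N 0 with h0 | h0
  · have hae := (eLpNorm_eq_zero_iff hZ.aestronglyMeasurable (by simpa)).1 (hN.symm.trans h0)
    have : μ {x | 4 * N < ‖Z x‖ₑ} = 0 := by
      rw [measure_eq_zero_iff_ae_notMem]
      filter_upwards [hae] with x hx
      simp [hx]
    rw [this]
    exact zero_le
  have h := mul_meas_ge_le_pow_eLpNorm' μ (p := r) (by simpa) (by simp)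
    hZ.aestronglyMeasurable (4 * N)
  rw [ENNReal.coe_toReal, ← hN, ENNReal.mul_rpow_of_nonneg _ _ hr'.le, mul_right_comm] at h
  have hNr : N ^ (r : ℝ) ≠ 0 := by simp [h0, hfin]
  have hNr' : N ^ (r : ℝ) ≠ ∞ := ENNReal.rpow_ne_top_of_nonneg hr'.le hfin
  have h4 : (4 : ℝ≥0∞) ^ (r : ℝ) * μ {x | 4 * N ≤ ‖Z x‖ₑ} ≤ 1 := by
    have : (4 : ℝ≥0∞) ^ (r : ℝ) * μ {x | 4 * N ≤ ‖Z x‖ₑ} * N ^ (r : ℝ) ≤ 1 * N ^ (r : ℝ) := by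
      rwa [one_mul]
    exact (ENNReal.mul_le_mul_iff_left hNr hNr').1 this
  calc μ {x | 4 * N < ‖Z x‖ₑ} ≤ μ {x | 4 * N ≤ ‖Z x‖ₑ} := measure_mono
        fun x (hx : 4 * N < ‖Z x‖ₑ) => hx.le
    _ = (4⁻¹ : ℝ≥0∞) ^ (r : ℝ) * ((4 : ℝ≥0∞) ^ (r : ℝ) * μ {x | 4 * N ≤ ‖Z x‖ₑ}) := by
        rw [← mul_assoc, ← ENNReal.mul_rpow_of_nonneg _ _ hr'.le,
          ENNReal.inv_mul_cancel (by norm_num) (by norm_num), ENNReal.one_rpow, one_mul]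
    _ ≤ _ := mul_le_of_le_one_right' h4

/-- A random moment order `m + J` at which the moment dominates the variable: `J` is the least
order that works. By `measure_four_mul_eLpNorm_lt` it has an exponential moment, expressed through
the measurable majorant `W` of `2 ^ J`. -/
theorem exists_dominating_order {Z : Ω → ℝ} [IsProbabilityMeasure μ] (hZ : Measurable Z) {m : ℕ}
    (hm : 1 ≤ m) (hfin : ∀ r : ℝ≥0, (m : ℝ≥0) ≤ r → eLpNorm Z r μ ≠ ∞) :
    ∃ (J : Ω → ℕ) (W : Ω → ℝ≥0∞), Measurable W ∧ ∫⁻ x, W x ∂μ ≤ 2 ∧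
      (∀ x, (2 : ℝ≥0∞) ^ J x ≤ W x) ∧
      ∀ᵐ x ∂μ, ‖Z x‖ₑ ≤ 4 * eLpNorm Z ((m + J x : ℝ≥0) : ℝ≥0∞) μ := by
  classical
  set S : ℕ → Set Ω := fun j => {x | 4 * eLpNorm Z ((m + j : ℝ≥0) : ℝ≥0∞) μ < ‖Z x‖ₑ} with hS
  have hSm : ∀ j, MeasurableSet (S j) := fun j => measurableSet_lt measurable_const hZ.enorm
  have hSμ : ∀ j, μ (S j) ≤ (4⁻¹ : ℝ≥0∞) ^ (j + 1) := by
    intro j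
    have hne : ((m : ℝ≥0) + j) ≠ 0 := by positivity
    refine (measure_four_mul_eLpNorm_lt hZ hne (hfin _ (by simp))).trans ?_
    rw [← ENNReal.rpow_natCast]
    refine ENNReal.rpow_le_rpow_of_exponent_ge (by norm_num) ?_
    push_cast
    have : (1 : ℝ) ≤ m := by exact_mod_cast hm
    linarith
  have hex : ∀ᵐ x ∂μ, ∃ j, x ∉ S j := by
    have h0 : μ (⋂ j, S j) = 0 := by
      have hlim : Filter.Tendsto (fun j : ℕ => (4⁻¹ : ℝ≥0∞) ^ (j + 1)) Filter.atTop (nhds 0) :=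
        (ENNReal.tendsto_pow_atTop_nhds_zero_of_lt_one (by norm_num)).comp
          (Filter.tendsto_add_atTop_nat 1)
      refine le_antisymm (ge_of_tendsto' hlim fun j => ?_) zero_le
      exact (measure_mono (iInter_subset S j)).trans (hSμ j)
    filter_upwards [measure_eq_zero_iff_ae_notMem.1 h0] with x hx
    simpa using hx
  set W : Ω → ℝ≥0∞ := fun x => 1 + ∑' j, (S j).indicator (fun _ => (2 : ℝ≥0∞) ^ (j + 1)) x with hW
  refine ⟨fun x => sInf {j | x ∉ S j}, W, ?_, ?_, fun x => ?_, ?_⟩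
  · exact measurable_const.add
      (Measurable.tsum (f := fun j x => (S j).indicator (fun _ => (2 : ℝ≥0∞) ^ (j + 1)) x)
        fun j => measurable_const.indicator (hSm j))
  · have hsum : ∑' j : ℕ, ∫⁻ x, (S j).indicator (fun _ => (2 : ℝ≥0∞) ^ (j + 1)) x ∂μ ≤ 1 := by
      calc _ ≤ ∑' j : ℕ, (2⁻¹ : ℝ≥0∞) ^ (j + 1) := by
            refine ENNReal.tsum_le_tsum fun j => ?_
            rw [lintegral_indicator_const (hSm j)]
            refine (mul_le_mul_right (hSμ j) _).trans (le_of_eq ?_)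
            rw [← mul_pow]
            congr 1
            rw [show (4 : ℝ≥0∞) = 2 * 2 by norm_num, ENNReal.mul_inv (by simp) (by simp),
              ← mul_assoc, ENNReal.mul_inv_cancel (by norm_num) (by norm_num), one_mul]
        _ = 1 := by
            rw [ENNReal.tsum_geometric_add_one, ENNReal.one_sub_inv_two, inv_inv]
            exact ENNReal.inv_mul_cancel (by norm_num) (by norm_num)
    rw [hW, lintegral_add_left measurable_const,
      lintegral_tsum fun j => (measurable_const.indicator (hSm j)).aemeasurable]
    simp only [lintegral_const, measure_univ, mul_one]
    calc _ ≤ (1 : ℝ≥0∞) + 1 := by gcongr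
      _ = 2 := by norm_num
  · -- if the least order is `j + 1`, then `j` is too small
    change (2 : ℝ≥0∞) ^ sInf {j | x ∉ S j} ≤ W x
    rcases h : sInf {j | x ∉ S j} with _ | j
    · simp [hW]
    · have hj : x ∈ S j := by
        by_contra hcon
        have := Nat.sInf_le (s := {j | x ∉ S j}) hcon
        omega
      refine le_trans ?_ (le_add_self)
      refine le_trans ?_ (ENNReal.le_tsum j)
      rw [indicator_of_mem hj]
  · filter_upwards [hex] with x hx
    exact not_lt.1 (Nat.sInf_mem (s := {j | x ∉ S j}) hx)

end Tails

section Sums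

variable {M : ℕ} {Ω : Fin M → Type*} {mΩ : ∀ k, MeasurableSpace (Ω k)} {μ : ∀ k, Measure (Ω k)}
  [∀ k, IsProbabilityMeasure (μ k)] {Z : ∀ k, Ω k → ℝ} {m : Fin M → ℕ} {q B : ℝ≥0}

/-- The lower bound: given orders `r_k` with the sum `q`, each `Z_k` with `r_k ≥ m_k` exceeds half
of its `r_k`-th moment with probability at least `c ^ r_k`. The others, of which
there are at most `∑ m_k ≤ q` that do not vanish, are nonnegative with probability at least `1/2`.
By independence all these events occur together with probability at least `c ^ (2q)`, whose `q`-th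
root is a constant. -/
theorem supSplit_le_eLpNorm_sum (hZ : ∀ k, Measurable (Z k)) (hB : 1 ≤ B) (hq : q ≠ 0)
    (hm : ∑ k, (m k : ℝ≥0) ≤ q) (hzero : ∀ k, m k = 0 → Z k = 0)
    (hsymm : ∀ k c, μ k {x | c ≤ Z k x} = μ k {x | Z k x ≤ -c})
    (hfin : ∀ k, 1 ≤ m k → ∀ r : ℝ≥0, (m k : ℝ≥0) ≤ r → eLpNorm (Z k) r (μ k) ≠ ∞)
    (hreg : ∀ k, 1 ≤ m k → ∀ r l : ℝ≥0, (m k : ℝ≥0) ≤ r → 1 ≤ l →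
      eLpNorm (Z k) ((l * r : ℝ≥0) : ℝ≥0∞) (μ k) ≤
        ((B * l ^ 2 : ℝ≥0) : ℝ≥0∞) * eLpNorm (Z k) r (μ k)) :
    supSplit q (fun k r => eLpNorm (Z k) r (μ k)) m ≤
      ((2 * (8 * (4 * B) ^ 2) ^ 2 : ℝ≥0) : ℝ≥0∞) *
        eLpNorm (fun x => ∑ k, Z k (x k)) q (Measure.pi μ) := by
  have hq' : (0 : ℝ) < q := by positivity
  have hB0 : B ≠ 0 := (zero_lt_one.trans_le hB).ne'
  set D : ℝ≥0 := 4 * B with hDdef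
  have hD : 1 ≤ D := hB.trans (le_mul_of_one_le_left' (by norm_num))
  set c : ℝ≥0 := 1 / (8 * D ^ 2) with hc
  have hc2 : c ≤ 2⁻¹ := by
    rw [hc, one_div]
    refine inv_anti₀ (by norm_num) ?_
    nlinarith [one_le_pow₀ hD (n := 2)]
  have hc1 : c ≤ 1 := hc2.trans (by norm_num)
  have hcE : (c : ℝ≥0∞) ≤ 1 := by exact_mod_cast hc1
  unfold supSplit
  refine iSup₂_le fun r hr => ?_
  set θ : Fin M → ℝ := fun k =>
    if (m k : ℝ≥0) ≤ r k then (eLpNorm (Z k) (r k) (μ k) / 2).toReal else 0 with hθ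
  have hθ0 : ∀ k, 0 ≤ θ k := fun k => by
    rw [hθ]; simp only; split_ifs <;> positivity
  have hN : ∀ k, (if (m k : ℝ≥0) ≤ r k then eLpNorm (Z k) (r k) (μ k) else 0) =
      2 * ENNReal.ofReal (θ k) := by
    intro k
    rw [hθ]
    simp only
    split_ifs with h
    · have hne : eLpNorm (Z k) (r k) (μ k) ≠ ∞ := by
        rcases Nat.eq_zero_or_pos (m k) with h0 | h0
        · simp [hzero k h0]
        · exact hfin k h0 _ h
      rw [ENNReal.ofReal_toReal (ENNReal.div_ne_top hne (by norm_num)),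
        ENNReal.mul_div_cancel (by norm_num) (by norm_num)]
    · simp
  have hprob : ∀ k, (c : ℝ≥0∞) ^ ((r k : ℝ) + m k) ≤ μ k {x | θ k ≤ Z k x} := by
    intro k
    rcases Nat.eq_zero_or_pos (m k) with h0 | h0
    · have : θ k = 0 := by rw [hθ]; simp [hzero k h0]
      simp only [this, hzero k h0, Pi.zero_apply, le_refl, ofPred_true, measure_univ]
      exact ENNReal.rpow_le_one hcE (by positivity)
    have hm1 : (1 : ℝ≥0) ≤ m k := by exact_mod_cast h0
    have hm1' : (1 : ℝ) ≤ m k := by exact_mod_cast h0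
    by_cases h : (m k : ℝ≥0) ≤ r k
    · have hdouble := hreg k h0 (r k) 2 h (by norm_num)
      rw [show B * 2 ^ 2 = D by rw [hDdef]; ring] at hdouble
      have := le_measure_le_of_symmetric (hZ k) (hsymm k) (hm1.trans h) hD (hfin k h0 _ h) hdouble
      rw [← hc] at this
      have e : θ k = (eLpNorm (Z k) (r k) (μ k) / 2).toReal := by rw [hθ]; simp [h]
      rw [e]
      refine le_trans ?_ this
      exact ENNReal.rpow_le_rpow_of_exponent_ge hcE (by linarith)
    · have e : θ k = 0 := by rw [hθ]; simp [h]
      rw [e]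
      have hhalf : (1 : ℝ≥0∞) ≤ 2 * μ k {x | 0 ≤ Z k x} := by
        rw [two_mul]
        nth_rewrite 2 [hsymm k 0]
        rw [neg_zero, ← measure_univ (μ := μ k)]
        refine le_trans (measure_mono fun x _ => ?_) (measure_union_le _ _)
        exact le_total 0 (Z k x)
      calc (c : ℝ≥0∞) ^ ((r k : ℝ) + m k) ≤ (c : ℝ≥0∞) ^ (1 : ℝ) := by
            refine ENNReal.rpow_le_rpow_of_exponent_ge hcE ?_
            have := (r k).2
            have : (0 : ℝ) ≤ r k := this
            linarith
        _ ≤ 2⁻¹ := by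
            rw [ENNReal.rpow_one, show (2⁻¹ : ℝ≥0∞) = ((2⁻¹ : ℝ≥0) : ℝ≥0∞) by
              rw [ENNReal.coe_inv (by norm_num)]; rfl]
            exact_mod_cast hc2
        _ ≤ 2⁻¹ * (2 * μ k {x | 0 ≤ Z k x}) := le_mul_of_one_le_right' hhalf
        _ = _ := by rw [← mul_assoc, ENNReal.inv_mul_cancel (by norm_num) (by norm_num), one_mul]
  set E : Set (∀ k, Ω k) := univ.pi fun k => {x | θ k ≤ Z k x} with hE
  have hmR : ∑ k, (m k : ℝ) ≤ q := by exact_mod_cast hm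
  have hEprob : ((c ^ 2 : ℝ≥0) : ℝ≥0∞) ^ (q : ℝ) ≤ Measure.pi μ E := by
    rw [hE, Measure.pi_pi]
    refine le_trans ?_ (Finset.prod_le_prod' fun k _ => hprob k)
    have hcne : (c : ℝ≥0∞) ≠ 0 := by
      rw [hc]
      have : (1 / (8 * D ^ 2) : ℝ≥0) ≠ 0 := by positivity
      exact_mod_cast this
    have hprodrpow : ∏ k, (c : ℝ≥0∞) ^ ((r k : ℝ) + m k) =
        (c : ℝ≥0∞) ^ (∑ k, ((r k : ℝ) + m k)) := by
      induction (Finset.univ : Finset (Fin M)) using Finset.induction_on with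
      | empty => simp
      | insert a s ha ih =>
        rw [Finset.prod_insert ha, Finset.sum_insert ha, ih,
          ← ENNReal.rpow_add _ _ hcne ENNReal.coe_ne_top]
    rw [hprodrpow, ENNReal.coe_pow, ← ENNReal.rpow_natCast, ← ENNReal.rpow_mul,
      Finset.sum_add_distrib, hr]
    refine ENNReal.rpow_le_rpow_of_exponent_ge hcE ?_
    push_cast
    linarith
  set ε := ENNReal.ofReal (∑ k, θ k) with hε
  have hEsub : E ⊆ {x | ε ≤ ‖∑ k, Z k (x k)‖ₑ} := by
    intro x hx
    change ε ≤ ‖∑ k, Z k (x k)‖ₑ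
    rw [Real.enorm_eq_ofReal_abs]
    refine ENNReal.ofReal_le_ofReal (le_trans ?_ (le_abs_self _))
    exact Finset.sum_le_sum fun k _ => hx k trivial
  have hmeas : Measurable fun x : (∀ k, Ω k) => ∑ k, Z k (x k) :=
    Finset.measurable_sum _ fun k _ => (hZ k).comp (measurable_pi_apply k)
  have hmarkov := mul_meas_ge_le_pow_eLpNorm' (Measure.pi μ) (p := q) (by simpa) (by simp)
    hmeas.aestronglyMeasurable ε
  rw [ENNReal.coe_toReal] at hmarkov
  have h1 : (ε * ((c ^ 2 : ℝ≥0) : ℝ≥0∞)) ^ (q : ℝ) ≤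
      eLpNorm (fun x => ∑ k, Z k (x k)) q (Measure.pi μ) ^ (q : ℝ) := by
    refine le_trans ?_ hmarkov
    rw [ENNReal.mul_rpow_of_nonneg _ _ hq'.le]
    gcongr
    exact hEprob.trans (measure_mono hEsub)
  rw [ENNReal.rpow_le_rpow_iff hq'] at h1
  have hLHS : (∑ k, if (m k : ℝ≥0) ≤ r k then eLpNorm (Z k) (r k) (μ k) else 0) = 2 * ε := by
    simp_rw [hN]
    rw [← Finset.mul_sum, hε, ENNReal.ofReal_sum_of_nonneg fun k _ => hθ0 k]
  rw [hLHS]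
  calc 2 * ε = ((2 * (8 * D ^ 2) ^ 2 : ℝ≥0) : ℝ≥0∞) * (ε * ((c ^ 2 : ℝ≥0) : ℝ≥0∞)) := by
        rw [mul_left_comm, ← ENNReal.coe_mul, mul_comm 2 ε]
        congr 1
        have : 2 * (8 * D ^ 2) ^ 2 * c ^ 2 = 2 := by
          rw [hc]
          have : D ≠ 0 := by positivity
          field_simp
        rw [this]
        rfl
    _ ≤ _ := by gcongr

/-- Moments of the orders `m_k + j_k`, whose sum may exceed `q`, are compared with moments of the
smaller orders `m_k + j_k / l`: for `l = 1 + 2 ∑ j_k / q` the latter sum up to at most `q`, because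
`∑ m_k ≤ q / 2`, and regularity of the moments makes the loss a factor `B l ^ 2`. -/
theorem sum_eLpNorm_le_supSplit (hZ : ∀ k, Measurable (Z k)) (hq : q ≠ 0)
    (hm : 2 * ∑ k, (m k : ℝ≥0) ≤ q) (hzero : ∀ k, m k = 0 → Z k = 0)
    (hreg : ∀ k, 1 ≤ m k → ∀ r l : ℝ≥0, (m k : ℝ≥0) ≤ r → 1 ≤ l →
      eLpNorm (Z k) ((l * r : ℝ≥0) : ℝ≥0∞) (μ k) ≤
        ((B * l ^ 2 : ℝ≥0) : ℝ≥0∞) * eLpNorm (Z k) r (μ k)) (j : Fin M → ℕ) :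
    ∑ k, eLpNorm (Z k) ((m k + j k : ℝ≥0) : ℝ≥0∞) (μ k) ≤
      ((B * (1 + 2 * (∑ k, (j k : ℝ≥0)) / q) ^ 2 : ℝ≥0) : ℝ≥0∞) *
        supSplit q (fun k r => eLpNorm (Z k) r (μ k)) m := by
  classical
  set l : ℝ≥0 := 1 + 2 * (∑ k, (j k : ℝ≥0)) / q with hl
  have hl1 : 1 ≤ l := le_self_add
  have hl0 : 0 < l := zero_lt_one.trans_le hl1
  rcases isEmpty_or_nonempty (Fin M) with hemp | ⟨⟨k₀⟩⟩
  · simp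
  set r' : Fin M → ℝ≥0 := fun k => m k + j k / l with hr'
  have hsum : ∑ k, r' k ≤ q := by
    rw [hr', Finset.sum_add_distrib, ← Finset.sum_div]
    have h1 : (∑ k, (j k : ℝ≥0)) / l ≤ q / 2 := by
      rw [div_le_iff₀ hl0, hl]
      have : q / 2 * (2 * (∑ k, (j k : ℝ≥0)) / q) = ∑ k, (j k : ℝ≥0) := by field_simp
      rw [mul_add, this]
      exact le_add_self
    have h2 : ∑ k, (m k : ℝ≥0) ≤ q / 2 := by
      rw [le_div_iff₀ (by norm_num), mul_comm]
      exact hm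
    calc _ ≤ q / 2 + q / 2 := add_le_add h2 h1
      _ = q := add_halves q
  set r : Fin M → ℝ≥0 := fun k => r' k + if k = k₀ then q - ∑ k, r' k else 0 with hr
  have hrsum : ∑ k, (r k : ℝ) = q := by
    have : ∑ k, r k = q := by
      rw [hr, Finset.sum_add_distrib]
      simp only [Finset.sum_ite_eq', Finset.mem_univ, if_true]
      exact add_tsub_cancel_of_le hsum
    exact_mod_cast this
  have hle : ∑ k, (if (m k : ℝ≥0) ≤ r k then eLpNorm (Z k) (r k) (μ k) else 0) ≤
      supSplit q (fun k r => eLpNorm (Z k) r (μ k)) m :=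
    le_iSup₂_of_le (f := fun (r : Fin M → ℝ≥0) (_ : ∑ k, (r k : ℝ) = q) =>
      ∑ k, if (m k : ℝ≥0) ≤ r k then eLpNorm (Z k) (r k) (μ k) else 0) r hrsum le_rfl
  refine le_trans ?_ (mul_le_mul_right hle _)
  rw [Finset.mul_sum]
  refine Finset.sum_le_sum fun k _ => ?_
  rcases Nat.eq_zero_or_pos (m k) with h0 | h0
  · simp [hzero k h0]
  have hmr : (m k : ℝ≥0) ≤ r k := by
    rw [hr, hr']
    exact le_self_add.trans le_self_add
  rw [if_pos hmr]
  refine le_trans ?_ (hreg k h0 (r k) l hmr hl1)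
  refine eLpNorm_le_eLpNorm_of_exponent_le ?_ (hZ k).aestronglyMeasurable
  have : (m k : ℝ≥0) + j k ≤ l * r k := by
    calc (m k : ℝ≥0) + j k ≤ l * m k + l * (j k / l) := by
          rw [mul_div_cancel₀ _ hl0.ne']
          gcongr
          exact le_mul_of_one_le_left' hl1
      _ = l * r' k := by rw [hr']; ring
      _ ≤ l * r k := by gcongr; rw [hr]; exact le_self_add
  exact_mod_cast this

/-- The loss `l ^ 2` of `sum_eLpNorm_le_supSplit`, raised to the power `q`, is absorbed by the
exponential moment of the random orders. -/
theorem one_add_rpow_le {q : ℝ} (hq : 0 < q) (J : ℕ) :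
    (1 + 2 * J / q) ^ (2 * q) ≤ 64 ^ q * 2 ^ J := by
  have h1 : 1 + 2 * J / q ≤ 8 * (2 : ℝ) ^ (J / (2 * q)) := by
    have h2 : 1 + J / (4 * q) ≤ (2 : ℝ) ^ (J / (2 * q)) := by
      have h := Real.add_one_le_exp (J / (4 * q))
      have hlog : (1 : ℝ) / 2 ≤ Real.log 2 := by linarith [Real.log_two_gt_d9]
      have : Real.exp (J / (4 * q)) ≤ (2 : ℝ) ^ (J / (2 * q)) := by
        rw [Real.rpow_def_of_pos (by norm_num)]
        apply Real.exp_le_exp.2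
        calc (J : ℝ) / (4 * q) = 1 / 2 * (J / (2 * q)) := by field_simp; norm_num
          _ ≤ _ := by gcongr
      linarith
    have h3 : 2 * (J : ℝ) / q = 8 * (J / (4 * q)) := by field_simp; ring
    rw [h3]
    linarith
  calc (1 + 2 * J / q) ^ (2 * q) ≤ (8 * (2 : ℝ) ^ (J / (2 * q))) ^ (2 * q) := by gcongr
    _ = _ := by
        rw [Real.mul_rpow (by norm_num) (by positivity), ← Real.rpow_mul (by norm_num),
          Real.rpow_mul (by norm_num), div_mul_cancel₀ _ (by positivity), Real.rpow_natCast]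
        norm_num

/-- The upper bound: each `Z_k` is dominated by its moment of the random order `m_k + J_k` of
`exists_dominating_order`, and `sum_eLpNorm_le_supSplit` rescales these orders to the sum `q`, up to
a random factor whose `q`-th moment is bounded. -/
theorem eLpNorm_sum_le_supSplit (hZ : ∀ k, Measurable (Z k)) (hq : q ≠ 0)
    (hm : 2 * ∑ k, (m k : ℝ≥0) ≤ q) (hzero : ∀ k, m k = 0 → Z k = 0)
    (hfin : ∀ k, 1 ≤ m k → ∀ r : ℝ≥0, (m k : ℝ≥0) ≤ r → eLpNorm (Z k) r (μ k) ≠ ∞)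
    (hreg : ∀ k, 1 ≤ m k → ∀ r l : ℝ≥0, (m k : ℝ≥0) ≤ r → 1 ≤ l →
      eLpNorm (Z k) ((l * r : ℝ≥0) : ℝ≥0∞) (μ k) ≤
        ((B * l ^ 2 : ℝ≥0) : ℝ≥0∞) * eLpNorm (Z k) r (μ k)) :
    eLpNorm (fun x => ∑ k, Z k (x k)) q (Measure.pi μ) ≤
      ((512 * B : ℝ≥0) : ℝ≥0∞) * supSplit q (fun k r => eLpNorm (Z k) r (μ k)) m := by
  have hq' : (0 : ℝ) < q := by positivity
  set D := supSplit q (fun k r => eLpNorm (Z k) r (μ k)) m with hD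
  have hdom : ∀ k, ∃ (J : Ω k → ℕ) (W : Ω k → ℝ≥0∞), Measurable W ∧
      ∫⁻ x, W x ∂(μ k) ≤ 2 ^ m k ∧ (∀ x, (2 : ℝ≥0∞) ^ J x ≤ W x) ∧
      ∀ᵐ x ∂(μ k), ‖Z k x‖ₑ ≤ 4 * eLpNorm (Z k) ((m k + J x : ℝ≥0) : ℝ≥0∞) (μ k) := by
    intro k
    rcases Nat.eq_zero_or_pos (m k) with h0 | h0
    · refine ⟨fun _ => 0, fun _ => 1, measurable_const, by simp [h0], by simp, ?_⟩
      simp [hzero k h0]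
    · obtain ⟨J, W, h1, h2, h3⟩ := exists_dominating_order (hZ k) h0 (hfin k h0)
      exact ⟨J, W, h1, h2.trans (le_self_pow (by norm_num) (by omega)), h3⟩
  choose J W hWm hWint hJW hJ using hdom
  have hae : ∀ᵐ x ∂(Measure.pi μ), ∀ k,
      ‖Z k (x k)‖ₑ ≤ 4 * eLpNorm (Z k) ((m k + J k (x k) : ℝ≥0) : ℝ≥0∞) (μ k) :=
    ae_all_iff.2 fun k => (measurePreserving_eval μ k).quasiMeasurePreserving.ae (hJ k)
  have hpt : ∀ᵐ x ∂(Measure.pi μ), ‖∑ k, Z k (x k)‖ₑ ^ (q : ℝ) ≤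
      (((256 * B : ℝ≥0) : ℝ≥0∞) * D) ^ (q : ℝ) * ∏ k, W k (x k) := by
    filter_upwards [hae] with x hx
    set l : ℝ≥0 := 1 + 2 * (∑ k, (J k (x k) : ℝ≥0)) / q with hl
    have h1 : ‖∑ k, Z k (x k)‖ₑ ≤ ((4 * B : ℝ≥0) : ℝ≥0∞) * D * ((l ^ 2 : ℝ≥0) : ℝ≥0∞) := by
      calc ‖∑ k, Z k (x k)‖ₑ ≤ ∑ k, ‖Z k (x k)‖ₑ := enorm_sum_le _ _
        _ ≤ ∑ k, 4 * eLpNorm (Z k) ((m k + J k (x k) : ℝ≥0) : ℝ≥0∞) (μ k) :=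
            Finset.sum_le_sum fun k _ => hx k
        _ ≤ 4 * (((B * l ^ 2 : ℝ≥0) : ℝ≥0∞) * D) := by
            rw [← Finset.mul_sum]
            gcongr
            exact sum_eLpNorm_le_supSplit hZ hq hm hzero hreg fun k => J k (x k)
        _ = _ := by
            push_cast
            ring
    have h2 : ((l ^ 2 : ℝ≥0) : ℝ≥0∞) ^ (q : ℝ) ≤ (64 : ℝ≥0∞) ^ (q : ℝ) * ∏ k, W k (x k) := by
      have h3 : (l ^ 2 : ℝ≥0) ^ (q : ℝ) ≤ (64 : ℝ≥0) ^ (q : ℝ) * 2 ^ (∑ k, J k (x k)) := by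
        have h := one_add_rpow_le hq' (∑ k, J k (x k))
        rw [← NNReal.coe_le_coe, hl]
        push_cast at h ⊢
        rw [Real.rpow_mul (by positivity), Real.rpow_ofNat] at h
        exact h
      rw [← ENNReal.coe_rpow_of_nonneg _ hq'.le]
      refine (ENNReal.coe_le_coe.2 h3).trans ?_
      rw [ENNReal.coe_mul, ENNReal.coe_rpow_of_nonneg _ hq'.le, ENNReal.coe_pow]
      refine mul_le_mul' le_rfl ?_
      rw [← Finset.prod_pow_eq_pow_sum]
      exact Finset.prod_le_prod' fun k _ => hJW k (x k)
    calc ‖∑ k, Z k (x k)‖ₑ ^ (q : ℝ)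
        ≤ (((4 * B : ℝ≥0) : ℝ≥0∞) * D * ((l ^ 2 : ℝ≥0) : ℝ≥0∞)) ^ (q : ℝ) :=
          ENNReal.rpow_le_rpow h1 hq'.le
      _ ≤ (((4 * B : ℝ≥0) : ℝ≥0∞) * D) ^ (q : ℝ) *
          ((64 : ℝ≥0∞) ^ (q : ℝ) * ∏ k, W k (x k)) := by
          rw [ENNReal.mul_rpow_of_nonneg _ _ hq'.le]
          gcongr
      _ = _ := by
          rw [← mul_assoc, ← ENNReal.mul_rpow_of_nonneg _ _ hq'.le]
          congr 2
          push_cast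
          ring
  have hint : ∫⁻ x, ‖∑ k, Z k (x k)‖ₑ ^ (q : ℝ) ∂(Measure.pi μ) ≤
      (((512 * B : ℝ≥0) : ℝ≥0∞) * D) ^ (q : ℝ) := by
    calc _ ≤ ∫⁻ x, (((256 * B : ℝ≥0) : ℝ≥0∞) * D) ^ (q : ℝ) * ∏ k, W k (x k) ∂(Measure.pi μ) :=
          lintegral_mono_ae hpt
      _ = (((256 * B : ℝ≥0) : ℝ≥0∞) * D) ^ (q : ℝ) * ∏ k, ∫⁻ x, W k x ∂(μ k) := by
          have hprod : Measurable fun x : (∀ k, Ω k) => ∏ k, W k (x k) :=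
            Finset.measurable_prod _ fun k _ => (hWm k).comp (measurable_pi_apply k)
          rw [lintegral_const_mul _ hprod, lintegral_pi_prod μ W hWm]
      _ ≤ (((256 * B : ℝ≥0) : ℝ≥0∞) * D) ^ (q : ℝ) * 2 ^ (q : ℝ) := by
          gcongr
          refine (Finset.prod_le_prod' fun k _ => hWint k).trans ?_
          rw [Finset.prod_pow_eq_pow_sum, ← ENNReal.rpow_natCast]
          refine ENNReal.rpow_le_rpow_of_exponent_le (by norm_num) ?_
          have h : (∑ k, (m k : ℝ≥0)) ≤ q :=
            (le_mul_of_one_le_left' (by norm_num)).trans hm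
          push_cast
          exact_mod_cast h
      _ = _ := by
          rw [← ENNReal.mul_rpow_of_nonneg _ _ hq'.le]
          congr 1
          push_cast
          ring
  rw [eLpNorm_eq_lintegral_rpow_enorm_toReal (by simpa) (by simp), ENNReal.coe_toReal]
  refine (ENNReal.rpow_le_rpow hint (by positivity)).trans (le_of_eq ?_)
  rw [← ENNReal.rpow_mul, mul_one_div_cancel hq'.ne', ENNReal.rpow_one]

end Sums

/-! ### Moments of linear functionals of one block -/

section Block

variable {n : ℕ} {p : ℝ} {U : ℝ → ℝ}

theorem isProbabilityMeasure_radialLaw (hn : 1 ≤ n) (hp : 1 < p) (hU : MonotoneOn U (Ici 0))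
    (hprob : IsProbabilityMeasure (blockLaw n p U)) :
    IsProbabilityMeasure (radialLaw n p U) :=
  ⟨by rw [radialLaw_univ hn hp hU, hprob.measure_univ]⟩

/-- The density of a block depends on the norm only, so linear functionals are symmetric. -/
theorem blockLaw_symmetric (hU : MonotoneOn U (Ici 0)) (u : Fin n → ℝ) (c : ℝ) :
    blockLaw n p U {x | c ≤ dot x u} = blockLaw n p U {x | dot x u ≤ -c} := by
  have hd := (measurable_exp_neg_comp hU p).comp (measurable_ellNorm (n := n) p)
  have h1 : MeasurableSet {x : Fin n → ℝ | c ≤ dot x u} :=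
    measurableSet_le measurable_const (measurable_dot u)
  have h2 : MeasurableSet {x : Fin n → ℝ | dot x u ≤ -c} :=
    measurableSet_le (measurable_dot u) measurable_const
  rw [blockLaw_eq, withDensity_apply _ h1, withDensity_apply _ h2]
  have h := (Measure.measurePreserving_neg (volume : Measure (Fin n → ℝ))).setLIntegral_comp_preimage
    h1 (f := fun x => ENNReal.ofReal (Real.exp (-U (max (ellNorm p x ^ p) 0)))) hd
  rw [← h]
  simp_rw [ellNorm_neg]
  congr 2
  ext x
  have : dot (-x) u = -dot x u := by simp [dot]
  simp only [mem_preimage, mem_ofPred_eq, this]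
  constructor <;> intro h <;> linarith

theorem eLpNorm_radialLaw_mono (hn : 1 ≤ n) (hp : 1 < p) (hU : MonotoneOn U (Ici 0))
    (hprob : IsProbabilityMeasure (blockLaw n p U)) {r₀ r₁ : ℝ≥0} (h : r₀ ≤ r₁) :
    eLpNorm (fun s => s) r₀ (radialLaw n p U) ≤ eLpNorm (fun s => s) r₁ (radialLaw n p U) := by
  have := isProbabilityMeasure_radialLaw hn hp hU hprob
  exact eLpNorm_le_eLpNorm_of_exponent_le (by exact_mod_cast h)
    measurable_id.aestronglyMeasurable

theorem eLpNorm_radialLaw_ne_top (hn : 1 ≤ n) (hp : 1 < p) (hU : MonotoneOn U (Ici 0))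
    (hUc : ConvexOn ℝ (Ici 0) U) (hprob : IsProbabilityMeasure (blockLaw n p U))
    (h2 : eLpNorm (fun s => s) (2 : ℝ≥0) (radialLaw n p U) ≠ ∞) (r : ℝ≥0) :
    eLpNorm (fun s => s) r (radialLaw n p U) ≠ ∞ := by
  rcases le_total r 2 with h | h
  · exact ne_top_of_le_ne_top h2 (eLpNorm_radialLaw_mono hn hp hU hprob h)
  · exact ne_top_of_le_ne_top (ENNReal.mul_ne_top ENNReal.ofReal_ne_top h2)
      (eLpNorm_radialLaw_le hn hp hU hUc hprob (by norm_num) h h2)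

/-- The moments of the radial part grow at most linearly in the order, whatever the dimension. -/
theorem growth_factor_le (hp : 1 < p) {r l : ℝ} (hr : 0 ≤ r) (hl : 1 ≤ l) (hn : 1 ≤ n) :
    ((n + l * r) / (n + r)) ^ (1 / p) ≤ l := by
  have hn' : (1 : ℝ) ≤ n := by exact_mod_cast hn
  have hp0 : 0 < p := by linarith
  have h1 : (n + l * r) / (n + r) ≤ l := by
    rw [div_le_iff₀ (by linarith)]
    nlinarith
  calc ((n + l * r) / (n + r)) ^ (1 / p) ≤ l ^ (1 / p) := by
        have : 0 ≤ (n + l * r) / (n + r) := by positivity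
        gcongr
    _ ≤ l ^ (1 : ℝ) := Real.rpow_le_rpow_of_exponent_le hl (by rw [div_le_one hp0]; exact hp.le)
    _ = l := Real.rpow_one l

theorem eLpNorm_radialLaw_mul_le (hn : 1 ≤ n) (hp : 1 < p) (hU : MonotoneOn U (Ici 0))
    (hUc : ConvexOn ℝ (Ici 0) U) (hprob : IsProbabilityMeasure (blockLaw n p U)) {r l : ℝ≥0}
    (hr : 1 ≤ r) (hl : 1 ≤ l) (hfin : eLpNorm (fun s => s) r (radialLaw n p U) ≠ ∞) :
    eLpNorm (fun s => s) ((l * r : ℝ≥0) : ℝ≥0∞) (radialLaw n p U) ≤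
      ((12 * l : ℝ≥0) : ℝ≥0∞) * eLpNorm (fun s => s) r (radialLaw n p U) := by
  refine (eLpNorm_radialLaw_le hn hp hU hUc hprob hr (le_mul_of_one_le_left' hl) hfin).trans ?_
  refine mul_le_mul' ?_ le_rfl
  rw [← ENNReal.ofReal_coe_nnreal]
  apply ENNReal.ofReal_le_ofReal
  push_cast
  gcongr
  exact growth_factor_le hp r.coe_nonneg (by exact_mod_cast hl) hn

theorem eLpNorm_radialLawY_pos (hn : 1 ≤ n) (hp : 1 < p) {r : ℝ≥0} (hr : r ≠ 0) :
    eLpNorm (fun s => s) r (radialLawY n p) ≠ 0 ∧ eLpNorm (fun s => s) r (radialLawY n p) ≠ ∞ := by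
  have hp0 : 0 < p := by linarith
  have hb := bConst_pos hp0
  have hg := gammaMoment_pos hn hp0 r.coe_nonneg
  have : 0 < bConst p ^ (-(1 / p)) * gammaMoment n p r ^ (1 / (r : ℝ)) := by
    have : 0 < gammaMoment n p r := hg
    positivity
  rw [eLpNorm_radialLawY hn hp hr]
  exact ⟨by simpa using this, ENNReal.ofReal_ne_top⟩

theorem eLpNorm_dot_blockLawY (hn : 1 ≤ n) (hp : 1 < p) (u : Fin n → ℝ) (r : ℝ≥0) :
    eLpNorm (fun x => dot x u) r (blockLawY n p) =
      eLpNorm (fun s => s) r (radialLawY n p) *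
        eLpNorm (fun v => dot v u) r (coneMeasure n p) := by
  rw [blockLawY_eq_blockLaw n hp, radialLawY_eq_radialLaw hn hp]
  exact eLpNorm_dot_blockLaw hn hp (monotoneOn_modelPotential n hp) u r

/-- The growth of the moments of the linear functionals of the cone measure, read off from those
of the model block. -/
theorem eLpNorm_dot_coneMeasure_mul_le (hn : 1 ≤ n) (hp : 1 < p) (u : Fin n → ℝ) {r l : ℝ≥0}
    (hr : 1 ≤ r) (hl : 1 ≤ l)
    (hm : ((Finset.univ.filter fun i => u i ≠ 0).card : ℝ≥0) ≤ r) :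
    eLpNorm (fun v => dot v u) ((l * r : ℝ≥0) : ℝ≥0∞) (coneMeasure n p) ≤
      ((5184 * l : ℝ≥0) : ℝ≥0∞) * eLpNorm (fun v => dot v u) r (coneMeasure n p) := by
  have hp0 : 0 < p := by linarith
  have hlr : r ≤ l * r := le_mul_of_one_le_left' hl
  have hr0 : r ≠ 0 := (zero_lt_one.trans_le hr).ne'
  have hl1 : (1 : ℝ) ≤ l := by exact_mod_cast hl
  have hE := ellNorm_nonneg p.conjExponent u
  obtain ⟨hpos, htop⟩ := eLpNorm_radialLawY_pos hn hp hr0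
  have hY : eLpNorm (fun x => dot x u) ((l * r : ℝ≥0) : ℝ≥0∞) (blockLawY n p) ≤
      ((5184 * l : ℝ≥0) : ℝ≥0∞) * eLpNorm (fun x => dot x u) r (blockLawY n p) := by
    refine (eLpNorm_dot_blockLawY_le hp u (hr.trans hlr) (hm.trans hlr)).trans ?_
    refine le_trans ?_ (mul_le_mul' le_rfl (le_eLpNorm_dot_blockLawY hp u hr hm))
    rw [← ENNReal.ofReal_coe_nnreal, ← ENNReal.ofReal_mul (by positivity)]
    apply ENNReal.ofReal_le_ofReal
    push_cast
    have h1 : ((l : ℝ) * r) ^ (1 / p) ≤ l * (r : ℝ) ^ (1 / p) := by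
      rw [Real.mul_rpow (by positivity) (by positivity)]
      gcongr
      calc (l : ℝ) ^ (1 / p) ≤ (l : ℝ) ^ (1 : ℝ) :=
            Real.rpow_le_rpow_of_exponent_le hl1 (by rw [div_le_one hp0]; exact hp.le)
        _ = l := Real.rpow_one _
    calc 12 * (((l : ℝ) * r) ^ (1 / p) * ellNorm p.conjExponent u)
        ≤ 12 * (l * (r : ℝ) ^ (1 / p) * ellNorm p.conjExponent u) := by gcongr
      _ = _ := by ring
  rw [eLpNorm_dot_blockLawY hn hp, eLpNorm_dot_blockLawY hn hp] at hY
  have hmono : eLpNorm (fun s => s) r (radialLawY n p) ≤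
      eLpNorm (fun s => s) ((l * r : ℝ≥0) : ℝ≥0∞) (radialLawY n p) := by
    rw [radialLawY_eq_radialLaw hn hp]
    refine eLpNorm_radialLaw_mono hn hp (monotoneOn_modelPotential n hp) ?_ hlr
    rw [← blockLawY_eq_blockLaw n hp]
    exact isProbabilityMeasure_blockLawY n hp
  refine (ENNReal.mul_le_mul_iff_right hpos htop).1 ?_
  refine (mul_le_mul' hmono le_rfl).trans (hY.trans (le_of_eq ?_))
  ring

/-- The regularity of the moments of linear functionals of a block: one factor `l` comes from the
radius and one from the direction. -/
theorem eLpNorm_dot_blockLaw_mul_le (hn : 1 ≤ n) (hp : 1 < p) (hU : MonotoneOn U (Ici 0))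
    (hUc : ConvexOn ℝ (Ici 0) U) (hprob : IsProbabilityMeasure (blockLaw n p U))
    (h2 : eLpNorm (fun s => s) (2 : ℝ≥0) (radialLaw n p U) ≠ ∞) (u : Fin n → ℝ) {r l : ℝ≥0}
    (hr : 1 ≤ r) (hl : 1 ≤ l)
    (hm : ((Finset.univ.filter fun i => u i ≠ 0).card : ℝ≥0) ≤ r) :
    eLpNorm (fun x => dot x u) ((l * r : ℝ≥0) : ℝ≥0∞) (blockLaw n p U) ≤
      ((62208 * l ^ 2 : ℝ≥0) : ℝ≥0∞) * eLpNorm (fun x => dot x u) r (blockLaw n p U) := by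
  rw [eLpNorm_dot_blockLaw hn hp hU, eLpNorm_dot_blockLaw hn hp hU]
  refine (mul_le_mul' (eLpNorm_radialLaw_mul_le hn hp hU hUc hprob hr hl
    (eLpNorm_radialLaw_ne_top hn hp hU hUc hprob h2 r))
    (eLpNorm_dot_coneMeasure_mul_le hn hp u hr hl hm)).trans (le_of_eq ?_)
  push_cast
  ring

theorem eLpNorm_dot_blockLaw_ne_top (hn : 1 ≤ n) (hp : 1 < p) (hU : MonotoneOn U (Ici 0))
    (hUc : ConvexOn ℝ (Ici 0) U) (hprob : IsProbabilityMeasure (blockLaw n p U))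
    (h2 : eLpNorm (fun s => s) (2 : ℝ≥0) (radialLaw n p U) ≠ ∞) (u : Fin n → ℝ) {r : ℝ≥0}
    (hr : 1 ≤ r) (hm : ((Finset.univ.filter fun i => u i ≠ 0).card : ℝ≥0) ≤ r) :
    eLpNorm (fun x => dot x u) r (blockLaw n p U) ≠ ∞ := by
  have hr0 : r ≠ 0 := (zero_lt_one.trans_le hr).ne'
  rw [eLpNorm_dot_blockLaw hn hp hU]
  refine ENNReal.mul_ne_top (eLpNorm_radialLaw_ne_top hn hp hU hUc hprob h2 r) fun htop => ?_
  have h := eLpNorm_dot_blockLawY_le hp u hr hm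
  rw [eLpNorm_dot_blockLawY hn hp, htop,
    ENNReal.mul_top (eLpNorm_radialLawY_pos hn hp hr0).1, top_le_iff] at h
  exact ENNReal.ofReal_ne_top h

end Block

/-! ### Isotropic blocks -/

section Isotropic

variable {n : ℕ} {p : ℝ} {U : ℝ → ℝ}

theorem dot_single (x : Fin n → ℝ) (i : Fin n) : dot x (Pi.single i 1) = x i := by
  simp [dot, Pi.single_apply]

theorem eLpNorm_coord_blockLawY (hp : 1 < p) (i : Fin n) :
    eLpNorm (fun x => x i) (2 : ℝ≥0) (blockLawY n p) = 1 := by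
  have := isProbabilityMeasure_coordLaw hp
  rw [blockLawY_eq_pi n hp]
  have h := eLpNorm_comp_measurePreserving (p := ((2 : ℝ≥0) : ℝ≥0∞)) (g := fun y : ℝ => y)
    measurable_id.aestronglyMeasurable (measurePreserving_eval (fun _ : Fin n => coordLaw p) i)
  refine h.trans ?_
  rw [eLpNorm_eq_lintegral_rpow_enorm_toReal (by simp) (by simp)]
  simp only [ENNReal.coe_toReal, NNReal.coe_ofNat]
  rw [lintegral_sq_coordLaw hp, ENNReal.one_rpow]

/-- In the isotropic position the radial part of a block and the model one have the same second
moment. -/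
theorem eLpNorm_two_radialLaw (hn : 1 ≤ n) (hp : 1 < p) (hU : MonotoneOn U (Ici 0))
    (hiso : ∀ i : Fin n, eLpNorm (fun x => x i) (2 : ℝ≥0) (blockLaw n p U) = 1) :
    eLpNorm (fun s => s) (2 : ℝ≥0) (radialLaw n p U) =
      eLpNorm (fun s => s) (2 : ℝ≥0) (radialLawY n p) := by
  set i : Fin n := ⟨0, hn⟩
  have h1 := eLpNorm_dot_blockLaw hn hp hU (Pi.single i 1) 2
  have h2 := eLpNorm_dot_blockLawY hn hp (Pi.single i 1) 2
  simp_rw [dot_single] at h1 h2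
  rw [hiso] at h1
  rw [eLpNorm_coord_blockLawY hp] at h2
  rw [ENNReal.eq_inv_of_mul_eq_one_left h1.symm, ENNReal.eq_inv_of_mul_eq_one_left h2.symm]

theorem normP_mul_normW (hn : 1 ≤ n) (hp : 1 < p) (hU : MonotoneOn U (Ici 0))
    (hiso : ∀ i : Fin n, eLpNorm (fun x => x i) (2 : ℝ≥0) (blockLaw n p U) = 1)
    (u : Fin n → ℝ) (r : ℝ≥0) :
    normP n p U r * normW n p U u r = eLpNorm (fun x => dot x u) r (blockLaw n p U) := by
  have h2 := eLpNorm_two_radialLaw hn hp hU hiso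
  obtain ⟨hpos, htop⟩ := eLpNorm_radialLawY_pos hn hp (r := 2) (by norm_num)
  have hl : l2 (radialLaw n p U) ≠ 0 := by
    have : eLpNorm (fun s => s) 2 (radialLaw n p U) = eLpNorm (fun s => s) (2 : ℝ≥0)
      (radialLaw n p U) := rfl
    rw [l2, this, h2]
    exact (ENNReal.toReal_pos hpos htop).ne'
  rw [eLpNorm_dot_blockLaw hn hp hU]
  unfold normP normW
  set c := l2 (radialLaw n p U)
  have e1 : (fun s : ℝ => s / c) = c⁻¹ • fun s : ℝ => s := by
    ext s; simp [div_eq_inv_mul]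
  have e2 : (fun v : Fin n → ℝ => dot (c • v) u) = c • fun v => dot v u := by
    ext v; simp [dot_smul]
  rw [e1, e2, eLpNorm_const_smul, eLpNorm_const_smul, mul_mul_mul_comm, ← enorm_mul,
    inv_mul_cancel₀ hl]
  simp

/-- The direction `W_k` is scaled by the second moment of the radial part of `X_k`, which agrees
with that of `Y_k` by isotropy. -/
theorem normQ_mul_normW (hn : 1 ≤ n) (hp : 1 < p) (hU : MonotoneOn U (Ici 0))
    (hiso : ∀ i : Fin n, eLpNorm (fun x => x i) (2 : ℝ≥0) (blockLaw n p U) = 1)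
    (u : Fin n → ℝ) (r : ℝ≥0) :
    normQ n p r * normW n p U u r = eLpNorm (fun x => dot x u) r (blockLawY n p) := by
  have h := normP_mul_normW hn hp (monotoneOn_modelPotential n hp)
    (by rw [← blockLawY_eq_blockLaw n hp]; exact eLpNorm_coord_blockLawY hp) u r
  rw [← blockLawY_eq_blockLaw n hp] at h
  rw [← h]
  have hl : l2 (radialLaw n p U) = l2 (radialLaw n p (modelPotential n p)) := by
    have h2 := eLpNorm_two_radialLaw hn hp hU hiso
    rw [radialLawY_eq_radialLaw hn hp] at h2
    exact congrArg ENNReal.toReal h2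
  unfold normQ normP normW
  rw [hl, radialLawY_eq_radialLaw hn hp]

theorem eLpNorm_radialLawY_growth (hn : 1 ≤ n) (hp : 1 < p) {r₀ r₁ : ℝ≥0} (h0 : 1 ≤ r₀)
    (h1 : r₀ ≤ r₁) :
    eLpNorm (fun s => s) r₀ (radialLawY n p) ≤ eLpNorm (fun s => s) r₁ (radialLawY n p) ∧
    eLpNorm (fun s => s) r₁ (radialLawY n p) ≤
      ENNReal.ofReal (12 * ((n + r₁) / (n + r₀)) ^ (1 / p)) *
        eLpNorm (fun s => s) r₀ (radialLawY n p) := by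
  have hY := isProbabilityMeasure_blockLawY n hp
  rw [blockLawY_eq_blockLaw n hp] at hY
  have hfin := (eLpNorm_radialLawY_pos hn hp (zero_lt_one.trans_le h0).ne').2
  rw [radialLawY_eq_radialLaw hn hp] at hfin ⊢
  exact ⟨eLpNorm_radialLaw_mono hn hp (monotoneOn_modelPotential n hp) hY h1,
    eLpNorm_radialLaw_le hn hp (monotoneOn_modelPotential n hp) (convexOn_modelPotential n p) hY
      h0 h1 hfin⟩

/-- Doubling `n + r` changes the moments of the radial part by a bounded factor only; in
particular they are all comparable for orders up to the dimension `n`. -/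
theorem growth_le_two (hn : 1 ≤ n) (hp : 1 < p) {r₀ r₁ : ℝ} (h0 : 0 ≤ r₀)
    (h : n + r₁ ≤ 2 * (n + r₀)) (h1 : 0 ≤ r₁) :
    12 * ((n + r₁) / (n + r₀)) ^ (1 / p) ≤ 24 := by
  have hn' : (1 : ℝ) ≤ n := by exact_mod_cast hn
  have hp0 : 0 < p := by linarith
  have h1 : ((n + r₁) / (n + r₀)) ^ (1 / p) ≤ 2 := by
    calc ((n + r₁) / (n + r₀)) ^ (1 / p) ≤ (2 : ℝ) ^ (1 / p) := by
          have : 0 ≤ (n + r₁) / (n + r₀) := by positivity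
          gcongr
          rw [div_le_iff₀ (by linarith)]
          exact h
      _ ≤ (2 : ℝ) ^ (1 : ℝ) :=
          Real.rpow_le_rpow_of_exponent_le (by norm_num) (by rw [div_le_one hp0]; exact hp.le)
      _ = 2 := Real.rpow_one 2
  linarith

/-- The second moments of the two radial parts agree, and from the order `2` on the moments of
the model one grow the fastest. -/
theorem eLpNorm_radialLaw_le_radialLawY (hn : 1 ≤ n) (hp : 1 < p) (hU : MonotoneOn U (Ici 0))
    (hUc : ConvexOn ℝ (Ici 0) U) (hprob : IsProbabilityMeasure (blockLaw n p U))
    (hiso : ∀ i : Fin n, eLpNorm (fun x => x i) (2 : ℝ≥0) (blockLaw n p U) = 1)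
    {r : ℝ≥0} (hr : 1 ≤ r) :
    eLpNorm (fun s => s) r (radialLaw n p U) ≤ 144 * eLpNorm (fun s => s) r (radialLawY n p) := by
  have hp0 : 0 < p := by linarith
  have hn' : (1 : ℝ) ≤ n := by exact_mod_cast hn
  have hr1 : (1 : ℝ) ≤ r := by exact_mod_cast hr
  have hr0 : r ≠ 0 := (zero_lt_one.trans_le hr).ne'
  have h2 := eLpNorm_two_radialLaw hn hp hU hiso
  have h2top := (eLpNorm_radialLawY_pos hn hp (r := 2) (by norm_num)).2
  rcases le_total r 2 with h | h
  · have hr2 : (r : ℝ) ≤ 2 := by exact_mod_cast h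
    calc _ ≤ eLpNorm (fun s => s) (2 : ℝ≥0) (radialLaw n p U) :=
          eLpNorm_radialLaw_mono hn hp hU hprob h
      _ ≤ ENNReal.ofReal (12 * ((n + (2 : ℝ≥0)) / (n + r)) ^ (1 / p)) *
          eLpNorm (fun s => s) r (radialLawY n p) := by
          rw [h2]
          exact (eLpNorm_radialLawY_growth hn hp hr h).2
      _ ≤ _ := by
          refine mul_le_mul' ?_ le_rfl
          refine (ENNReal.ofReal_le_ofReal (growth_le_two hn hp r.coe_nonneg ?_ (by simp))).trans ?_
          · push_cast; linarith
          · rw [ENNReal.ofReal_ofNat]; norm_num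
  · have hr2 : (2 : ℝ) ≤ r := by exact_mod_cast h
    have hgrow := eLpNorm_radialLaw_le hn hp hU hUc hprob (by norm_num) h (by rw [h2]; exact h2top)
    rw [h2] at hgrow
    refine hgrow.trans ?_
    have hb := bConst_pos hp0
    rw [eLpNorm_radialLawY hn hp hr0, eLpNorm_radialLawY hn hp (by norm_num),
      show (144 : ℝ≥0∞) = ENNReal.ofReal 144 by rw [ENNReal.ofReal_ofNat],
      ← ENNReal.ofReal_mul (by positivity), ← ENNReal.ofReal_mul (by norm_num)]
    apply ENNReal.ofReal_le_ofReal
    have hup := gammaMoment_rpow_le hn hp0 (r := 2) (by norm_num)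
    have hlow := le_gammaMoment_rpow hn hp hr1
    have e : ((n + r) / p : ℝ) ^ (1 / p) =
        ((n + r) / (n + 2) : ℝ) ^ (1 / p) * ((n + 2) / p : ℝ) ^ (1 / p) := by
      rw [← Real.mul_rpow (by positivity) (by positivity)]
      congr 1
      field_simp
    rw [e] at hlow
    push_cast
    set β := bConst p ^ (-(1 / p))
    have hβ : 0 ≤ β := by positivity
    have hF : 0 ≤ ((n + r) / (n + 2) : ℝ) ^ (1 / p) := by positivity
    calc 12 * ((n + r) / (n + 2) : ℝ) ^ (1 / p) * (β * gammaMoment n p 2 ^ (1 / 2 : ℝ))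
        ≤ 12 * ((n + r) / (n + 2) : ℝ) ^ (1 / p) * (β * ((n + 2) / p : ℝ) ^ (1 / p)) := by gcongr
      _ = 144 * (β * (1 / 12 * (((n + r) / (n + 2) : ℝ) ^ (1 / p) *
          ((n + 2) / p : ℝ) ^ (1 / p)))) := by ring
      _ ≤ _ := by gcongr

/-- For `r ≤ n` both radial parts have `r`-th moments of the order of their common second moment. -/
theorem eLpNorm_radialLawY_le_radialLaw (hn : 1 ≤ n) (hp : 1 < p) (hU : MonotoneOn U (Ici 0))
    (hUc : ConvexOn ℝ (Ici 0) U) (hprob : IsProbabilityMeasure (blockLaw n p U))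
    (hiso : ∀ i : Fin n, eLpNorm (fun x => x i) (2 : ℝ≥0) (blockLaw n p U) = 1)
    {r : ℝ≥0} (hr : 1 ≤ r) (hrn : r ≤ n) :
    eLpNorm (fun s => s) r (radialLawY n p) ≤ 576 * eLpNorm (fun s => s) r (radialLaw n p U) := by
  have hn' : (1 : ℝ) ≤ n := by exact_mod_cast hn
  have hr1 : (1 : ℝ) ≤ r := by exact_mod_cast hr
  have hrn' : (r : ℝ) ≤ n := by exact_mod_cast hrn
  have h2 := eLpNorm_two_radialLaw hn hp hU hiso
  have h2top := (eLpNorm_radialLawY_pos hn hp (r := 2) (by norm_num)).2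
  have hfin := eLpNorm_radialLaw_ne_top hn hp hU hUc hprob (by rw [h2]; exact h2top) r
  have hY2 : eLpNorm (fun s => s) r (radialLawY n p) ≤
      24 * eLpNorm (fun s => s) (2 : ℝ≥0) (radialLawY n p) := by
    rcases le_total r 2 with h | h
    · refine (eLpNorm_radialLawY_growth hn hp hr h).1.trans ?_
      exact le_mul_of_one_le_left' (by norm_num)
    · refine (eLpNorm_radialLawY_growth hn hp (by norm_num) h).2.trans (mul_le_mul' ?_ le_rfl)
      refine (ENNReal.ofReal_le_ofReal (growth_le_two hn hp (by simp) ?_ r.coe_nonneg)).trans ?_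
      · push_cast; linarith
      · rw [ENNReal.ofReal_ofNat]
  have hX2 : eLpNorm (fun s => s) (2 : ℝ≥0) (radialLaw n p U) ≤
      24 * eLpNorm (fun s => s) r (radialLaw n p U) := by
    rcases le_total r 2 with h | h
    · refine (eLpNorm_radialLaw_le hn hp hU hUc hprob hr h hfin).trans (mul_le_mul' ?_ le_rfl)
      refine (ENNReal.ofReal_le_ofReal (growth_le_two hn hp r.coe_nonneg ?_ (by simp))).trans ?_
      · push_cast; linarith
      · rw [ENNReal.ofReal_ofNat]
    · refine (eLpNorm_radialLaw_mono hn hp hU hprob h).trans ?_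
      exact le_mul_of_one_le_left' (by norm_num)
  rw [← h2] at hY2
  calc _ ≤ _ := hY2
    _ ≤ 24 * (24 * eLpNorm (fun s => s) r (radialLaw n p U)) := by gcongr
    _ = _ := by rw [← mul_assoc]; norm_num

end Isotropic

/-! ### Structured vectors and cube-like sets -/

section Final

variable {M : ℕ} {n : Fin M → ℕ} {p : Fin M → ℝ} {U : Fin M → ℝ → ℝ}

/-- Of the isotropy only the unit variance of the coordinates matters. -/
theorem IsStructured.eLpNorm_coord (h : IsStructured n p U) (k : Fin M) (i : Fin (n k)) :
    eLpNorm (fun x => x i) (2 : ℝ≥0) (blockLaw (n k) (p k) (U k)) = 1 := by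
  have := h.prob
  have hcov := h.cov ⟨k, i⟩ ⟨k, i⟩
  simp only [covariance, if_true] at hcov
  have hmean := h.mean ⟨k, i⟩
  simp only at hmean
  rw [hmean] at hcov
  simp only [sub_zero] at hcov
  have hm : Measurable fun x : Fin (n k) → ℝ => x i := measurable_pi_apply i
  have hcomp := eLpNorm_comp_measurePreserving (p := ((2 : ℝ≥0) : ℝ≥0∞)) hm.aestronglyMeasurable
    (measurePreserving_eval (fun k => blockLaw (n k) (p k) (U k)) k)
  rw [← hcomp, eLpNorm_eq_lintegral_rpow_enorm_toReal (by simp) (by simp)]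
  -- a nonintegrable square would have the junk value `0` for its integral
  have hint : Integrable (fun x : Vec n => x k i * x k i) (lawX n p U) := by
    by_contra hcon
    rw [integral_undef hcon] at hcov
    norm_num at hcov
  have hl := ofReal_integral_eq_lintegral_ofReal hint
    (Filter.Eventually.of_forall fun x => mul_self_nonneg _)
  rw [hcov, ENNReal.ofReal_one] at hl
  have e : ∀ x : Vec n, ‖((fun x : Fin (n k) → ℝ => x i) ∘ Function.eval k) x‖ₑ ^
      (((2 : ℝ≥0) : ℝ≥0∞).toReal) = ENNReal.ofReal (x k i * x k i) := by
    intro x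
    simp only [Function.comp, Function.eval, ENNReal.coe_toReal, NNReal.coe_ofNat]
    rw [Real.enorm_eq_ofReal_abs, ENNReal.ofReal_rpow_of_nonneg (abs_nonneg _) (by norm_num),
      Real.rpow_two, sq_abs, sq]
  simp_rw [e]
  change (∫⁻ x, _ ∂(lawX n p U)) ^ _ = 1
  rw [← hl, ENNReal.one_rpow]

theorem eLpNorm_dot_pi (μ : ∀ k, Measure (Fin (n k) → ℝ)) [∀ k, IsProbabilityMeasure (μ k)]
    (k : Fin M) (u : Fin (n k) → ℝ) (r : ℝ≥0∞) :
    eLpNorm (fun x : Vec n => dot (x k) u) r (Measure.pi μ) =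
      eLpNorm (fun x => dot x u) r (μ k) :=
  eLpNorm_comp_measurePreserving (g := fun x => dot x u) (measurable_dot u).aestronglyMeasurable
    (measurePreserving_eval μ k)

theorem proc_sub_proc (t s : Vec n) :
    (fun x : Vec n => proc t x - proc s x) = fun x => ∑ k, dot (x k) (t k - s k) := by
  ext x
  simp [proc, dot, ← Finset.sum_sub_distrib, mul_sub]

variable {C δ ρ q : ℝ} {κ : Vec n} {T : Finset (Vec n)}

/-- The smallness of `δ` forces `ρ ≤ e ^ (-2)`: for larger `ρ ≤ e ^ (-1)` the quotient
`ρ / log (1/ρ)` would exceed `e ^ (-2) / 2 ≥ 4 C δ`. -/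
theorem IsCubeLike.log_ge_two (h : IsCubeLike n p U C δ ρ q κ T) (hC : 1 ≤ C)
    (hδ : δ ≤ Real.exp (-2) / (8 * C)) : 2 ≤ Real.log (1 / ρ) := by
  have hρ := h.rho_pos
  by_contra hcon
  push Not at hcon
  have hlog : Real.log (1 / ρ) = -Real.log ρ := by rw [one_div, Real.log_inv]
  have h1 : 1 ≤ Real.log (1 / ρ) := by
    rw [hlog, le_neg, Real.log_le_iff_le_exp hρ]
    exact h.rho_le
  have h2 : Real.exp (-2) < ρ := by
    rw [← Real.lt_log_iff_exp_lt hρ]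
    linarith
  have h3 := h.rho_eq
  rw [div_eq_iff (by linarith)] at h3
  have h4 : 4 * C * δ ≤ Real.exp (-2) / 2 := by
    rw [le_div_iff₀ (by linarith)] at hδ
    linarith
  nlinarith [Real.exp_pos (-2)]

/-- Two points of a cube-like set agree at a coordinate as soon as both are nonzero there. -/
theorem IsCubeLike.blockSupp_symmDiff (h : IsCubeLike n p U C δ ρ q κ T) {s t : Vec n}
    (hs : s ∈ T) (ht : t ∈ T) (k : Fin M) :
    blockSupp t k ∆ blockSupp s k = Finset.univ.filter fun i => (t k - s k) i ≠ 0 := by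
  ext i
  have hκ : 0 < κ k i := h.rho_pos.trans_le (h.side k i)
  simp only [blockSupp, Finset.mem_symmDiff, Finset.mem_filter_univ, abs_pos, Pi.sub_apply,
    ne_eq, not_not]
  rcases h.cube s hs k i with h1 | h1 <;> rcases h.cube t ht k i with h2 | h2 <;>
    simp [h1, h2, hκ.ne']

/-- Few coordinates change along an increment. A point has at most
`2 C δ q / ρ = q / (2 log (1/ρ))` nonzero coordinates, since each of them is at least `ρ`, so an
increment has at most `q / log (1/ρ) ≤ q / 2`. -/
theorem IsCubeLike.two_mul_sum_card_le (h : IsCubeLike n p U C δ ρ q κ T)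
    (hlog : 2 ≤ Real.log (1 / ρ)) {s t : Vec n} (hs : s ∈ T) (ht : t ∈ T) :
    2 * ∑ k, ((blockSupp t k ∆ blockSupp s k).card : ℝ) ≤ q := by
  have hρ := h.rho_pos
  have hsupp : ∀ t ∈ T, ρ * ∑ k, ((blockSupp t k).card : ℝ) ≤ 2 * C * δ * q := by
    intro t ht
    refine le_trans ?_ (h.thin t ht)
    rw [Finset.mul_sum]
    refine Finset.sum_le_sum fun k _ => ?_
    rw [mul_comm, ← nsmul_eq_mul]
    exact Finset.card_nsmul_le_sum _ _ _ fun i _ => h.side k i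
  have hcard : ∑ k, ((blockSupp t k ∆ blockSupp s k).card : ℝ) ≤
      ∑ k, ((blockSupp t k).card : ℝ) + ∑ k, ((blockSupp s k).card : ℝ) := by
    rw [← Finset.sum_add_distrib]
    refine Finset.sum_le_sum fun k _ => ?_
    have : (blockSupp t k ∆ blockSupp s k).card ≤ (blockSupp t k).card + (blockSupp s k).card :=
      (Finset.card_le_card (symmDiff_le_sup (a := blockSupp t k) (b := blockSupp s k))).trans
        (Finset.card_union_le _ _)
    exact_mod_cast this
  have h3 := h.rho_eq
  rw [div_eq_iff (by linarith)] at h3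
  have h1 := hsupp t ht
  have h2 := hsupp s hs
  have hq : 0 ≤ q := by linarith [h.order]
  have hnn : 0 ≤ ∑ k, ((blockSupp t k ∆ blockSupp s k).card : ℝ) :=
    Finset.sum_nonneg fun k _ => Nat.cast_nonneg _
  have h4 : ρ * ∑ k, ((blockSupp t k ∆ blockSupp s k).card : ℝ) ≤ 4 * C * δ * q := by
    nlinarith [mul_le_mul_of_nonneg_left hcard hρ.le]
  have h5 : 0 < 4 * C * δ := by
    rw [← h.rho_eq]
    exact div_pos hρ (by linarith)
  have h6 : 4 * C * δ * (Real.log (1 / ρ) * ∑ k, ((blockSupp t k ∆ blockSupp s k).card : ℝ)) ≤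
      4 * C * δ * q := by
    rw [← mul_assoc, ← h3]
    exact h4
  have h7 := le_of_mul_le_mul_left h6 h5
  nlinarith

/-- The moments of the increments, for any family of blocks with the growth properties of the
`X_k` and the `Y_k`. -/
theorem comparable_eLpNorm_sum_dot (hn : ∀ k, 1 ≤ n k) (hp : ∀ k, 1 < p k)
    (hU : ∀ k, MonotoneOn (U k) (Ici 0)) (hUc : ∀ k, ConvexOn ℝ (Ici 0) (U k))
    (hprob : ∀ k, IsProbabilityMeasure (blockLaw (n k) (p k) (U k)))
    (h2 : ∀ k, eLpNorm (fun s => s) (2 : ℝ≥0) (radialLaw (n k) (p k) (U k)) ≠ ∞)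
    (a : Vec n) {q : ℝ≥0} (hq : q ≠ 0)
    (hm : 2 * ∑ k, ((Finset.univ.filter fun i => a k i ≠ 0).card : ℝ≥0) ≤ q) :
    eLpNorm (fun x => ∑ k, dot (x k) (a k)) q (lawX n p U) ≤
        ((512 * 62208 : ℝ≥0) : ℝ≥0∞) *
          supSplit q (fun k r => eLpNorm (fun x => dot x (a k)) r (blockLaw (n k) (p k) (U k)))
            (fun k => (Finset.univ.filter fun i => a k i ≠ 0).card) ∧
      supSplit q (fun k r => eLpNorm (fun x => dot x (a k)) r (blockLaw (n k) (p k) (U k)))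
          (fun k => (Finset.univ.filter fun i => a k i ≠ 0).card) ≤
        ((2 * (8 * (4 * 62208) ^ 2) ^ 2 : ℝ≥0) : ℝ≥0∞) *
          eLpNorm (fun x => ∑ k, dot (x k) (a k)) q (lawX n p U) := by
  have hZ : ∀ k, Measurable fun x : Fin (n k) → ℝ => dot x (a k) := fun k => measurable_dot (a k)
  have hzero : ∀ k, (Finset.univ.filter fun i => a k i ≠ 0).card = 0 →
      (fun x : Fin (n k) → ℝ => dot x (a k)) = 0 := by
    intro k hk
    have : a k = 0 := by
      ext i
      by_contra hi
      exact (Finset.card_ne_zero_of_mem (Finset.mem_filter.2 ⟨Finset.mem_univ i, hi⟩)) hk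
    ext x
    simp [this, dot]
  have hone : ∀ {m : ℕ} {r : ℝ≥0}, 1 ≤ m → (m : ℝ≥0) ≤ r → 1 ≤ r := fun h h' =>
    le_trans (by exact_mod_cast h) h'
  have hfin : ∀ k, 1 ≤ (Finset.univ.filter fun i => a k i ≠ 0).card → ∀ r : ℝ≥0,
      ((Finset.univ.filter fun i => a k i ≠ 0).card : ℝ≥0) ≤ r →
      eLpNorm (fun x : Fin (n k) → ℝ => dot x (a k)) r (blockLaw (n k) (p k) (U k)) ≠ ∞ :=
    fun k hk r hr => eLpNorm_dot_blockLaw_ne_top (hn k) (hp k) (hU k) (hUc k) (hprob k) (h2 k)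
      _ (hone hk hr) hr
  have hreg : ∀ k, 1 ≤ (Finset.univ.filter fun i => a k i ≠ 0).card → ∀ r l : ℝ≥0,
      ((Finset.univ.filter fun i => a k i ≠ 0).card : ℝ≥0) ≤ r → 1 ≤ l →
      eLpNorm (fun x : Fin (n k) → ℝ => dot x (a k)) ((l * r : ℝ≥0) : ℝ≥0∞)
          (blockLaw (n k) (p k) (U k)) ≤
        ((62208 * l ^ 2 : ℝ≥0) : ℝ≥0∞) *
          eLpNorm (fun x : Fin (n k) → ℝ => dot x (a k)) r (blockLaw (n k) (p k) (U k)) :=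
    fun k hk r l hr hl => eLpNorm_dot_blockLaw_mul_le (hn k) (hp k) (hU k) (hUc k) (hprob k)
      (h2 k) _ (hone hk hr) hl hr
  have hB : (1 : ℝ≥0) ≤ 62208 := by norm_num
  have hm' : ∑ k, ((Finset.univ.filter fun i => a k i ≠ 0).card : ℝ≥0) ≤ q :=
    (le_mul_of_one_le_left' one_le_two).trans hm
  generalize (62208 : ℝ≥0) = B at hreg hB ⊢
  have hup := eLpNorm_sum_le_supSplit (μ := fun k => blockLaw (n k) (p k) (U k))
    (Z := fun k x => dot x (a k)) hZ hq hm hzero hfin hreg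
  have hlow := supSplit_le_eLpNorm_sum (μ := fun k => blockLaw (n k) (p k) (U k))
    (Z := fun k x => dot x (a k)) hZ hB hq hm' hzero (fun k c => blockLaw_symmetric (hU k) _ c)
    hfin hreg
  exact ⟨hup, hlow⟩

theorem comparable_of_le {K₁ K₂ K : ℝ≥0} {a b : ℝ≥0∞} (h₁ : a ≤ K₁ * b) (h₂ : b ≤ K₂ * a)
    (hK₁ : K₁ ≤ K) (hK₂ : K₂ ≤ K) : Comparable K a b :=
  ⟨h₁.trans (by gcongr), h₂.trans (by gcongr)⟩

end Final

end RadialProduct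

open RadialProduct in
theorem proposition4p5 :
    ∃ K : ℝ≥0, ∀ C : ℝ, 1 ≤ C → ∃ δ₀ : ℝ, 0 < δ₀ ∧ ∀ δ : ℝ, 0 < δ → δ ≤ δ₀ →
      ∀ (M : ℕ) (n : Fin M → ℕ) (p : Fin M → ℝ) (U : Fin M → ℝ → ℝ),
        RadialProduct.IsStructured n p U →
      ∀ (ρ q : ℝ) (κ : RadialProduct.Vec n) (T : Finset (RadialProduct.Vec n)),
        RadialProduct.IsCubeLike n p U C δ ρ q κ T →
      ∀ s ∈ T, ∀ t ∈ T,
        -- the moments of the increments of the process based on X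
        RadialProduct.Comparable K
          (eLpNorm (fun x => RadialProduct.proc t x - RadialProduct.proc s x)
            (ENNReal.ofReal q) (RadialProduct.lawX n p U))
          (RadialProduct.supSplit q
            (fun k r => RadialProduct.normP (n k) (p k) (U k) r *
              RadialProduct.normW (n k) (p k) (U k) (t k - s k) r)
            (fun k => (RadialProduct.blockSupp t k ∆ RadialProduct.blockSupp s k).card)) ∧
        -- the moments of the increments of the process based on Y
        RadialProduct.Comparable K
          (eLpNorm (fun y => RadialProduct.proc t y - RadialProduct.proc s y)
            (ENNReal.ofReal q) (RadialProduct.lawY n p))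
          (RadialProduct.supSplit q
            (fun k r => RadialProduct.normQ (n k) (p k) r *
              RadialProduct.normW (n k) (p k) (U k) (t k - s k) r)
            (fun k => (RadialProduct.blockSupp t k ∆ RadialProduct.blockSupp s k).card)) ∧
        -- the moments of the single blocks
        ∀ (k : Fin M) (r : ℝ≥0),
          ((RadialProduct.blockSupp t k ∆ RadialProduct.blockSupp s k).card : ℝ≥0) ≤ r →
          RadialProduct.normQ (n k) (p k) r *
              RadialProduct.normW (n k) (p k) (U k) (t k - s k) r =
            eLpNorm (fun y => RadialProduct.dot (y k) (t k - s k)) r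
              (RadialProduct.lawY n p) ∧
          RadialProduct.Comparable K
            (eLpNorm (fun y => RadialProduct.dot (y k) (t k - s k)) r
              (RadialProduct.lawY n p))
            (ENNReal.ofReal ((r : ℝ) ^ (1 / p k) *
              RadialProduct.ellNorm (p k).conjExponent (t k - s k))) ∧
          RadialProduct.normP (n k) (p k) (U k) r *
              RadialProduct.normW (n k) (p k) (U k) (t k - s k) r =
            eLpNorm (fun x => RadialProduct.dot (x k) (t k - s k)) r
              (RadialProduct.lawX n p U) ∧
          eLpNorm (fun x => RadialProduct.dot (x k) (t k - s k)) r
              (RadialProduct.lawX n p U) ≤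
            K * eLpNorm (fun y => RadialProduct.dot (y k) (t k - s k)) r
              (RadialProduct.lawY n p) ∧
          (r ≤ n k →
            eLpNorm (fun y => RadialProduct.dot (y k) (t k - s k)) r
                (RadialProduct.lawY n p) ≤
              K * eLpNorm (fun x => RadialProduct.dot (x k) (t k - s k)) r
                (RadialProduct.lawX n p U)) := by
  -- `62208 = 12 * 12 * 432` is the regularity constant of the blocks, the product of the factor
  -- `12` for the radius and the ratio `12 * 432` of the two bounds for the model block
  refine ⟨2 * (8 * (4 * 62208) ^ 2) ^ 2, fun C hC => ⟨Real.exp (-2) / (8 * C), by positivity,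
    fun δ hδ hδ₀ M n p U hX ρ q κ T hT s hs t ht => ?_⟩⟩
  have hn := hX.block_pos
  have hp := hX.one_lt
  have hU := hX.increasing
  have hUc := hX.convex
  have hprob := hX.prob
  have hiso := hX.eLpNorm_coord
  have hYprob : ∀ k, IsProbabilityMeasure (blockLawY (n k) (p k)) := fun k =>
    isProbabilityMeasure_blockLawY (n k) (hp k)
  have hY2 : ∀ k, eLpNorm (fun s => s) (2 : ℝ≥0) (radialLawY (n k) (p k)) ≠ ∞ := fun k =>
    (eLpNorm_radialLawY_pos (hn k) (hp k) (by norm_num)).2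
  have hX2 : ∀ k, eLpNorm (fun s => s) (2 : ℝ≥0) (radialLaw (n k) (p k) (U k)) ≠ ∞ := fun k => by
    rw [eLpNorm_two_radialLaw (hn k) (hp k) (hU k) (hiso k)]
    exact hY2 k
  have hYlaw : lawY n p = lawX n p fun k => modelPotential (n k) (p k) := by
    unfold lawY lawX
    congr 1
    ext k : 1
    exact blockLawY_eq_blockLaw (n k) (hp k)
  have hYblock : ∀ k, blockLawY (n k) (p k) = blockLaw (n k) (p k) (modelPotential (n k) (p k)) :=
    fun k => blockLawY_eq_blockLaw (n k) (hp k)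
  have hcard := hT.two_mul_sum_card_le (hT.log_ge_two hC hδ₀) hs ht
  have hq0 : 0 < q := by linarith [hT.order]
  simp only [hT.blockSupp_symmDiff hs ht] at hcard ⊢
  set a : Vec n := fun k => t k - s k with ha
  lift q to ℝ≥0 using hq0.le
  have hq : q ≠ 0 := by
    rintro rfl
    simp at hq0
  have hm : 2 * ∑ k, ((Finset.univ.filter fun i => a k i ≠ 0).card : ℝ≥0) ≤ q := by
    exact_mod_cast hcard
  have hP : ∀ (k : Fin M) (r : ℝ≥0), normP (n k) (p k) (U k) r *
      normW (n k) (p k) (U k) (t k - s k) r =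
        eLpNorm (fun x => dot x (a k)) r (blockLaw (n k) (p k) (U k)) := fun k r =>
    normP_mul_normW (hn k) (hp k) (hU k) (hiso k) _ r
  have hQ : ∀ (k : Fin M) (r : ℝ≥0), normQ (n k) (p k) r *
      normW (n k) (p k) (U k) (t k - s k) r =
        eLpNorm (fun x => dot x (a k)) r (blockLawY (n k) (p k)) := fun k r =>
    normQ_mul_normW (hn k) (hp k) (hU k) (hiso k) _ r
  simp only [hP, hQ, proc_sub_proc, ENNReal.ofReal_coe_nnreal]
  refine ⟨?_, ?_, fun k r hr => ?_⟩
  · obtain ⟨h1, h2⟩ := comparable_eLpNorm_sum_dot hn hp hU hUc hprob hX2 a hq hm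
    exact comparable_of_le h1 h2 (by norm_num) le_rfl
  · obtain ⟨h1, h2⟩ := comparable_eLpNorm_sum_dot hn hp
      (fun k => monotoneOn_modelPotential (n k) (hp k))
      (fun k => convexOn_modelPotential (n k) (p k)) (fun k => hYblock k ▸ hYprob k)
      (fun k => by rw [← radialLawY_eq_radialLaw (hn k) (hp k)]; exact hY2 k) a hq hm
    simp only [← hYlaw, ← hYblock] at h1 h2
    exact comparable_of_le h1 h2 (by norm_num) le_rfl
  have hmX : ∀ r : ℝ≥0∞, eLpNorm (fun x : Vec n => dot (x k) (t k - s k)) r (lawX n p U) =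
      eLpNorm (fun x => dot x (a k)) r (blockLaw (n k) (p k) (U k)) := fun r =>
    eLpNorm_dot_pi _ k _ r
  have hmY : ∀ r : ℝ≥0∞, eLpNorm (fun x : Vec n => dot (x k) (t k - s k)) r (lawY n p) =
      eLpNorm (fun x => dot x (a k)) r (blockLawY (n k) (p k)) := fun r =>
    eLpNorm_dot_pi _ k _ r
  rw [hmX, hmY]
  rcases Nat.eq_zero_or_pos (Finset.univ.filter fun i => a k i ≠ 0).card with h0 | h0
  · -- the increment vanishes on this block
    have hak : a k = 0 := by
      ext i
      by_contra hi
      exact (Finset.card_ne_zero_of_mem (Finset.mem_filter.2 ⟨Finset.mem_univ i, hi⟩)) h0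
    have hz : (fun x : Fin (n k) → ℝ => dot x (a k)) = 0 := by
      ext x
      simp [hak, dot]
    have hE : ellNorm (p k).conjExponent (t k - s k) = 0 := by
      change ellNorm (p k).conjExponent (a k) = 0
      rw [hak]
      exact ellNorm_zero (Real.HolderConjugate.conjExponent (hp k)).symm.pos
    simp [hz, hE, Comparable]
  have hr1 : 1 ≤ r := le_trans (by exact_mod_cast h0) hr
  refine ⟨rfl, ?_, rfl, ?_, fun hrn => ?_⟩
  · refine comparable_of_le (K₁ := 12) (K₂ := 432) ?_ ?_ (by norm_num) (by norm_num)
    · have h := eLpNorm_dot_blockLawY_le (hp k) (a k) hr1 hr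
      rw [ENNReal.ofReal_mul (by norm_num)] at h
      refine h.trans (le_of_eq ?_)
      congr 1
      rw [ENNReal.ofReal_ofNat]
      rfl
    · have h := le_eLpNorm_dot_blockLawY (hp k) (a k) hr1 hr
      refine le_trans (le_of_eq ?_) (mul_le_mul' le_rfl h)
      rw [← ENNReal.ofReal_coe_nnreal, ← ENNReal.ofReal_mul (by positivity)]
      congr 1
      push_cast
      change _ = 432 * (1 / 432 * _)
      ring
  · rw [eLpNorm_dot_blockLaw (hn k) (hp k) (hU k), eLpNorm_dot_blockLawY (hn k) (hp k),
      ← mul_assoc]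
    refine mul_le_mul' ((eLpNorm_radialLaw_le_radialLawY (hn k) (hp k) (hU k) (hUc k) (hprob k)
      (hiso k) hr1).trans (mul_le_mul' ?_ le_rfl)) le_rfl
    rw [show (144 : ℝ≥0∞) = ((144 : ℝ≥0) : ℝ≥0∞) from rfl]
    exact ENNReal.coe_le_coe.2 (by norm_num)
  · rw [eLpNorm_dot_blockLaw (hn k) (hp k) (hU k), eLpNorm_dot_blockLawY (hn k) (hp k),
      ← mul_assoc]
    refine mul_le_mul' ((eLpNorm_radialLawY_le_radialLaw (hn k) (hp k) (hU k) (hUc k) (hprob k)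
      (hiso k) hr1 hrn).trans (mul_le_mul' ?_ le_rfl)) le_rfl
    rw [show (576 : ℝ≥0∞) = ((576 : ℝ≥0) : ℝ≥0∞) from rfl]
    exact ENNReal.coe_le_coe.2 (by norm_num)
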